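/- Let $0<q<1$ and use the notation $(a;q)_n=\prod_{k=0}^{n-1}(1-aq^k)$, $(a;q)_{-n}=\prod_{k=1}^{n}(1-aq^{-k})^{-1}$ for $n\in\mathbb N=\{0,1,2,\dots\}$, $(a;q)_\infty=\prod_{k\ge 0}(1-aq^k)$, $(a_1,\dots,a_r;q)_\infty=\prod_i(a_i;q)_\infty$ and ${}_0\varphi_1(-;b;q,z)=\sum_{k\ge0}\frac{q^{k(k-1)}z^k}{(b;q)_k(q;q)_k}$. Let $h_n(x|q)$ be the continuous $q^{-1}$-Hermite polynomials, $$2x\,h_n(x|q)=h_{n+1}(x|q)+q^{-n}(1-q^n)h_{n-1}(x|q),\qquad h_{-1}=0,\ h_0=1,$$ and for $\alpha\in(q,1]$, $l\in\mathbb Z$ put $$x_l(\alpha)=\tfrac12\bigl((\alpha q^l)^{-1}-\alpha q^l\bigr),\qquad w_l(\alpha)=\alpha^{4l}q^{2l^2-l}(1+\alpha^2q^{2l}),\qquad \mu_\alpha=\sum_{l\in\mathbb Z}w_l(\alpha)\,\delta_{x_l(\alpha)} .$$ Let $L$ be the bounded operator on $\ell^2(\mathbb Z)$ with $L e_l=a_le_{l+1}+b_le_l+a_{l-1}e_{l-1}$,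 where $$a_l=\frac{\alpha^2q^{2l+\frac12}}{1+\alpha^2q^{2l+1}}\frac1{\sqrt{(1+\alpha^2q^{2l})(1+\alpha^2q^{2l+2})}},\qquad b_l=\frac{\alpha^2(1+q)q^{2l-1}}{(1+\alpha^2q^{2l+1})(1+\alpha^2q^{2l-1})}.$$ For $z\ne0$ put $$(\phi_z)_l=C_l(\alpha)\,z^{-l}\,{}_0\varphi_1\Bigl(-;-\alpha^2q^{2l+1};q,-\frac{\alpha^2q^{2l+1}}{z}\Bigr),\qquad C_l(\alpha)=\frac{\alpha^{2l}q^{l^2-\frac12l}\sqrt{1+\alpha^2q^{2l}}}{(-\alpha^2q;q)_{2l}} .$$ (1) For every $\alpha\in(q,1]$ the operator $L$ is compact and self-adjoint, its spectrum is $\{q^n: n\in\mathbb N\}\cup\{0\}$, and $0$ is not an eigenvalue. For every $n\in\mathbb N$ the sequence $\phi_{q^n}$ lies in $\ell^2(\mathbb Z)$, the eigenspace of $L$ for $q^n$ is one-dimensional and spanned by $\phi_{q^n}$, and $$\|\phi_{q^n}\|^2=\frac{(-1/\alpha^2,q;q)_\infty}{(-\alpha^2q;q)_\infty}\,\alpha^{2n+2}\,q^{-\frac12n(n+1)}\,(q;q)_n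 .$$ The $\phi_{q^n}$, $n\in\mathbb N$, form an orthogonal basis of $\ell^2(\mathbb Z)$ (they are pairwise orthogonal and their span is dense). In terms of the polynomials, $$(\phi_{q^n})_l=\frac{\alpha^n}{(-\alpha^2q;q)_\infty}\sqrt{w_l(\alpha)}\;h_n(x_l(\alpha)|q),\qquad l\in\mathbb Z .$$ (2) For every $\alpha\in(q,1]$ and all $n,m\in\mathbb N$, with absolutely convergent sum, $$\sum_{l=-\infty}^\infty\alpha^{4l}q^{2l^2-l}(1+\alpha^2q^{2l})\,h_n(x_l(\alpha)|q)\,h_m(x_l(\alpha)|q)=\delta_{n,m}\,q^{-n(n+1)/2}(q;q)_n\,(-\alpha^2,-q/\alpha^2,q;q)_\infty,$$ and the polynomials are dense in $L^2(\mu_\alpha)$. (3) For every $\xi\in\mathbb R$ there is an $\alpha\in(q,1]$ with $\mu_\alpha(\{\xi\})>0$. Call a nonzero positive Borel measure $\mu$ on $\mathbb R$ with finite moments N-extremal for the $h_n(\cdot|q)$ if the $h_n(\cdot|q)$ are orthogonal with respect to $\mu$ and the polynomials are dense in $L^2(\mu)$. Then $\mu$ is N-extremal if and only if $\mu=c\,\mu_\alpha$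 for some $\alpha\in(q,1]$ and some constant $0<c<\infty$. -/

import Mathlib

open MeasureTheory Polynomial
open scoped ENNReal

noncomputable section

namespace QInvHermite

/-! ### Shifted factorials and the basic hypergeometric series `₀φ₁` -/

/-- `(a;q)_n = ∏_{k=0}^{n-1} (1 - a q^k)` for `n ∈ ℕ`. -/
def qPoch {K : Type*} [Field K] (a q : K) (n : ℕ) : K :=
  ∏ k ∈ Finset.range n, (1 - a * q ^ k)

/-- `(a;q)_n` for `n ∈ ℤ`, where `(a;q)_{-n} = 1 / ∏_{k=1}^{n} (1 - a q^{-k})`. -/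
def qPochInt (a q : ℝ) : ℤ → ℝ
  | Int.ofNat n => qPoch a q n
  | Int.negSucc n => (∏ k ∈ Finset.range (n + 1), (1 - a * q ^ (-(k + 1 : ℤ))))⁻¹

/-- `(a;q)_∞ = ∏_{k=0}^∞ (1 - a q^k)`. -/
def qPochInf (a q : ℝ) : ℝ := ∏' k : ℕ, (1 - a * q ^ k)

/-- `₀φ₁(-; b; q, z) = ∑_k q^{k(k-1)} z^k / ((b;q)_k (q;q)_k)`. -/
def phi01 (b q z : ℂ) : ℂ :=
  ∑' k : ℕ, q ^ (k * (k - 1)) * z ^ k / (qPoch b q k * qPoch q q k)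

/-! ### The Jacobi operator on `ℓ²(ℤ)` -/

/-- The Hilbert space `ℓ²(ℤ)`. -/
abbrev EllTwo : Type := lp (fun _ : ℤ => ℂ) 2

theorem memlp_mul_shift (a : ℤ → ℝ) (M : ℝ) (hM : ∀ k, |a k| ≤ M) (s : ℤ) (v : EllTwo) :
    Memℓp (fun k : ℤ => (a k : ℂ) * v (k + s)) 2 := by
  have h2 : (0 : ℝ) < (2 : ℝ≥0∞).toReal := by norm_num
  have hv := ((lp.memℓp v).summable h2)
  have hs : Summable fun k : ℤ => ‖v (k + s)‖ ^ (2 : ℝ≥0∞).toReal :=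
    (Equiv.addRight s).summable_iff.mpr hv
  refine memℓp_gen (Summable.of_nonneg_of_le (fun k => by positivity) (fun k => ?_)
    (hs.mul_left (M ^ (2 : ℝ≥0∞).toReal)))
  have hM0 : 0 ≤ M := (abs_nonneg _).trans (hM 0)
  rw [← Real.mul_rpow hM0 (norm_nonneg _), norm_mul, Complex.norm_real, Real.norm_eq_abs]
  gcongr
  exact hM k

/-- The bounded operator `(T v)_k = a_k v_{k+s}`, for a bounded real sequence `a`. -/
def mulShift (a : ℤ → ℝ) (M : ℝ) (hM : ∀ k, |a k| ≤ M) (s : ℤ) : EllTwo →L[ℂ] EllTwo :=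
  LinearMap.mkContinuous
    { toFun := fun v => ⟨fun k : ℤ => (a k : ℂ) * v (k + s), memlp_mul_shift a M hM s v⟩
      map_add' := fun v w => by
        ext k
        exact mul_add _ _ _
      map_smul' := fun c v => by
        ext k
        simp [mul_left_comm] }
    M (fun v => by
      have h2 : (0 : ℝ) < (2 : ℝ≥0∞).toReal := by norm_num
      have hM0 : 0 ≤ M := (abs_nonneg _).trans (hM 0)
      have hv := lp.hasSum_norm h2 v
      have hs : HasSum (fun k : ℤ => ‖v (k + s)‖ ^ (2 : ℝ≥0∞).toReal)
          (‖v‖ ^ (2 : ℝ≥0∞).toReal) :=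
        (Equiv.addRight s).hasSum_iff.mpr hv
      refine lp.norm_le_of_tsum_le h2 (by positivity) ?_
      rw [Real.mul_rpow hM0 (norm_nonneg _)]
      have hs' := hs.mul_left (M ^ (2 : ℝ≥0∞).toReal)
      rw [← hs'.tsum_eq]
      refine Summable.tsum_le_tsum (fun k => ?_)
        ((memlp_mul_shift a M hM s v).summable h2) hs'.summable
      rw [← Real.mul_rpow hM0 (norm_nonneg _)]
      simp only [LinearMap.coe_mk, AddHom.coe_mk, norm_mul, Complex.norm_real, Real.norm_eq_abs]
      gcongr
      exact hM k)

theorem mulShift_apply (a : ℤ → ℝ) (M : ℝ) (hM : ∀ k, |a k| ≤ M) (s : ℤ) (v : EllTwo) (k : ℤ) :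
    mulShift a M hM s v k = (a k : ℂ) * v (k + s) := rfl

/-- The coefficient `a_l`. -/
def coeffA (q α : ℝ) (l : ℤ) : ℝ :=
  α ^ 2 * q ^ (2 * (l : ℝ) + 1 / 2) / (1 + α ^ 2 * q ^ (2 * l + 1)) *
    (1 / √((1 + α ^ 2 * q ^ (2 * l)) * (1 + α ^ 2 * q ^ (2 * l + 2))))

/-- The coefficient `b_l`. -/
def coeffB (q α : ℝ) (l : ℤ) : ℝ :=
  α ^ 2 * (1 + q) * q ^ (2 * l - 1) /
    ((1 + α ^ 2 * q ^ (2 * l + 1)) * (1 + α ^ 2 * q ^ (2 * l - 1)))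

theorem abs_coeffA_le {q : ℝ} (hq : 0 < q) (α : ℝ) (l : ℤ) :
    |coeffA q α l| ≤ q ^ (-(1 / 2) : ℝ) := by
  have h0 : 0 ≤ coeffA q α l := by unfold coeffA; positivity
  rw [abs_of_nonneg h0]
  unfold coeffA
  have e : q ^ (2 * (l : ℝ) + 1 / 2) = q ^ (-(1 / 2) : ℝ) * q ^ (2 * l + 1) := by
    rw [← Real.rpow_intCast q (2 * l + 1), ← Real.rpow_add hq]
    congr 1
    push_cast
    ring
  have hp : 0 < q ^ (2 * l + 1) := by positivity
  have hr : 0 < q ^ (-(1 / 2) : ℝ) := by positivity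
  have h1 : α ^ 2 * q ^ (2 * (l : ℝ) + 1 / 2) / (1 + α ^ 2 * q ^ (2 * l + 1))
      ≤ q ^ (-(1 / 2) : ℝ) := by
    rw [e, div_le_iff₀ (by positivity)]
    nlinarith
  have h2 : 1 / √((1 + α ^ 2 * q ^ (2 * l)) * (1 + α ^ 2 * q ^ (2 * l + 2))) ≤ 1 := by
    have hx : 1 ≤ 1 + α ^ 2 * q ^ (2 * l) := le_add_of_nonneg_right (by positivity)
    have hy : 1 ≤ 1 + α ^ 2 * q ^ (2 * l + 2) := le_add_of_nonneg_right (by positivity)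
    have hs : 1 ≤ √((1 + α ^ 2 * q ^ (2 * l)) * (1 + α ^ 2 * q ^ (2 * l + 2))) := by
      rw [Real.one_le_sqrt]
      nlinarith
    rw [div_le_one (by positivity)]
    exact hs
  calc _ ≤ q ^ (-(1 / 2) : ℝ) * 1 := mul_le_mul h1 h2 (by positivity) hr.le
    _ = _ := mul_one _

theorem abs_coeffB_le {q : ℝ} (hq : 0 < q) (α : ℝ) (l : ℤ) :
    |coeffB q α l| ≤ 1 + q := by
  have h0 : 0 ≤ coeffB q α l := by unfold coeffB; positivity
  rw [abs_of_nonneg h0]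
  unfold coeffB
  have hx : 0 ≤ α ^ 2 * q ^ (2 * l + 1) := by positivity
  have hy : 0 ≤ α ^ 2 * q ^ (2 * l - 1) := by positivity
  rw [div_le_iff₀ (by positivity)]
  have h1 : α ^ 2 * q ^ (2 * l - 1) ≤
      (1 + α ^ 2 * q ^ (2 * l + 1)) * (1 + α ^ 2 * q ^ (2 * l - 1)) := by nlinarith
  calc _ = (1 + q) * (α ^ 2 * q ^ (2 * l - 1)) := by ring
    _ ≤ _ := mul_le_mul_of_nonneg_left h1 (by positivity)

/-- The bounded operator `L` on `ℓ²(ℤ)`,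
`(L v)_k = a_k v_{k+1} + b_k v_k + a_{k-1} v_{k-1}`;
see `opL_single` for its action on the standard basis. -/
def opL (q α : ℝ) (hq : 0 < q) : EllTwo →L[ℂ] EllTwo :=
  mulShift (coeffA q α) _ (abs_coeffA_le hq α) 1
    + mulShift (coeffB q α) _ (abs_coeffB_le hq α) 0
    + mulShift (fun k => coeffA q α (k - 1)) _ (fun k => abs_coeffA_le hq α (k - 1)) (-1)

theorem opL_apply (q α : ℝ) (hq : 0 < q) (v : EllTwo) (k : ℤ) :
    opL q α hq v k = (coeffA q α k : ℂ) * v (k + 1) + (coeffB q α k : ℂ) * v k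
      + (coeffA q α (k - 1) : ℂ) * v (k - 1) := by
  simp [opL, mulShift_apply, sub_eq_add_neg]

/-- The standard basis vector `e_l` of `ℓ²(ℤ)`. -/
def basisVec (l : ℤ) : EllTwo := lp.single 2 l (1 : ℂ)

/-- `L e_l = a_l e_{l+1} + b_l e_l + a_{l-1} e_{l-1}`. -/
theorem opL_single (q α : ℝ) (hq : 0 < q) (l : ℤ) :
    opL q α hq (basisVec l) = (coeffA q α l : ℂ) • basisVec (l + 1)
      + (coeffB q α l : ℂ) • basisVec l + (coeffA q α (l - 1) : ℂ) • basisVec (l - 1) := by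
  ext k
  rw [opL_apply]
  simp only [basisVec, lp.coeFn_add, lp.coeFn_smul, Pi.add_apply, Pi.smul_apply,
    lp.single_apply, Pi.single_apply, smul_eq_mul]
  rcases eq_or_ne k l with rfl | h1
  · simp [show k ≠ k - 1 by omega]
  rcases eq_or_ne k (l + 1) with rfl | h2
  · simp [show l + 1 + 1 ≠ l by omega, show l + 1 ≠ l - 1 by omega]
  rcases eq_or_ne k (l - 1) with rfl | h3
  · simp [show l - 1 - 1 ≠ l by omega, show l - 1 ≠ l + 1 by omega]
  have h4 : k + 1 ≠ l := by omega
  have h5 : k - 1 ≠ l := by omega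
  simp [h1, h2, h3, h4, h5]

/-! ### The eigenvectors -/

/-- `C_l(α) = α^{2l} q^{l² - l/2} √(1 + α² q^{2l}) / (-α² q; q)_{2l}`. -/
def coeffC (q α : ℝ) (l : ℤ) : ℝ :=
  α ^ (2 * l) * q ^ ((l : ℝ) ^ 2 - (l : ℝ) / 2) * √(1 + α ^ 2 * q ^ (2 * l)) /
    qPochInt (-(α ^ 2 * q)) q (2 * l)

/-- `(φ_z)_l = C_l(α) z^{-l} ₀φ₁(-; -α² q^{2l+1}; q, -α² q^{2l+1} / z)`. -/
def phi (q α : ℝ) (z : ℂ) (l : ℤ) : ℂ :=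
  (coeffC q α l : ℂ) * z ^ (-l) *
    phi01 (-((α : ℂ) ^ 2 * (q : ℂ) ^ (2 * l + 1))) (q : ℂ)
      (-((α : ℂ) ^ 2 * (q : ℂ) ^ (2 * l + 1)) / z)

/-! ### The continuous `q⁻¹`-Hermite polynomials and their measures -/

/-- The continuous `q⁻¹`-Hermite polynomials: `h_{-1} = 0`, `h_0 = 1`,
`2 x h_n(x|q) = h_{n+1}(x|q) + q^{-n} (1 - q^n) h_{n-1}(x|q)`. -/
def hermite (q : ℝ) : ℕ → ℝ[X]
  | 0 => 1
  | 1 => 2 * X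
  | n + 2 => 2 * X * hermite q (n + 1)
      - C ((q ^ (n + 1))⁻¹ * (1 - q ^ (n + 1))) * hermite q n

/-- The mass points `x_l(α) = ½ ((α q^l)⁻¹ - α q^l)`. -/
def massPoint (q α : ℝ) (l : ℤ) : ℝ := ((α * q ^ l)⁻¹ - α * q ^ l) / 2

/-- The weights `α^{4l} q^{2l² - l} (1 + α² q^{2l})`. -/
def weight (q α : ℝ) (l : ℤ) : ℝ :=
  α ^ (4 * l) * q ^ (2 * l ^ 2 - l) * (1 + α ^ 2 * q ^ (2 * l))

/-- The discrete measure with mass `weight q α l` at `massPoint q α l`, for `l ∈ ℤ`. -/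
def discreteMeasure (q α : ℝ) : Measure ℝ :=
  Measure.sum fun l : ℤ => ENNReal.ofReal (weight q α l) • Measure.dirac (massPoint q α l)

/-- `μ` is a nonzero positive Borel measure on `ℝ` with finite moments with respect to which the
polynomials `p_n` are orthogonal. -/
structure IsOrthogonalityMeasure (p : ℕ → ℝ[X]) (μ : Measure ℝ) : Prop where
  ne_zero : μ ≠ 0
  integrable_pow : ∀ k : ℕ, Integrable (fun x : ℝ => x ^ k) μ
  orthogonal : ∀ n m : ℕ, n ≠ m → ∫ x, (p n).eval x * (p m).eval x ∂μ = 0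

/-- The polynomials are dense in the complex Hilbert space `L²(μ)`. -/
def PolynomialsDense (μ : Measure ℝ) : Prop :=
  ∀ f : ℝ → ℂ, MemLp f 2 μ → ∀ ε : ℝ≥0∞, ε ≠ 0 →
    ∃ P : ℂ[X], eLpNorm (fun x : ℝ => f x - P.eval (x : ℂ)) 2 μ ≤ ε

/-- `μ` is an N-extremal measure for the polynomials `p_n`: an orthogonality measure for which
the polynomials are dense in `L²(μ)`. -/
structure IsNExtremal (p : ℕ → ℝ[X]) (μ : Measure ℝ) : Prop where
  isOrthogonalityMeasure : IsOrthogonalityMeasure p μ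
  dense : PolynomialsDense μ

end QInvHermite

end

namespace QInvHermite

open Filter Topology

/-! ### Infinite shifted factorials -/

/-! Write u = αq^l, so that x_l = (1/u - u)/2. The regularised series F(b,y) = (b;q)_∞
₀φ₁(-;b;q,by), called `phiReg`, satisfies two first-order contiguous relations. Eliminating one way
gives a recurrence in y, the other way a recurrence in b. At b = -u²q and y = q^{-n} the recurrence
in y is the Hermite recurrence, and F(b,1) = 1 supplies its initial value; hence u^n h_n(x_l|q) =
F(-u²q, q^{-n}) (`pow_mul_eval_hermite`). The recurrence in b becomes a second-order q-difference
equation for h_n in u, and conjugation with √w_l turns it into L v = q^n v for v_l = √w_l h_n(x_l)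
(`jacobi_hermite`).

Orthogonality is then the symmetry of L together with the distinctness of the q^n. The norms follow
from the three-term recurrence and the total mass, which is the Jacobi triple product with its even
and odd terms paired.

Completeness is a trace argument. L = D*D with D bidiagonal and injective, so L is positive, and its
diagonal telescopes to 1/(1-q) = ∑ q^n. The known eigenvalues therefore exhaust the trace and leave
no room for another eigenvector. The estimate `norm_factorOp_residual_sq_le` makes this elementary,
without trace-class operators. Compactness, the spectrum, the eigenspaces and the density of the
polynomials in L²(μ_α) all follow from completeness.

For the N-extremal measures, let ν be one. It has the moments of a multiple of μ_α for every α, and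
every real x is an atom of some μ_α, so P ↦ P(x) is bounded in the L²(ν) norm for every x. Together
with density this forces ν to be atomic (`exists_atom`). An atom ξ of ν is an atom of some μ_α as
well. Two measures with equal moments, dense polynomials and a common atom must agree
(`eq_of_common_atom`): transporting the indicator of an atom of ν to L²(μ_α), and moving its zero at
ξ elsewhere by a rational factor, shows that all atoms of ν are atoms of μ_α; density makes point
masses maximal; and the total masses are equal. -/

theorem qPoch_zero {K : Type*} [Field K] (a q : K) : qPoch a q 0 = 1 := by simp [qPoch]

theorem qPoch_succ {K : Type*} [Field K] (a q : K) (n : ℕ) :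
    qPoch a q (n + 1) = qPoch a q n * (1 - a * q ^ n) := by
  simp [qPoch, Finset.prod_range_succ]

theorem multipliable_qPoch {q : ℝ} (hq0 : 0 < q) (hq1 : q < 1) (a : ℝ) :
    Multipliable fun k : ℕ => 1 - a * q ^ k := by
  have h : Summable fun k : ℕ => ‖-(a * q ^ k)‖ := by
    simp only [norm_neg, norm_mul, norm_pow]
    exact (summable_geometric_of_lt_one (norm_nonneg q)
      (by rwa [Real.norm_of_nonneg hq0.le])).mul_left _
  simpa [sub_eq_add_neg] using multipliable_one_add_of_summable h

theorem tendsto_qPoch {q : ℝ} (hq0 : 0 < q) (hq1 : q < 1) (a : ℝ) :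
    Tendsto (fun n => qPoch a q n) atTop (𝓝 (qPochInf a q)) :=
  (multipliable_qPoch hq0 hq1 a).tendsto_prod_tprod_nat

theorem qPoch_mul_qPochInf {q : ℝ} (hq0 : 0 < q) (hq1 : q < 1) (a : ℝ) (n : ℕ) :
    qPoch a q n * qPochInf (a * q ^ n) q = qPochInf a q := by
  have h := Multipliable.prod_mul_tprod_nat_mul' (k := n) (f := fun k : ℕ => 1 - a * q ^ k)
    (by simpa [pow_add, mul_assoc, mul_comm, mul_left_comm]
        using multipliable_qPoch hq0 hq1 (a * q ^ n))
  rw [qPochInf, qPochInf, qPoch, ← h]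
  congr 1
  exact tprod_congr fun k => by rw [pow_add]; ring

theorem one_sub_mul_qPochInf {q : ℝ} (hq0 : 0 < q) (hq1 : q < 1) (a : ℝ) :
    (1 - a) * qPochInf (a * q) q = qPochInf a q := by
  simpa [qPoch] using qPoch_mul_qPochInf hq0 hq1 a 1

theorem one_le_qPoch {q : ℝ} (hq0 : 0 < q) {a : ℝ} (ha : a ≤ 0) (n : ℕ) : 1 ≤ qPoch a q n := by
  induction n with
  | zero => simp [qPoch]
  | succ n ih =>
    rw [qPoch_succ]
    have : a * q ^ n ≤ 0 := mul_nonpos_of_nonpos_of_nonneg ha (by positivity)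
    nlinarith

theorem one_le_qPochInf {q : ℝ} (hq0 : 0 < q) (hq1 : q < 1) {a : ℝ} (ha : a ≤ 0) :
    1 ≤ qPochInf a q :=
  ge_of_tendsto (tendsto_qPoch hq0 hq1 a) (Eventually.of_forall (one_le_qPoch hq0 ha))

theorem qPochInf_mul_pow_le {q : ℝ} (hq0 : 0 < q) (hq1 : q < 1) {a : ℝ} (ha : a ≤ 0) (n : ℕ) :
    qPochInf (a * q ^ n) q ≤ qPochInf a q := by
  rw [← qPoch_mul_qPochInf hq0 hq1 a n]
  have h1 := one_le_qPoch hq0 ha n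
  have h2 := one_le_qPochInf hq0 hq1 (a := a * q ^ n)
    (mul_nonpos_of_nonpos_of_nonneg ha (by positivity))
  nlinarith

theorem tendsto_qPochInf_mul_pow {q : ℝ} (hq0 : 0 < q) (hq1 : q < 1) {a : ℝ} (ha : a ≤ 0) :
    Tendsto (fun n : ℕ => qPochInf (a * q ^ n) q) atTop (𝓝 1) := by
  have h0 : qPochInf a q ≠ 0 := (zero_lt_one.trans_le (one_le_qPochInf hq0 hq1 ha)).ne'
  have h := (tendsto_const_nhds (x := qPochInf a q)).div (tendsto_qPoch hq0 hq1 a) h0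
  rw [div_self h0] at h
  refine h.congr fun n => ?_
  have h1 : qPoch a q n ≠ 0 := (zero_lt_one.trans_le (one_le_qPoch hq0 ha n)).ne'
  simp only [Pi.div_apply]
  rw [← qPoch_mul_qPochInf hq0 hq1 a n, mul_div_cancel_left₀ _ h1]

theorem qPoch_self_pos {q : ℝ} (hq0 : 0 < q) (hq1 : q < 1) (n : ℕ) : 0 < qPoch q q n := by
  refine Finset.prod_pos fun k _ => ?_
  have : q * q ^ k < 1 := by
    rw [← pow_succ']
    exact pow_lt_one₀ hq0.le hq1 (by simp)
  linarith

theorem qPochInf_self_pos {q : ℝ} (hq0 : 0 < q) (hq1 : q < 1) : 0 < qPochInf q q := by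
  refine lt_of_le_of_ne (ge_of_tendsto (tendsto_qPoch hq0 hq1 q)
    (Eventually.of_forall fun n => (qPoch_self_pos hq0 hq1 n).le)) (Ne.symm ?_)
  have h := tprod_one_add_ne_zero_of_summable (f := fun k : ℕ => -(q * q ^ k)) (fun k => ?_) ?_
  · simpa [qPochInf, sub_eq_add_neg] using h
  · have : q * q ^ k < 1 := by
      rw [← pow_succ']
      exact pow_lt_one₀ hq0.le hq1 (by simp)
    linarith
  · simp only [norm_neg, norm_mul, norm_pow]
    exact (summable_geometric_of_lt_one (norm_nonneg q)
      (by rwa [Real.norm_of_nonneg hq0.le])).mul_left _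

theorem qPochInf_self_le {q : ℝ} (hq0 : 0 < q) (hq1 : q < 1) (n : ℕ) :
    qPochInf q q ≤ qPoch q q n := by
  refine (antitone_nat_of_succ_le fun n => ?_).le_of_tendsto (tendsto_qPoch hq0 hq1 q) n
  rw [qPoch_succ]
  have h1 := qPoch_self_pos hq0 hq1 n
  have : 0 < q * q ^ n := by positivity
  nlinarith

/-- Splitting off finitely many factors of the infinite product works for both signs of the index.
For a ≤ 0 all factors are at least 1, so the negative case may divide by them. -/
theorem qPochInt_mul_qPochInf {q : ℝ} (hq0 : 0 < q) (hq1 : q < 1) {a : ℝ} (ha : a ≤ 0) (m : ℤ) :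
    qPochInt a q m * qPochInf (a * q ^ m) q = qPochInf a q := by
  cases m with
  | ofNat n => simpa [qPochInt] using qPoch_mul_qPochInf hq0 hq1 a n
  | negSucc n =>
    have h := qPoch_mul_qPochInf hq0 hq1 (a * q ^ (Int.negSucc n)) (n + 1)
    have e : a * q ^ (Int.negSucc n) * q ^ (n + 1) = a := by
      rw [zpow_negSucc]
      field_simp
    rw [e] at h
    have e2 : qPoch (a * q ^ (Int.negSucc n)) q (n + 1)
        = ∏ k ∈ Finset.range (n + 1), (1 - a * q ^ (-(k + 1 : ℤ))) := by
      rw [qPoch, ← Finset.prod_range_reflect]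
      refine Finset.prod_congr rfl fun k hk => ?_
      have hk' : k ≤ n := by simpa [Nat.lt_succ_iff] using hk
      rw [mul_assoc, ← zpow_natCast q (n + 1 - 1 - k), ← zpow_add₀ hq0.ne']
      congr 3
      rw [Int.negSucc_eq]
      omega
    have hpos : qPoch (a * q ^ (Int.negSucc n)) q (n + 1) ≠ 0 :=
      (zero_lt_one.trans_le (one_le_qPoch hq0
        (mul_nonpos_of_nonpos_of_nonneg ha (by positivity)) _)).ne'
    rw [qPochInt, ← e2, ← h, inv_mul_cancel_left₀ hpos]

theorem qPochInt_pos {q : ℝ} (hq0 : 0 < q) (hq1 : q < 1) {a : ℝ} (ha : a ≤ 0) (m : ℤ) :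
    0 < qPochInt a q m := by
  have h := qPochInt_mul_qPochInf hq0 hq1 ha m
  have h1 := one_le_qPochInf hq0 hq1 ha
  have h2 := one_le_qPochInf hq0 hq1 (a := a * q ^ m)
    (mul_nonpos_of_nonpos_of_nonneg ha (by positivity))
  by_contra! h3
  nlinarith

/-! ### The function `(b;q)_∞ ₀φ₁(-; b; q, b y)` -/

theorem summable_pow_mul_pow {q : ℝ} (hq0 : 0 < q) (hq1 : q < 1) (r : ℝ) :
    Summable fun k : ℕ => q ^ (k * (k - 1)) * r ^ k := by
  rcases eq_or_ne r 0 with rfl | hr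
  · exact summable_of_ne_finset_zero (s := {0}) fun k hk => by
      simp only [Finset.mem_singleton] at hk
      simp [hk]
  refine summable_of_ratio_test_tendsto_lt_one (l := 0) zero_lt_one
    (Eventually.of_forall fun k => by positivity) ?_
  have h2 : Tendsto (fun k : ℕ => (q ^ 2) ^ k * |r|) atTop (𝓝 (0 * |r|)) :=
    (tendsto_pow_atTop_nhds_zero_of_lt_one (by positivity)
      (pow_lt_one₀ hq0.le hq1 two_ne_zero)).mul_const _
  rw [zero_mul] at h2
  refine h2.congr fun k => ?_
  -- The subtraction k - 1 is truncated; this is harmless because the factor k vanishes at k = 0.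
  have e : q ^ ((k + 1) * (k + 1 - 1)) = q ^ (k * (k - 1)) * (q ^ 2) ^ k := by
    rw [← pow_mul, ← pow_add]
    congr 1
    cases k with
    | zero => rfl
    | succ k => simp only [Nat.add_sub_cancel]; ring
  rw [e, norm_mul, norm_mul, norm_mul, pow_succ r, norm_mul (r ^ k), Real.norm_eq_abs r,
    Real.norm_of_nonneg (by positivity : (0 : ℝ) ≤ (q ^ 2) ^ k)]
  have h3 : ‖q ^ (k * (k - 1))‖ ≠ 0 := norm_ne_zero_iff.mpr (by positivity)
  have h4 : ‖r ^ k‖ ≠ 0 := norm_ne_zero_iff.mpr (by positivity)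
  field_simp

/-- The terms of `(b;q)_∞ ₀φ₁(-; b; q, b y)`. -/
noncomputable def phiTerm (q b y : ℝ) (k : ℕ) : ℝ :=
  q ^ (k * (k - 1)) * (b * y) ^ k * qPochInf (b * q ^ k) q / qPoch q q k

/-- The function `(b;q)_∞ ₀φ₁(-; b; q, b y)`, for `b ≤ 0`. -/
noncomputable def phiReg (q b y : ℝ) : ℝ := ∑' k, phiTerm q b y k

/-- The factor q^{k(k-1)} beats every geometric growth. The constant is uniform in k, and since
`qPochInf` decreases along b, bq, bq², … it also yields the domination needed for b → 0. -/
theorem norm_phiTerm_le {q : ℝ} (hq0 : 0 < q) (hq1 : q < 1) {b : ℝ} (hb : b ≤ 0) (y : ℝ) (k : ℕ) :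
    ‖phiTerm q b y k‖ ≤ q ^ (k * (k - 1)) * |b * y| ^ k * (qPochInf b q / qPochInf q q) := by
  have h1 := one_le_qPochInf hq0 hq1 (a := b * q ^ k)
    (mul_nonpos_of_nonpos_of_nonneg hb (by positivity))
  rw [phiTerm, mul_div_assoc, norm_mul, norm_mul, norm_pow _ k, Real.norm_eq_abs (b * y),
    Real.norm_of_nonneg (by positivity : 0 ≤ q ^ (k * (k - 1))), norm_div,
    Real.norm_of_nonneg (by linarith : 0 ≤ qPochInf (b * q ^ k) q),
    Real.norm_of_nonneg (qPoch_self_pos hq0 hq1 k).le]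
  gcongr
  · linarith [one_le_qPochInf hq0 hq1 hb]
  · exact qPochInf_self_pos hq0 hq1
  · exact qPochInf_mul_pow_le hq0 hq1 hb k
  · exact qPochInf_self_le hq0 hq1 k

theorem summable_phiTerm {q : ℝ} (hq0 : 0 < q) (hq1 : q < 1) {b : ℝ} (hb : b ≤ 0) (y : ℝ) :
    Summable (phiTerm q b y) :=
  Summable.of_norm_bounded ((summable_pow_mul_pow hq0 hq1 _).mul_right _)
    (norm_phiTerm_le hq0 hq1 hb y)

/-- The factor 1 - q^k produced by the difference cancels the last factor of (q;q)_k; what remains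
is the series for bq with its index shifted by one. -/
theorem phiReg_sub_phiReg_mul {q : ℝ} (hq0 : 0 < q) (hq1 : q < 1) {b : ℝ} (hb : b ≤ 0) (y : ℝ) :
    phiReg q b y - phiReg q b (y * q) = b * y * phiReg q (b * q) (y * q) := by
  have hbq : b * q ≤ 0 := mul_nonpos_of_nonpos_of_nonneg hb hq0.le
  have h1 := summable_phiTerm hq0 hq1 hb y
  have h2 := summable_phiTerm hq0 hq1 hb (y * q)
  rw [phiReg, phiReg, phiReg, ← h1.tsum_sub h2, (h1.sub h2).tsum_eq_zero_add, ← tsum_mul_left]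
  have h0 : phiTerm q b y 0 - phiTerm q b (y * q) 0 = 0 := by simp [phiTerm]
  rw [h0, zero_add]
  refine tsum_congr fun k => ?_
  have e : q ^ ((k + 1) * (k + 1 - 1)) = q ^ (k * (k - 1)) * (q ^ k) ^ 2 := by
    rw [← pow_mul, ← pow_add]
    congr 1
    cases k with
    | zero => rfl
    | succ k => simp only [Nat.add_sub_cancel]; ring
  have h3 := (qPoch_self_pos hq0 hq1 k).ne'
  have h4 := (qPoch_self_pos hq0 hq1 (k + 1)).ne'
  simp only [phiTerm, e]
  rw [show b * q * q ^ k = b * q ^ (k + 1) by ring]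
  have h5 : 1 - q * q ^ k ≠ 0 := fun h => h4 (by rw [qPoch_succ, h, mul_zero])
  rw [qPoch_succ]
  simp only [mul_pow, pow_succ] at h5 ⊢
  generalize q ^ (k * (k - 1)) = A
  generalize qPochInf (b * (q ^ k * q)) q = B
  generalize q ^ k = Q at h5 ⊢
  rw [mul_comm] at h5
  field_simp

/-- Termwise this is (bq^k;q)_∞ = (1 - bq^k)(bq^{k+1};q)_∞, the extra q^k being absorbed by a change
of y. -/
theorem phiReg_eq_sub {q : ℝ} (hq0 : 0 < q) (hq1 : q < 1) {b : ℝ} (hb : b ≤ 0) (y : ℝ) :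
    phiReg q b y = phiReg q (b * q) (y / q) - b * phiReg q (b * q) y := by
  have hbq : b * q ≤ 0 := mul_nonpos_of_nonpos_of_nonneg hb hq0.le
  rw [phiReg, phiReg, phiReg, ← tsum_mul_left,
    ← (summable_phiTerm hq0 hq1 hbq (y / q)).tsum_sub
      ((summable_phiTerm hq0 hq1 hbq y).mul_left b)]
  refine tsum_congr fun k => ?_
  simp only [phiTerm]
  rw [← one_sub_mul_qPochInf hq0 hq1 (b * q ^ k), show b * q * (y / q) = b * y by field_simp,
    show b * q * q ^ k = b * q ^ k * q by ring]
  have h3 := (qPoch_self_pos hq0 hq1 k).ne'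
  field_simp
  ring

/-- The three-term relation in the parameter `b`. -/
theorem phiReg_three_term {q : ℝ} (hq0 : 0 < q) (hq1 : q < 1) {b : ℝ} (hb : b ≤ 0) (y : ℝ) :
    b * y * phiReg q (b * q ^ 2) y = phiReg q b y - (1 - b) * phiReg q (b * q) y := by
  have hbq : b * q ≤ 0 := mul_nonpos_of_nonpos_of_nonneg hb hq0.le
  have h1 := phiReg_sub_phiReg_mul hq0 hq1 hbq (y / q)
  have h2 := phiReg_eq_sub hq0 hq1 hb y
  rw [div_mul_cancel₀ _ hq0.ne', show b * q * (y / q) = b * y by field_simp,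
    show b * q * q = b * q ^ 2 by ring] at h1
  linear_combination -h1 - h2

/-- At y = 1 the two contiguous relations share the value at (bq, q), which cancels. This invariance
under b ↦ bq is what evaluates the series at y = 1. -/
theorem phiReg_mul_self {q : ℝ} (hq0 : 0 < q) (hq1 : q < 1) {b : ℝ} (hb : b ≤ 0) :
    phiReg q (b * q) 1 = phiReg q b 1 := by
  have h1 := phiReg_sub_phiReg_mul hq0 hq1 hb 1
  have h2 := phiReg_eq_sub hq0 hq1 hb q
  rw [one_mul, mul_one] at h1
  rw [div_self hq0.ne'] at h2
  linear_combination -h1 - h2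

/-- `₀φ₁(-; b; q, b) = 1 / (b;q)_∞`. -/
theorem phiReg_one {q : ℝ} (hq0 : 0 < q) (hq1 : q < 1) {b : ℝ} (hb : b ≤ 0) :
    phiReg q b 1 = 1 := by
  have hc : ∀ n : ℕ, b * q ^ n ≤ 0 := fun n =>
    mul_nonpos_of_nonpos_of_nonneg hb (by positivity)
  have h1 : ∀ n : ℕ, phiReg q (b * q ^ n) 1 = phiReg q b 1 := by
    intro n
    induction n with
    | zero => simp
    | succ n ih => rw [← ih, ← phiReg_mul_self hq0 hq1 (hc n), pow_succ, mul_assoc]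
  have hqn : ∀ n : ℕ, q ^ n ≤ 1 := fun n => pow_le_one₀ hq0.le hq1.le
  -- As bq^n → 0 only the term k = 0 survives, and its limit is 1; the sequence itself is constant
  -- by `h1`.
  have h2 : Tendsto (fun n : ℕ => phiReg q (b * q ^ n) 1) atTop
      (𝓝 (∑' k : ℕ, if k = 0 then (1 : ℝ) else 0)) := by
    refine tendsto_tsum_of_dominated_convergence
      (bound := fun k => q ^ (k * (k - 1)) * |b| ^ k * (qPochInf b q / qPochInf q q))
      ((summable_pow_mul_pow hq0 hq1 _).mul_right _) (fun k => ?_)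
      (Eventually.of_forall fun n k => ?_)
    · have h3 : Tendsto (fun n : ℕ => qPochInf (b * q ^ n * q ^ k) q) atTop (𝓝 1) := by
        refine ((tendsto_qPochInf_mul_pow hq0 hq1 hb).comp (tendsto_add_atTop_nat k)).congr
          fun n => ?_
        simp [pow_add, mul_assoc]
      have h4 : Tendsto (fun n : ℕ => b * q ^ n * 1) atTop (𝓝 (b * 0 * 1)) :=
        ((tendsto_pow_atTop_nhds_zero_of_lt_one hq0.le hq1).const_mul b).mul_const 1
      have h5 := (((h4.pow k).const_mul (q ^ (k * (k - 1)))).mul h3).div_const (qPoch q q k)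
      refine h5.congr' ?_ |>.trans (le_of_eq ?_)
      · exact Eventually.of_forall fun n => by simp [phiTerm]
      · cases k with
        | zero => simp [qPoch]
        | succ k => simp
    · refine (norm_phiTerm_le hq0 hq1 (hc n) 1 k).trans ?_
      have h6 := one_le_qPochInf hq0 hq1 hb
      have h7 := qPochInf_self_pos hq0 hq1
      have h8 : |b * q ^ n * 1| ≤ |b| := by
        rw [mul_one, abs_mul, abs_of_nonneg (by positivity : 0 ≤ q ^ n)]
        exact mul_le_of_le_one_right (abs_nonneg b) (hqn n)
      have h9 := qPochInf_mul_pow_le hq0 hq1 hb n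
      gcongr
      exact div_nonneg (by linarith [one_le_qPochInf hq0 hq1 (hc n)]) h7.le
  rw [tsum_ite_eq] at h2
  refine tendsto_nhds_unique ?_ h2
  simp only [h1]
  exact tendsto_const_nhds

/-- The recurrence in `y`, which is that of the `q⁻¹`-Hermite polynomials for `y = q⁻ⁿ`. -/
theorem phiReg_recurrence {q : ℝ} (hq0 : 0 < q) (hq1 : q < 1) {b : ℝ} (hb : b ≤ 0) (y : ℝ) :
    phiReg q b (y / q) = (1 + b / q) * phiReg q b y + b / q * (y - 1) * phiReg q b (y * q) := by
  have h1 := phiReg_sub_phiReg_mul hq0 hq1 hb (y / q)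
  have h2 := phiReg_eq_sub hq0 hq1 hb (y * q)
  have h3 := phiReg_sub_phiReg_mul hq0 hq1 hb y
  rw [div_mul_cancel₀ _ hq0.ne'] at h1
  rw [mul_div_cancel_right₀ _ hq0.ne'] at h2
  -- Elimination of the value at (bq, yq), which leaves the value at (bq, y) as the only one with a
  -- shifted parameter.
  have h4 : y * phiReg q (b * q) y
      = y * phiReg q b (y * q) + (phiReg q b y - phiReg q b (y * q)) := by
    linear_combination -y * h2 - h3
  generalize phiReg q (b * q) y = Z at h1 h4
  field_simp at h1 ⊢
  linear_combination h1 + b * h4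

/-- Both sides obey the same second-order recurrence in n: take b = -u²q, hence b/q = -u², and y =
q^{-n}. At y = 1 the factor y - 1 kills the third term, which corresponds to h_{-1} = 0. -/
theorem pow_mul_eval_hermite {q : ℝ} (hq0 : 0 < q) (hq1 : q < 1) {u : ℝ} (hu : 0 < u) (n : ℕ) :
    u ^ n * (hermite q n).eval ((u⁻¹ - u) / 2) = phiReg q (-(u ^ 2 * q)) (q ^ n)⁻¹ := by
  have hb : -(u ^ 2 * q) ≤ 0 := by
    have : 0 < u ^ 2 * q := by positivity
    linarith
  have hb' : -(u ^ 2 * q) / q = -u ^ 2 := by field_simp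
  have key : ∀ n : ℕ, u ^ n * (hermite q n).eval ((u⁻¹ - u) / 2)
        = phiReg q (-(u ^ 2 * q)) (q ^ n)⁻¹ ∧
      u ^ (n + 1) * (hermite q (n + 1)).eval ((u⁻¹ - u) / 2)
        = phiReg q (-(u ^ 2 * q)) (q ^ (n + 1))⁻¹ := by
    intro n
    induction n with
    | zero =>
      have h1 := phiReg_recurrence hq0 hq1 hb 1
      rw [hb', phiReg_one hq0 hq1 hb] at h1
      refine ⟨by simp [hermite, phiReg_one hq0 hq1 hb], ?_⟩
      simp only [one_div, mul_one, sub_self, mul_zero, zero_mul, add_zero] at h1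
      simp only [zero_add, pow_one, h1, hermite, eval_mul, eval_ofNat, eval_X]
      field_simp
      ring
    | succ n ih =>
      refine ⟨ih.2, ?_⟩
      have h1 := phiReg_recurrence hq0 hq1 hb (q ^ (n + 1))⁻¹
      rw [hb', show (q ^ (n + 1))⁻¹ / q = (q ^ (n + 1 + 1))⁻¹ by field_simp; ring,
        show (q ^ (n + 1))⁻¹ * q = (q ^ n)⁻¹ by
          rw [pow_succ q n]; field_simp, ← ih.1, ← ih.2] at h1
      rw [h1]
      simp only [hermite, eval_sub, eval_mul, eval_ofNat, eval_X, eval_C]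
      field_simp
      ring
  exact (key n).1

/-! ### The `q`-difference equation -/

/-- The second order `q`-difference equation of the `q⁻¹`-Hermite polynomials. -/
theorem hermite_difference_equation {q : ℝ} (hq0 : 0 < q) (hq1 : q < 1) {u t : ℝ} (hu : 0 < u)
    (ht : t = u ^ 2) (n : ℕ) :
    t ^ 2 * q / ((1 + t * q) * (1 + t)) * (hermite q n).eval (((u * q)⁻¹ - u * q) / 2)
      + t * (1 + q⁻¹) / ((1 + t * q) * (1 + t / q)) * (hermite q n).eval ((u⁻¹ - u) / 2)
      + 1 / ((1 + t / q) * (1 + t)) * (hermite q n).eval (((u / q)⁻¹ - u / q) / 2)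
      = q ^ n * (hermite q n).eval ((u⁻¹ - u) / 2) := by
  have hneg : ∀ s : ℝ, 0 < s → -(t * s) ≤ 0 := fun s hs => by
    have : 0 ≤ t * s := by rw [ht]; positivity
    linarith
  have ht0 : 0 < t := by rw [ht]; positivity
  have e2 := pow_mul_eval_hermite hq0 hq1 (mul_pos hu hq0) n
  have e0 := pow_mul_eval_hermite hq0 hq1 hu n
  have e1 := pow_mul_eval_hermite hq0 hq1 (div_pos hu hq0) n
  set H2 := (hermite q n).eval (((u * q)⁻¹ - u * q) / 2)
  set H0 := (hermite q n).eval ((u⁻¹ - u) / 2)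
  set H1 := (hermite q n).eval (((u / q)⁻¹ - u / q) / 2)
  -- The shifts of u by q^{±1} multiply b = -tq by q^{±2}. The relations at -t/q, -t and -tq link
  -- the three wanted values with the two intermediate ones at -t and -tq², named Y and Z below and
  -- then eliminated.
  have r1 := phiReg_three_term hq0 hq1 (hneg q⁻¹ (by positivity)) (q ^ n)⁻¹
  have r2 := phiReg_three_term hq0 hq1 (hneg 1 one_pos) (q ^ n)⁻¹
  have r3 := phiReg_three_term hq0 hq1 (hneg q hq0) (q ^ n)⁻¹
  rw [show -((u * q) ^ 2 * q) = -(t * q) * q ^ 2 by rw [ht]; ring] at e2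
  rw [show -(u ^ 2 * q) = -(t * q) by rw [ht]] at e0
  rw [show -((u / q) ^ 2 * q) = -(t * q⁻¹) by rw [ht]; field_simp] at e1
  rw [show -(t * q⁻¹) * q ^ 2 = -(t * q) by field_simp,
    show -(t * q⁻¹) * q = -(t * 1) by field_simp] at r1
  rw [show -(t * 1) * q ^ 2 = -(t * q) * q by ring, show -(t * 1) * q = -(t * q) by ring] at r2
  rw [← e2, ← e0] at r3
  rw [← e0] at r2
  rw [← e0, ← e1] at r1
  generalize phiReg q (-(t * 1)) (q ^ n)⁻¹ = Y at r1 r2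
  generalize phiReg q (-(t * q) * q) (q ^ n)⁻¹ = Z at r2 r3
  rw [div_pow] at r1
  rw [mul_pow] at r3
  have hun : u ^ n ≠ 0 := by positivity
  have hqn : q ^ n ≠ 0 := by positivity
  generalize u ^ n = U at r1 r2 r3 hun
  generalize q ^ n = Q at r1 r2 r3 hqn ⊢
  have d1 : 1 + t * q ≠ 0 := by positivity
  have d2 : 1 + t ≠ 0 := by positivity
  have d3 : 1 + t / q ≠ 0 := by positivity
  have d4 : q + t ≠ 0 := by positivity
  have f2 : Y = (1 + t) * (U * H0) - t * Q⁻¹ * Z := by linear_combination -r2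
  have f3 : H2 = -(U * H0 - (1 + t * q) * Z) / (t * q * U) := by
    field_simp at r3 ⊢
    linear_combination -r3
  have f1 : H1 = Q / U * ((1 + t / q) * Y - t / q * Q⁻¹ * (U * H0)) := by
    field_simp at r1 ⊢
    linear_combination -r1
  rw [f3, f1, f2]
  field_simp
  ring


/-! ### The eigenvectors in terms of the polynomials -/

/-- Dividing `phiReg` by (b;q)_∞ restores the denominators (b;q)_k; this passes from the real
regularised series to the complex one in the statement. -/
theorem phi01_ofReal {q : ℝ} (hq0 : 0 < q) (hq1 : q < 1) {b : ℝ} (hb : b ≤ 0) (y : ℝ) :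
    phi01 (b : ℂ) (q : ℂ) ((b * y : ℝ) : ℂ) = ((phiReg q b y / qPochInf b q : ℝ) : ℂ) := by
  have hcast : ∀ (a : ℝ) (k : ℕ), qPoch (a : ℂ) (q : ℂ) k = ((qPoch a q k : ℝ) : ℂ) := by
    intro a k
    simp [qPoch]
  rw [phi01, phiReg, ← tsum_div_const, Complex.ofReal_tsum]
  refine tsum_congr fun k => ?_
  rw [hcast, hcast, phiTerm, ← qPoch_mul_qPochInf hq0 hq1 b k]
  have h1 := (zero_lt_one.trans_le (one_le_qPoch hq0 hb k)).ne'
  have h2 := (zero_lt_one.trans_le (one_le_qPochInf hq0 hq1 (a := b * q ^ k)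
    (mul_nonpos_of_nonpos_of_nonneg hb (by positivity)))).ne'
  have h3 := (qPoch_self_pos hq0 hq1 k).ne'
  have e : q ^ (k * (k - 1)) * (b * y) ^ k * qPochInf (b * q ^ k) q / qPoch q q k
      / (qPoch b q k * qPochInf (b * q ^ k) q)
      = q ^ (k * (k - 1)) * (b * y) ^ k / (qPoch b q k * qPoch q q k) := by
    field_simp
  rw [e]
  push_cast
  rfl

theorem weight_pos {q α : ℝ} (hq0 : 0 < q) (hα : 0 < α) (l : ℤ) : 0 < weight q α l := by
  unfold weight; positivity

theorem sqrt_weight {q α : ℝ} (hq0 : 0 < q) (hα : 0 < α) (l : ℤ) :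
    √(weight q α l) =
      α ^ (2 * l) * q ^ ((l : ℝ) ^ 2 - (l : ℝ) / 2) * √(1 + α ^ 2 * q ^ (2 * l)) := by
  rw [weight, Real.sqrt_mul (by positivity)]
  congr 1
  rw [Real.sqrt_eq_iff_mul_self_eq (by positivity) (by positivity)]
  have e1 : q ^ ((l : ℝ) ^ 2 - (l : ℝ) / 2) * q ^ ((l : ℝ) ^ 2 - (l : ℝ) / 2)
      = q ^ (2 * l ^ 2 - l) := by
    rw [← Real.rpow_add hq0, ← Real.rpow_intCast]
    congr 1
    push_cast
    ring
  have e2 : α ^ (2 * l) * α ^ (2 * l) = α ^ (4 * l) := by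
    rw [← zpow_add₀ hα.ne']
    congr 1
    ring
  rw [← e1, ← e2]
  ring

theorem sq_mul_zpow (q α : ℝ) (l : ℤ) :
    (α * q ^ l) ^ 2 = α ^ 2 * q ^ (2 * l) := by
  rw [mul_pow, ← zpow_natCast (q ^ l), ← zpow_mul]
  congr 2
  push_cast
  ring

/-- The denominator (-α²q;q)_{2l} of C_l combines with (-α²q^{2l+1};q)_∞ to the l-independent
(-α²q;q)_∞, and z^{-l} = q^{-nl} reduces (αq^l)^n to α^n. -/
theorem phi_eq {q α : ℝ} (hq0 : 0 < q) (hq1 : q < 1) (hα : 0 < α) (n : ℕ) (l : ℤ) :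
    phi q α ((q : ℂ) ^ n) l =
      ((α ^ n / qPochInf (-(α ^ 2 * q)) q * √(weight q α l) *
        (hermite q n).eval (massPoint q α l) : ℝ) : ℂ) := by
  have hu : 0 < α * q ^ l := by positivity
  have hb : -(α ^ 2 * q ^ (2 * l + 1)) ≤ 0 := by
    have : 0 < α ^ 2 * q ^ (2 * l + 1) := by positivity
    linarith
  have hb1 : -(α ^ 2 * q) ≤ 0 := by
    have : 0 < α ^ 2 * q := by positivity
    linarith
  have h1 := phi01_ofReal hq0 hq1 hb (q ^ n)⁻¹
  have h2 := pow_mul_eval_hermite hq0 hq1 hu n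
  have hbu : -((α * q ^ l) ^ 2 * q) = -(α ^ 2 * q ^ (2 * l + 1)) := by
    rw [sq_mul_zpow q α, zpow_add_one₀ hq0.ne', mul_assoc]
  rw [hbu] at h2
  have h3 := qPochInt_mul_qPochInf hq0 hq1 hb1 (2 * l)
  have h4 := qPochInt_pos hq0 hq1 hb1 (2 * l)
  have h5 : -(α ^ 2 * q) * q ^ (2 * l) = -(α ^ 2 * q ^ (2 * l + 1)) := by
    rw [zpow_add_one₀ hq0.ne']; ring
  rw [h5] at h3
  have h6 := one_le_qPochInf hq0 hq1 hb
  have e1 : (-((α : ℂ) ^ 2 * (q : ℂ) ^ (2 * l + 1)) / (q : ℂ) ^ n)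
      = ((-(α ^ 2 * q ^ (2 * l + 1)) * (q ^ n)⁻¹ : ℝ) : ℂ) := by
    push_cast
    rw [div_eq_mul_inv]
  have e2 : (-((α : ℂ) ^ 2 * (q : ℂ) ^ (2 * l + 1)))
      = ((-(α ^ 2 * q ^ (2 * l + 1)) : ℝ) : ℂ) := by
    push_cast
    rfl
  rw [phi, e1, e2, h1, ← h2, ← h3, sqrt_weight hq0 hα, coeffC, massPoint]
  have e3 : ((q : ℂ) ^ n) ^ (-l) = ((((q ^ l) ^ n)⁻¹ : ℝ) : ℂ) := by
    push_cast
    rw [← zpow_natCast, ← zpow_natCast, ← zpow_mul, ← zpow_mul, ← zpow_neg]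
    congr 1
    ring
  rw [e3, ← Complex.ofReal_mul, ← Complex.ofReal_mul]
  congr 1
  have h7 : qPochInf (-(α ^ 2 * q ^ (2 * l + 1))) q ≠ 0 := by linarith
  rw [mul_pow]
  have h8 := h4.ne'
  field_simp

/-! ### The eigenvalue equation -/

/-- With the companion for the index l + 1, this shows that conjugation with √w_l removes the square
roots from the off-diagonal entries and leaves the rational coefficients of the q-difference
equation. -/
theorem coeffA_mul_sqrt_weight {q α : ℝ} (hq0 : 0 < q) (hα : 0 < α) (l : ℤ) :
    coeffA q α l * √(weight q α l) = √(weight q α (l + 1)) /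
      ((1 + α ^ 2 * q ^ (2 * l + 1)) * (1 + α ^ 2 * q ^ (2 * l + 2))) := by
  rw [sqrt_weight hq0 hα, sqrt_weight hq0 hα, coeffA, Real.sqrt_mul (by positivity),
    show 2 * (l + 1) = 2 * l + 2 by ring]
  have e1 : q ^ ((((l + 1 : ℤ) : ℝ)) ^ 2 - ((l + 1 : ℤ) : ℝ) / 2)
      = q ^ ((l : ℝ) ^ 2 - (l : ℝ) / 2) * q ^ (2 * (l : ℝ) + 1 / 2) := by
    rw [← Real.rpow_add hq0]
    congr 1
    push_cast
    ring
  have e2 : α ^ (2 * l + 2) = α ^ (2 * l) * α ^ 2 := zpow_add₀ hα.ne' _ _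
  rw [e1, e2]
  have h1 : √(1 + α ^ 2 * q ^ (2 * l)) ≠ 0 := by positivity
  have h2 : √(1 + α ^ 2 * q ^ (2 * l + 2)) ≠ 0 := by positivity
  have h3 : √(1 + α ^ 2 * q ^ (2 * l + 2)) ^ 2 = 1 + α ^ 2 * q ^ (2 * l + 2) :=
    Real.sq_sqrt (by positivity)
  generalize √(1 + α ^ 2 * q ^ (2 * l + 2)) = R at h2 h3 ⊢
  rw [← h3]
  field_simp

theorem coeffA_mul_sqrt_weight_succ {q α : ℝ} (hq0 : 0 < q) (hα : 0 < α) (l : ℤ) :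
    coeffA q α l * √(weight q α (l + 1)) = √(weight q α l) *
      ((α ^ 2 * q ^ (2 * l)) ^ 2 * q /
        ((1 + α ^ 2 * q ^ (2 * l + 1)) * (1 + α ^ 2 * q ^ (2 * l)))) := by
  rw [sqrt_weight hq0 hα, sqrt_weight hq0 hα, coeffA, Real.sqrt_mul (by positivity),
    show 2 * (l + 1) = 2 * l + 2 by ring]
  have e1 : q ^ ((((l + 1 : ℤ) : ℝ)) ^ 2 - ((l + 1 : ℤ) : ℝ) / 2)
      = q ^ ((l : ℝ) ^ 2 - (l : ℝ) / 2) * q ^ (2 * (l : ℝ) + 1 / 2) := by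
    rw [← Real.rpow_add hq0]
    congr 1
    push_cast
    ring
  have e2 : α ^ (2 * l + 2) = α ^ (2 * l) * α ^ 2 := zpow_add₀ hα.ne' _ _
  have e3 : q ^ (2 * (l : ℝ) + 1 / 2) * q ^ (2 * (l : ℝ) + 1 / 2) = (q ^ (2 * l)) ^ 2 * q := by
    rw [← Real.rpow_add hq0, ← zpow_natCast, ← zpow_mul, ← zpow_add_one₀ hq0.ne',
      ← Real.rpow_intCast]
    congr 1
    push_cast
    ring
  rw [e1, e2]
  have h1 : √(1 + α ^ 2 * q ^ (2 * l)) ≠ 0 := by positivity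
  have h2 : √(1 + α ^ 2 * q ^ (2 * l + 2)) ≠ 0 := by positivity
  have h3 : √(1 + α ^ 2 * q ^ (2 * l)) ^ 2 = 1 + α ^ 2 * q ^ (2 * l) :=
    Real.sq_sqrt (by positivity)
  generalize √(1 + α ^ 2 * q ^ (2 * l)) = R at h1 h3 ⊢
  rw [← h3, mul_pow, mul_assoc ((α ^ 2) ^ 2), ← e3]
  field_simp

/-- The sequence `√w_l h_n(x_l)` is an eigensequence of the Jacobi recursion. -/
theorem jacobi_hermite {q α : ℝ} (hq0 : 0 < q) (hq1 : q < 1) (hα : 0 < α) (n : ℕ) (l : ℤ) :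
    coeffA q α l * (√(weight q α (l + 1)) * (hermite q n).eval (massPoint q α (l + 1)))
      + coeffB q α l * (√(weight q α l) * (hermite q n).eval (massPoint q α l))
      + coeffA q α (l - 1) * (√(weight q α (l - 1)) * (hermite q n).eval (massPoint q α (l - 1)))
      = q ^ n * (√(weight q α l) * (hermite q n).eval (massPoint q α l)) := by
  have hu : 0 < α * q ^ l := by positivity
  have h := hermite_difference_equation hq0 hq1 hu (sq_mul_zpow q α l).symm n
  have h1 := coeffA_mul_sqrt_weight_succ hq0 hα l
  have h2 := coeffA_mul_sqrt_weight hq0 hα (l - 1)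
  have e1 : α ^ 2 * q ^ (2 * l + 1) = α ^ 2 * q ^ (2 * l) * q := by
    rw [zpow_add_one₀ hq0.ne', mul_assoc]
  have e2 : α ^ 2 * q ^ (2 * l - 1) = α ^ 2 * q ^ (2 * l) / q := by
    rw [zpow_sub_one₀ hq0.ne']; field_simp
  have e3 : coeffB q α l = α ^ 2 * q ^ (2 * l) * (1 + q⁻¹) /
      ((1 + α ^ 2 * q ^ (2 * l) * q) * (1 + α ^ 2 * q ^ (2 * l) / q)) := by
    rw [coeffB, ← e1, ← e2]
    congr 1
    rw [zpow_sub_one₀ hq0.ne']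
    field_simp
    ring
  rw [show 2 * (l - 1) + 1 = 2 * l - 1 by ring, show 2 * (l - 1) + 2 = 2 * l by ring,
    sub_add_cancel, e2] at h2
  rw [e1] at h1
  simp only [massPoint]
  rw [show α * q ^ (l + 1) = α * q ^ l * q by rw [zpow_add_one₀ hq0.ne', mul_assoc],
    show α * q ^ (l - 1) = α * q ^ l / q by rw [zpow_sub_one₀ hq0.ne']; field_simp,
    ← mul_assoc, h1, ← mul_assoc (coeffA q α (l - 1)), h2, e3]
  linear_combination √(weight q α l) * h


/-! ### The Jacobi triple product -/

/-- `1 / (q;q)_m`, which is `0` for `m < 0`. -/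
noncomputable def invQPoch (q : ℝ) (m : ℤ) : ℝ := if m < 0 then 0 else (qPoch q q m.toNat)⁻¹

/-- The convention 1/(q;q)_m = 0 for m < 0 makes the relation valid for all integers: at m = 0 the
factor 1 - q^0 vanishes. The induction for the triple product then needs no boundary cases. -/
theorem invQPoch_sub_one {q : ℝ} (hq0 : 0 < q) (hq1 : q < 1) (m : ℤ) :
    invQPoch q (m - 1) = (1 - q ^ m) * invQPoch q m := by
  rcases lt_trichotomy m 0 with h | rfl | h
  · simp [invQPoch, h, show m - 1 < 0 by omega]
  · simp [invQPoch]
  · lift m to ℕ using h.le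
    obtain ⟨k, rfl⟩ : ∃ k, m = k + 1 := ⟨m - 1, by omega⟩
    have h1 := (qPoch_self_pos hq0 hq1 (k + 1)).ne'
    rw [qPoch_succ] at h1
    have e : ((k + 1 : ℕ) : ℤ) - 1 = (k : ℤ) := by push_cast; ring
    rw [invQPoch, invQPoch, e, if_neg (by omega), if_neg (by omega), Int.toNat_natCast,
      Int.toNat_natCast, qPoch_succ, zpow_natCast, pow_succ' q k]
    have h2 := (mul_ne_zero_iff.mp h1).1
    have h3 := (mul_ne_zero_iff.mp h1).2
    field_simp

theorem invQPoch_nonneg {q : ℝ} (hq0 : 0 < q) (hq1 : q < 1) (m : ℤ) : 0 ≤ invQPoch q m := by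
  rw [invQPoch]
  split_ifs
  · exact le_rfl
  · exact (inv_pos.mpr (qPoch_self_pos hq0 hq1 _)).le

theorem invQPoch_le {q : ℝ} (hq0 : 0 < q) (hq1 : q < 1) (m : ℤ) :
    invQPoch q m ≤ (qPochInf q q)⁻¹ := by
  have h := qPochInf_self_pos hq0 hq1
  rw [invQPoch]
  split_ifs
  · positivity
  · exact inv_anti₀ h (qPochInf_self_le hq0 hq1 _)

theorem tendsto_invQPoch {q : ℝ} (hq0 : 0 < q) (hq1 : q < 1) {f : ℕ → ℤ}
    (hf : Tendsto f atTop atTop) :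
    Tendsto (fun n => invQPoch q (f n)) atTop (𝓝 (qPochInf q q)⁻¹) := by
  have h1 : Tendsto (fun n => (f n).toNat) atTop atTop := by
    refine tendsto_atTop.mpr fun b => ?_
    filter_upwards [tendsto_atTop.mp hf b] with n hn
    omega
  refine (((tendsto_qPoch hq0 hq1 q).comp h1).inv₀ (qPochInf_self_pos hq0 hq1).ne').congr' ?_
  filter_upwards [tendsto_atTop.mp hf 0] with n hn
  simp [invQPoch, not_lt.mpr hn]

/-- `q^{j(j-1)/2} z^j`. -/
noncomputable def thetaTerm (q z : ℝ) (j : ℤ) : ℝ := q ^ (j * (j - 1) / 2) * z ^ j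

theorem thetaTerm_add_one {q z : ℝ} (hq0 : 0 < q) (hz : 0 < z) (j : ℤ) :
    thetaTerm q z (j + 1) = thetaTerm q z j * (q ^ j * z) := by
  -- Integer division commutes with adding a multiple of 2, so the parity of j(j - 1) need not be
  -- discussed.
  have e : (j + 1) * (j + 1 - 1) / 2 = j * (j - 1) / 2 + j := by
    rw [show (j + 1) * (j + 1 - 1) = j * (j - 1) + j * 2 by ring,
      Int.add_mul_ediv_right _ _ two_ne_zero]
  rw [thetaTerm, thetaTerm, e, zpow_add₀ hq0.ne', zpow_add_one₀ hz.ne']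
  ring

theorem thetaTerm_pos {q z : ℝ} (hq0 : 0 < q) (hz : 0 < z) (j : ℤ) : 0 < thetaTerm q z j := by
  unfold thetaTerm; positivity

theorem thetaTerm_neg {q z : ℝ} (hq0 : 0 < q) (j : ℤ) : thetaTerm q z (-j) = thetaTerm q (q / z) j := by
  have e : -j * (-j - 1) / 2 = j * (j - 1) / 2 + j := by
    rw [show -j * (-j - 1) = j * (j - 1) + j * 2 by ring,
      Int.add_mul_ediv_right _ _ two_ne_zero]
  rw [thetaTerm, thetaTerm, e, zpow_add₀ hq0.ne', div_zpow, zpow_neg]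
  field_simp

theorem summable_thetaTerm {q z : ℝ} (hq0 : 0 < q) (hq1 : q < 1) (hz : 0 < z) :
    Summable (thetaTerm q z) := by
  have key : ∀ z : ℝ, 0 < z → Summable fun n : ℕ => thetaTerm q z n := by
    intro z hz
    refine summable_of_ratio_test_tendsto_lt_one (l := 0) zero_lt_one
      (Eventually.of_forall fun n => (thetaTerm_pos hq0 hz n).ne') ?_
    have h := (tendsto_pow_atTop_nhds_zero_of_lt_one hq0.le hq1).mul_const z
    rw [zero_mul] at h
    refine h.congr fun n => ?_
    have h1 := thetaTerm_pos hq0 hz n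
    rw [Nat.cast_succ, thetaTerm_add_one hq0 hz, norm_mul, zpow_natCast,
      mul_div_cancel_left₀ _ (norm_ne_zero_iff.mpr h1.ne'),
      Real.norm_of_nonneg (by positivity)]
  refine Summable.of_nat_of_neg (key z hz) ?_
  simp only [thetaTerm_neg hq0]
  exact key _ (div_pos hq0 hz)

/-- The finite form of the Jacobi triple product. -/
theorem hasSum_finite_triple_product {q z : ℝ} (hq0 : 0 < q) (hq1 : q < 1) (hz : 0 < z) (N : ℕ) :
    HasSum (fun j : ℤ => qPoch q q (2 * N) * (invQPoch q (N + j) * invQPoch q (N - j))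
      * thetaTerm q z j) (qPoch (-z) q N * qPoch (-(q / z)) q N) := by
  induction N with
  | zero =>
    convert hasSum_ite_eq (0 : ℤ) (1 : ℝ) using 1
    · ext j
      rcases lt_trichotomy j 0 with h | rfl | h
      · simp [invQPoch, h, h.ne]
      · simp [invQPoch, thetaTerm, qPoch]
      · simp [invQPoch, h, h.ne']
    · simp [qPoch]
  | succ N ih =>
    -- The new factor is (1 + zq^N)(1 + q^{N+1}/z) = (1 + q^{2N+1}) + zq^N + q^{N+1}/z. Reindexing
    -- the z and 1/z parts by one reduces the claim to a q-Pascal identity for each coefficient.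
    have h1 := ((Equiv.subRight (1 : ℤ)).hasSum_iff.mpr ih).mul_left (z * q ^ N)
    have h2 := ((Equiv.addRight (1 : ℤ)).hasSum_iff.mpr ih).mul_left (q / z * q ^ N)
    have h3 := ((ih.mul_left (1 + q ^ (2 * N + 1))).add h1).add h2
    have hv : qPoch (-z) q (N + 1) * qPoch (-(q / z)) q (N + 1)
        = (1 + q ^ (2 * N + 1)) * (qPoch (-z) q N * qPoch (-(q / z)) q N)
          + z * q ^ N * (qPoch (-z) q N * qPoch (-(q / z)) q N)
          + q / z * q ^ N * (qPoch (-z) q N * qPoch (-(q / z)) q N) := by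
      rw [qPoch_succ, qPoch_succ]
      field_simp
      ring
    rw [hv]
    refine (congrArg (fun f => HasSum f _) (funext fun j => ?_)).mpr h3
    · simp only [Function.comp_apply, Equiv.subRight_apply, Equiv.coe_addRight]
      have t1 := thetaTerm_add_one hq0 hz j
      have t2 := thetaTerm_add_one hq0 hz (j - 1)
      rw [sub_add_cancel] at t2
      have i1 := invQPoch_sub_one hq0 hq1 (N + 1 + j)
      have i2 := invQPoch_sub_one hq0 hq1 (N + 1 - j)
      have i3 := invQPoch_sub_one hq0 hq1 (N + j)
      have i4 := invQPoch_sub_one hq0 hq1 (N - j)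
      rw [show (N : ℤ) + 1 + j - 1 = N + j by ring] at i1
      rw [show (N : ℤ) + 1 - j - 1 = N - j by ring] at i2
      have t3 : thetaTerm q z (j - 1) = thetaTerm q z j / (q ^ (j - 1) * z) := by
        rw [t2]; field_simp
      rw [show (N : ℤ) + (j - 1) = N + j - 1 by ring, show (N : ℤ) - (j - 1) = N + 1 - j by ring,
        show (N : ℤ) + (j + 1) = N + 1 + j by ring, show (N : ℤ) - (j + 1) = N - j - 1 by ring,
        Nat.cast_succ, i3, i4, i1, i2, t1, t3, show 2 * (N + 1) = 2 * N + 1 + 1 by ring,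
        qPoch_succ, qPoch_succ]
      generalize invQPoch q (N + 1 + j) = A
      generalize invQPoch q (N + 1 - j) = B
      generalize thetaTerm q z j = T
      generalize qPoch q q (2 * N) = P
      simp only [zpow_add₀ hq0.ne', zpow_sub₀ hq0.ne', zpow_natCast, zpow_one, pow_succ, pow_mul',
        pow_zero, one_mul]
      have hj : q ^ j ≠ 0 := by positivity
      generalize q ^ j = J at hj ⊢
      have hN : q ^ N ≠ 0 := by positivity
      generalize q ^ N = Q at hN ⊢
      field_simp
      ring

/-- The Jacobi triple product. -/
theorem hasSum_thetaTerm {q z : ℝ} (hq0 : 0 < q) (hq1 : q < 1) (hz : 0 < z) :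
    HasSum (thetaTerm q z)
      (qPochInf (-z) q * qPochInf (-(q / z)) q * qPochInf q q) := by
  have hs := summable_thetaTerm hq0 hq1 hz
  have hQ := qPochInf_self_pos hq0 hq1
  -- The q-binomial coefficients tend to 1/(q;q)_∞ and are bounded by (q;q)_∞^{-2}, so the theta
  -- series dominates.
  have h1 : Tendsto (fun N : ℕ => ∑' j : ℤ, qPoch q q (2 * N) *
      (invQPoch q (N + j) * invQPoch q (N - j)) * thetaTerm q z j) atTop
      (𝓝 (∑' j : ℤ, qPochInf q q * ((qPochInf q q)⁻¹ * (qPochInf q q)⁻¹) * thetaTerm q z j)) := by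
    refine tendsto_tsum_of_dominated_convergence
      (bound := fun j => 1 * ((qPochInf q q)⁻¹ * (qPochInf q q)⁻¹) * thetaTerm q z j)
      (hs.mul_left _) (fun j => ?_) (Eventually.of_forall fun N j => ?_)
    · have hN : Tendsto (fun N : ℕ => (N : ℤ)) atTop atTop := tendsto_natCast_atTop_atTop
      have h2N : Tendsto (fun N : ℕ => 2 * N) atTop atTop :=
        tendsto_id.const_mul_atTop' two_pos
      refine ((((tendsto_qPoch hq0 hq1 q).comp h2N).mul
        ((tendsto_invQPoch hq0 hq1 (tendsto_atTop_add_const_right _ j hN)).mul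
          (tendsto_invQPoch hq0 hq1 ?_))).mul_const _)
      simpa [sub_eq_add_neg] using tendsto_atTop_add_const_right _ (-j) hN
    · have a1 := invQPoch_nonneg hq0 hq1 (N + j)
      have a2 := invQPoch_nonneg hq0 hq1 (N - j)
      have a3 := thetaTerm_pos hq0 hz j
      have a4 := qPoch_self_pos hq0 hq1 (2 * N)
      rw [Real.norm_of_nonneg (by positivity)]
      have a5 := invQPoch_le hq0 hq1 (N + j)
      have a6 := invQPoch_le hq0 hq1 (N - j)
      have a7 : qPoch q q (2 * N) ≤ 1 := by
        refine Finset.prod_le_one (fun k _ => ?_) (fun k _ => ?_)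
        · have : q * q ^ k ≤ 1 := by
            rw [← pow_succ']
            exact pow_le_one₀ hq0.le hq1.le
          linarith
        · have : 0 < q * q ^ k := by positivity
          linarith
      gcongr
  have h2 : Tendsto (fun N : ℕ => ∑' j : ℤ, qPoch q q (2 * N) *
      (invQPoch q (N + j) * invQPoch q (N - j)) * thetaTerm q z j) atTop
      (𝓝 (qPochInf (-z) q * qPochInf (-(q / z)) q)) := by
    simp only [(hasSum_finite_triple_product hq0 hq1 hz _).tsum_eq]
    exact (tendsto_qPoch hq0 hq1 _).mul (tendsto_qPoch hq0 hq1 _)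
  have h3 := tendsto_nhds_unique h1 h2
  rw [tsum_mul_left, mul_inv_cancel_left₀ hQ.ne'] at h3
  rw [← h3, mul_comm (qPochInf q q)⁻¹, inv_mul_cancel_right₀ hQ.ne']
  exact hs.hasSum

theorem tsum_int_even_odd {f : ℤ → ℝ} (hf : Summable f) :
    HasSum (fun l : ℤ => f (2 * l) + f (2 * l + 1)) (∑' j, f j) := by
  have he : Function.Injective fun l : ℤ => 2 * l := fun a b h => by simpa using h
  have ho : Function.Injective fun l : ℤ => 2 * l + 1 := fun a b h => by simpa using h
  have h1 := (hf.comp_injective he).hasSum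
  have h2 := (hf.comp_injective ho).hasSum
  have hc : IsCompl (Set.range fun l : ℤ => 2 * l) (Set.range fun l : ℤ => 2 * l + 1) := by
    simpa using Int.isCompl_even_odd
  have h5 := HasSum.add_isCompl (f := f) hc (he.hasSum_range_iff.mpr h1)
    (ho.hasSum_range_iff.mpr h2)
  rw [h5.tsum_eq]
  exact h1.add h2

/-- The total mass of the weights. -/
theorem hasSum_weight {q α : ℝ} (hq0 : 0 < q) (hq1 : q < 1) (hα : 0 < α) :
    HasSum (weight q α)
      (qPochInf (-α ^ 2) q * qPochInf (-(q / α ^ 2)) q * qPochInf q q) := by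
  have h := hasSum_thetaTerm hq0 hq1 (z := α ^ 2) (by positivity)
  have h1 := tsum_int_even_odd h.summable
  rw [h.tsum_eq] at h1
  -- At z = α² the theta terms of index 2l and 2l + 1 add up to w_l: their ratio is α²q^{2l}.
  refine (congrArg (fun f => HasSum f _) (funext fun l => ?_)).mpr h1
  rw [thetaTerm_add_one hq0 (by positivity), weight, thetaTerm]
  have e1 : 2 * l * (2 * l - 1) / 2 = 2 * l ^ 2 - l := by
    rw [show 2 * l * (2 * l - 1) = (2 * l ^ 2 - l) * 2 by ring]
    exact Int.mul_ediv_cancel _ two_ne_zero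
  have e2 : (α ^ 2) ^ (2 * l) = α ^ (4 * l) := by
    rw [← zpow_natCast, ← zpow_mul]
    congr 1
    push_cast
    ring
  rw [e1, e2]
  ring


/-! ### Polynomials on the mass points -/

/-- These are the even-indexed theta terms at √z. -/
theorem summable_zpow_quadratic {q z : ℝ} (hq0 : 0 < q) (hq1 : q < 1) (hz : 0 < z) :
    Summable fun l : ℤ => q ^ (2 * l ^ 2 - l) * z ^ l := by
  have h := (summable_thetaTerm hq0 hq1 (Real.sqrt_pos.mpr hz)).comp_injective
    (i := fun l : ℤ => 2 * l) (fun a b h => by simpa using h)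
  refine h.congr fun l => ?_
  have e1 : 2 * l * (2 * l - 1) / 2 = 2 * l ^ 2 - l := by
    rw [show 2 * l * (2 * l - 1) = (2 * l ^ 2 - l) * 2 by ring]
    exact Int.mul_ediv_cancel _ two_ne_zero
  have e2 : √z ^ (2 * l) = z ^ l := by
    rw [zpow_mul]
    congr 1
    exact Real.sq_sqrt hz.le
  simp only [Function.comp_apply, thetaTerm, e1, e2]

theorem summable_weight_mul_zpow {q α : ℝ} (hq0 : 0 < q) (hq1 : q < 1) (hα : 0 < α) (k : ℤ) :
    Summable fun l : ℤ => weight q α l * (α * q ^ l) ^ k := by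
  have h1 := summable_zpow_quadratic hq0 hq1 (z := α ^ 4 * q ^ k) (by positivity)
  have h2 := summable_zpow_quadratic hq0 hq1 (z := α ^ 4 * q ^ k * q ^ 2) (by positivity)
  refine ((h1.add (h2.mul_left (α ^ 2))).mul_left (α ^ k)).congr fun l => ?_
  have e1 : (q ^ k) ^ l = (q ^ l) ^ k := by rw [← zpow_mul, ← zpow_mul, mul_comm]
  have e2 : α ^ (4 * l) = (α ^ 4) ^ l := zpow_mul α 4 l
  have e3 : q ^ (2 * l) = (q ^ 2) ^ l := zpow_mul q 2 l
  rw [weight, mul_zpow α, mul_zpow _ (q ^ 2), mul_zpow _ (q ^ k), e1, e2, e3]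
  ring

/-- Bounding |x_l|^k by powers of u = αq^l reduces all moments to theta-like series. -/
theorem abs_massPoint_pow_le {q α : ℝ} (hq0 : 0 < q) (hα : 0 < α) (l : ℤ) (k : ℕ) :
    |massPoint q α l| ^ k ≤ (α * q ^ l) ^ (k : ℤ) + (α * q ^ l) ^ (-k : ℤ) := by
  have hu : 0 < α * q ^ l := by positivity
  rw [massPoint, zpow_neg, zpow_natCast, ← inv_pow]
  generalize α * q ^ l = u at hu
  have hi : 0 < u⁻¹ := inv_pos.mpr hu
  rcases le_total u u⁻¹ with h | h
  · have : |(u⁻¹ - u) / 2| ≤ u⁻¹ := by rw [abs_le]; constructor <;> linarith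
    have := pow_le_pow_left₀ (abs_nonneg _) this k
    have : 0 < u ^ k := by positivity
    linarith
  · have : |(u⁻¹ - u) / 2| ≤ u := by rw [abs_le]; constructor <;> linarith
    have := pow_le_pow_left₀ (abs_nonneg _) this k
    have : 0 < u⁻¹ ^ k := by positivity
    linarith

theorem summable_weight_mul_abs_pow {q α : ℝ} (hq0 : 0 < q) (hq1 : q < 1) (hα : 0 < α) (k : ℕ) :
    Summable fun l : ℤ => weight q α l * |massPoint q α l| ^ k := by
  refine Summable.of_nonneg_of_le
    (fun l => mul_nonneg (weight_pos hq0 hα l).le (by positivity)) (fun l => ?_)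
    ((summable_weight_mul_zpow hq0 hq1 hα k).add (summable_weight_mul_zpow hq0 hq1 hα (-k)))
  rw [← mul_add]
  exact mul_le_mul_of_nonneg_left (abs_massPoint_pow_le hq0 hα l k) (weight_pos hq0 hα l).le

theorem summable_weight_mul_eval {q α : ℝ} (hq0 : 0 < q) (hq1 : q < 1) (hα : 0 < α) (P : ℝ[X]) :
    Summable fun l : ℤ => weight q α l * P.eval (massPoint q α l) := by
  induction P using Polynomial.induction_on' with
  | add P Q hP hQ => simpa [mul_add] using hP.add hQ
  | monomial k c =>
    refine Summable.of_norm_bounded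
      ((summable_weight_mul_abs_pow hq0 hq1 hα k).mul_left |c|) (fun l => le_of_eq ?_)
    rw [eval_monomial, norm_mul, norm_mul, norm_pow, Real.norm_of_nonneg (weight_pos hq0 hα l).le]
    simp only [Real.norm_eq_abs]
    ring

theorem memlp_poly {q α : ℝ} (hq0 : 0 < q) (hq1 : q < 1) (hα : 0 < α) (P : ℂ[X]) :
    Memℓp (fun l : ℤ => (√(weight q α l) : ℂ) * P.eval (massPoint q α l : ℂ)) 2 := by
  induction P using Polynomial.induction_on' with
  | add P Q hP hQ => simpa [mul_add] using! hP.add hQ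
  | monomial k c =>
    have h : Memℓp (fun l : ℤ => (√(weight q α l) : ℂ) * (massPoint q α l : ℂ) ^ k) 2 := by
      refine memℓp_gen ((summable_weight_mul_abs_pow hq0 hq1 hα (2 * k)).congr fun l => ?_)
      rw [ENNReal.toReal_ofNat, Real.rpow_two, norm_mul, norm_pow, Complex.norm_real,
        Complex.norm_real, mul_pow, Real.norm_of_nonneg (Real.sqrt_nonneg _),
        Real.sq_sqrt (weight_pos hq0 hα l).le, Real.norm_eq_abs, ← pow_mul, mul_comm k]
    convert h.const_smul c using 1
    ext l
    simp [eval_monomial]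
    ring

/-- The sequence `√w_l P(x_l)` in `ℓ²(ℤ)`. -/
noncomputable def polyVec {q α : ℝ} (hq0 : 0 < q) (hq1 : q < 1) (hα : 0 < α) (P : ℂ[X]) : EllTwo :=
  ⟨fun l : ℤ => (√(weight q α l) : ℂ) * P.eval (massPoint q α l : ℂ), memlp_poly hq0 hq1 hα P⟩

/-- The sequence `√w_l h_n(x_l)` in `ℓ²(ℤ)`. -/
noncomputable def hermiteVec {q α : ℝ} (hq0 : 0 < q) (hq1 : q < 1) (hα : 0 < α) (n : ℕ) : EllTwo :=
  polyVec hq0 hq1 hα ((hermite q n).map Complex.ofRealHom)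

theorem hermiteVec_apply {q α : ℝ} (hq0 : 0 < q) (hq1 : q < 1) (hα : 0 < α) (n : ℕ) (l : ℤ) :
    hermiteVec hq0 hq1 hα n l =
      ((√(weight q α l) * (hermite q n).eval (massPoint q α l) : ℝ) : ℂ) := by
  have e : ((hermite q n).map Complex.ofRealHom).eval (massPoint q α l : ℂ)
      = (((hermite q n).eval (massPoint q α l) : ℝ) : ℂ) := by
    rw [eval_map, ← Complex.ofRealHom_eq_coe, eval₂_at_apply]
    rfl
  simp [hermiteVec, polyVec, e]

theorem opL_hermiteVec {q α : ℝ} (hq0 : 0 < q) (hq1 : q < 1) (hα : 0 < α) (n : ℕ) :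
    opL q α hq0 (hermiteVec hq0 hq1 hα n) = ((q : ℂ) ^ n) • hermiteVec hq0 hq1 hα n := by
  ext l
  have h := jacobi_hermite hq0 hq1 hα n l
  rw [opL_apply, lp.coeFn_smul, Pi.smul_apply, smul_eq_mul]
  simp only [hermiteVec_apply]
  exact_mod_cast congrArg (fun x : ℝ => (x : ℂ)) h

/-! ### Self-adjointness and factorization of the Jacobi operator -/

/-- The adjoint of a weighted shift is the opposite shift with translated weights: reindex the sum.
-/
theorem inner_mulShift (a : ℤ → ℝ) (M M' : ℝ) (hM : ∀ k, |a k| ≤ M) (s : ℤ)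
    (hM' : ∀ k, |a (k - s)| ≤ M') (v w : EllTwo) :
    inner ℂ (mulShift a M hM s v) w
      = inner ℂ v (mulShift (fun k => a (k - s)) M' hM' (-s) w) := by
  have h1 := lp.hasSum_inner (𝕜 := ℂ) (mulShift a M hM s v) w
  have h2 := lp.hasSum_inner (𝕜 := ℂ) v (mulShift (fun k => a (k - s)) M' hM' (-s) w)
  refine h1.unique (((Equiv.addRight s).hasSum_iff.mpr h2).congr_fun fun k => ?_)
  simp [mulShift_apply]
  ring

theorem opL_isSymmetric (q α : ℝ) (hq0 : 0 < q) :
    (opL q α hq0).toLinearMap.IsSymmetric := by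
  intro v w
  have h1 := inner_mulShift (coeffA q α) _ _ (abs_coeffA_le hq0 α) 1
    (fun k => abs_coeffA_le hq0 α (k - 1)) v w
  -- The third summand of L is the adjoint of the first, so the same identity is taken with v and w
  -- exchanged and then conjugated.
  have h2 := inner_mulShift (coeffA q α) _ _ (abs_coeffA_le hq0 α) 1
    (fun k => abs_coeffA_le hq0 α (k - 1)) w v
  have h3 := inner_mulShift (coeffB q α) _ _ (abs_coeffB_le hq0 α) 0
    (fun k => abs_coeffB_le hq0 α (k - 0)) v w
  rw [← inner_conj_symm, ← inner_conj_symm w, (starRingEnd ℂ).injective.eq_iff] at h2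
  simp only [sub_zero, neg_zero] at h3
  simp only [opL, ContinuousLinearMap.coe_coe, add_apply, inner_add_left,
    inner_add_right, h1, h3, h2]
  ring

/-- The diagonal coefficients of the factor `D` in `L = D* D`. -/
noncomputable def factorC (q α : ℝ) (l : ℤ) : ℝ :=
  √(α ^ 2 * q ^ (2 * l) / ((1 + α ^ 2 * q ^ (2 * l + 1)) * (1 + α ^ 2 * q ^ (2 * l))))

/-- The off-diagonal coefficients of the factor `D` in `L = D* D`. -/
noncomputable def factorD (q α : ℝ) (l : ℤ) : ℝ :=
  √(α ^ 2 * q ^ (2 * l + 1) / ((1 + α ^ 2 * q ^ (2 * l + 1)) * (1 + α ^ 2 * q ^ (2 * l + 2))))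

theorem abs_factorC_le {q : ℝ} (hq0 : 0 < q) (α : ℝ) (l : ℤ) : |factorC q α l| ≤ 1 := by
  rw [factorC, abs_of_nonneg (Real.sqrt_nonneg _), Real.sqrt_le_iff]
  refine ⟨zero_le_one, ?_⟩
  rw [one_pow, div_le_one (by positivity)]
  have h1 : 0 ≤ α ^ 2 * q ^ (2 * l) := by positivity
  have h2 : 0 ≤ α ^ 2 * q ^ (2 * l + 1) := by positivity
  nlinarith

theorem abs_factorD_le {q : ℝ} (hq0 : 0 < q) (α : ℝ) (l : ℤ) : |factorD q α l| ≤ 1 := by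
  rw [factorD, abs_of_nonneg (Real.sqrt_nonneg _), Real.sqrt_le_iff]
  refine ⟨zero_le_one, ?_⟩
  rw [one_pow, div_le_one (by positivity)]
  have h1 : 0 ≤ α ^ 2 * q ^ (2 * l + 2) := by positivity
  have h2 : 0 ≤ α ^ 2 * q ^ (2 * l + 1) := by positivity
  nlinarith

theorem factorC_mul_factorD {q α : ℝ} (hq0 : 0 < q) (l : ℤ) :
    factorC q α l * factorD q α l = coeffA q α l := by
  have h1 : 0 ≤ α ^ 2 * q ^ (2 * l) / ((1 + α ^ 2 * q ^ (2 * l + 1)) * (1 + α ^ 2 * q ^ (2 * l))) := by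
    positivity
  rw [factorC, factorD, ← Real.sqrt_mul h1, Real.sqrt_eq_iff_mul_self_eq (by positivity)
    (by unfold coeffA; positivity), coeffA]
  have e3 : q ^ (2 * (l : ℝ) + 1 / 2) * q ^ (2 * (l : ℝ) + 1 / 2)
      = q ^ (2 * l) * q ^ (2 * l + 1) := by
    rw [← Real.rpow_add hq0, ← zpow_add₀ hq0.ne', ← Real.rpow_intCast]
    congr 1
    push_cast
    ring
  have h2 : 0 ≤ (1 + α ^ 2 * q ^ (2 * l)) * (1 + α ^ 2 * q ^ (2 * l + 2)) := by positivity
  have h3 := Real.sq_sqrt h2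
  have h4 : √((1 + α ^ 2 * q ^ (2 * l)) * (1 + α ^ 2 * q ^ (2 * l + 2))) ≠ 0 := by positivity
  generalize √((1 + α ^ 2 * q ^ (2 * l)) * (1 + α ^ 2 * q ^ (2 * l + 2))) = R at h3 h4 ⊢
  generalize q ^ (2 * (l : ℝ) + 1 / 2) = X at e3 ⊢
  symm
  calc _ = α ^ 2 * α ^ 2 * (X * X) /
        (1 + α ^ 2 * q ^ (2 * l + 1)) ^ 2 / R ^ 2 := by field_simp
    _ = _ := by
      rw [e3, h3]
      field_simp

theorem factorC_sq_add_factorD_sq {q α : ℝ} (hq0 : 0 < q) (l : ℤ) :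
    factorC q α l ^ 2 + factorD q α (l - 1) ^ 2 = coeffB q α l := by
  rw [factorC, factorD, coeffB, Real.sq_sqrt (by positivity), Real.sq_sqrt (by positivity),
    show 2 * (l - 1) + 1 = 2 * l - 1 by ring, show 2 * (l - 1) + 2 = 2 * l by ring]
  have e1 : q ^ (2 * l + 1) = q ^ (2 * l - 1) * q * q := by
    rw [← zpow_add_one₀ hq0.ne', ← zpow_add_one₀ hq0.ne']
    congr 1
    ring
  have e2 : q ^ (2 * l) = q ^ (2 * l - 1) * q := by
    rw [← zpow_add_one₀ hq0.ne', sub_add_cancel]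
  rw [e1, e2]
  have hx : 0 < q ^ (2 * l - 1) := by positivity
  generalize q ^ (2 * l - 1) = x at hx
  field_simp
  ring

/-- The factor `D` in `L = D* D`. -/
noncomputable def factorOp (q α : ℝ) (hq0 : 0 < q) : EllTwo →L[ℂ] EllTwo :=
  mulShift (factorC q α) 1 (abs_factorC_le hq0 α) 0
    + mulShift (factorD q α) 1 (abs_factorD_le hq0 α) 1

theorem factorOp_apply (q α : ℝ) (hq0 : 0 < q) (v : EllTwo) (k : ℤ) :
    factorOp q α hq0 v k = (factorC q α k : ℂ) * v k + (factorD q α k : ℂ) * v (k + 1) := by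
  simp [factorOp, mulShift_apply]

/-- `L = D* D`. -/
theorem inner_factorOp (q α : ℝ) (hq0 : 0 < q) (v w : EllTwo) :
    inner ℂ (factorOp q α hq0 v) (factorOp q α hq0 w) = inner ℂ v (opL q α hq0 w) := by
  have h1 := inner_mulShift (factorC q α) _ _ (abs_factorC_le hq0 α) 0
    (fun k => abs_factorC_le hq0 α (k - 0)) v (factorOp q α hq0 w)
  have h2 := inner_mulShift (factorD q α) _ _ (abs_factorD_le hq0 α) 1
    (fun k => abs_factorD_le hq0 α (k - 1)) v (factorOp q α hq0 w)
  have h0 : factorOp q α hq0 v = mulShift (factorC q α) 1 (abs_factorC_le hq0 α) 0 v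
    + mulShift (factorD q α) 1 (abs_factorD_le hq0 α) 1 v := rfl
  rw [h0, inner_add_left, h1, h2, ← inner_add_right]
  congr 1
  ext k
  rw [lp.coeFn_add, Pi.add_apply, mulShift_apply, mulShift_apply, factorOp_apply, factorOp_apply,
    opL_apply, ← factorC_mul_factorD hq0, ← factorC_mul_factorD hq0,
    ← factorC_sq_add_factorD_sq hq0]
  simp only [sub_zero, neg_zero, add_zero]
  rw [show k + -1 + 1 = k by ring, show k + -1 = k - 1 by ring]
  push_cast
  ring

/-- `D` is injective. -/
theorem factorOp_injective {q α : ℝ} (hq0 : 0 < q) (hq1 : q < 1) (hα : 0 < α) (hα1 : α ≤ 1)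
    {v : EllTwo}     (hv : factorOp q α hq0 v = 0) : v = 0 := by
  have hc : ∀ k, 0 < factorC q α k := fun k => by unfold factorC; positivity
  have hd : ∀ k, 0 < factorD q α k := fun k => by unfold factorD; positivity
  have h1 : ∀ k : ℤ, factorC q α k * ‖v k‖ = factorD q α k * ‖v (k + 1)‖ := by
    intro k
    have h := congrArg (fun x : EllTwo => x k) hv
    simp only [factorOp_apply, lp.coeFn_zero, Pi.zero_apply] at h
    have h2 := congrArg norm (eq_neg_of_add_eq_zero_left h)
    rwa [norm_neg, norm_mul, norm_mul, Complex.norm_real, Complex.norm_real,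
      Real.norm_of_nonneg (hc k).le, Real.norm_of_nonneg (hd k).le] at h2
  -- With t = α²q^{2n} the inequality of the squares amounts to (1 - q)(1 - tq) ≥ 0, and α ≤ 1 gives
  -- t ≤ 1 already from n = 0 on.
  have hcd : ∀ n : ℕ, factorD q α n ≤ factorC q α n := by
    intro n
    refine Real.sqrt_le_sqrt ?_
    have e1 : α ^ 2 * q ^ (2 * (n : ℤ) + 1) = α ^ 2 * q ^ (2 * (n : ℤ)) * q := by
      rw [zpow_add_one₀ hq0.ne', mul_assoc]
    have e2 : α ^ 2 * q ^ (2 * (n : ℤ) + 2) = α ^ 2 * q ^ (2 * (n : ℤ)) * q ^ 2 := by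
      rw [zpow_add₀ hq0.ne', mul_assoc]
      norm_cast
    have e3 : α ^ 2 * q ^ (2 * (n : ℤ)) ≤ 1 := by
      refine mul_le_one₀ (pow_le_one₀ hα.le hα1) (by positivity) ?_
      rw [show 2 * (n : ℤ) = ((2 * n : ℕ) : ℤ) by push_cast; rfl, zpow_natCast]
      exact pow_le_one₀ hq0.le hq1.le
    have e4 : 0 < α ^ 2 * q ^ (2 * (n : ℤ)) := by positivity
    rw [e1, e2]
    generalize α ^ 2 * q ^ (2 * (n : ℤ)) = t at e3 e4
    rw [div_le_div_iff₀ (by positivity) (by positivity)]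
    have h5 : 0 ≤ t * (1 + t * q) * ((1 - q) * (1 - t * q)) := by
      have : t * q ≤ 1 := by nlinarith
      have : 0 ≤ (1 - q) * (1 - t * q) := mul_nonneg (by linarith) (by linarith)
      positivity
    linear_combination h5
  -- A kernel vector has nondecreasing |v_n| for n ≥ 0, while square summability makes |v_n| tend to
  -- 0. So it vanishes there, and the recursion, run backwards, kills the negative indices.
  have hmono : Monotone fun n : ℕ => ‖v n‖ := by
    refine monotone_nat_of_le_succ fun n => ?_
    have h2 := h1 n
    have h3 : factorC q α n * ‖v n‖ ≤ factorC q α n * ‖v (n + 1 : ℕ)‖ := by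
      rw [h2, Nat.cast_succ]
      exact mul_le_mul_of_nonneg_right (hcd n) (norm_nonneg _)
    exact le_of_mul_le_mul_left h3 (hc n)
  have hlim : Tendsto (fun n : ℕ => ‖v n‖) atTop (𝓝 0) := by
    have h2 : (0 : ℝ) < (2 : ℝ≥0∞).toReal := by norm_num
    have h3 := (((lp.memℓp v).summable h2).comp_injective Nat.cast_injective).tendsto_atTop_zero
    have h4 := h3.sqrt
    simpa [Function.comp_def] using h4
  have hnat : ∀ n : ℕ, v n = 0 := fun n =>
    norm_le_zero_iff.mp (hmono.ge_of_tendsto hlim n)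
  have hneg : ∀ n : ℕ, v (-n) = 0 := by
    intro n
    induction n with
    | zero => simpa using hnat 0
    | succ n ih =>
      have h2 := h1 (-(n + 1 : ℕ))
      rw [show (-((n + 1 : ℕ) : ℤ) + 1) = -n by push_cast; ring, ih, norm_zero, mul_zero,
        mul_eq_zero] at h2
      exact norm_eq_zero.mp (h2.resolve_left (hc _).ne')
  ext k
  rcases Int.eq_nat_or_neg k with ⟨n, rfl | rfl⟩
  · exact hnat n
  · exact hneg n


/-! ### The discrete orthogonality relations -/

/-- `∑_l w_l P(x_l)`. -/
noncomputable def weightSum (q α : ℝ) (P : ℝ[X]) : ℝ :=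
  ∑' l : ℤ, weight q α l * P.eval (massPoint q α l)

theorem weightSum_add {q α : ℝ} (hq0 : 0 < q) (hq1 : q < 1) (hα : 0 < α) (P Q : ℝ[X]) :
    weightSum q α (P + Q) = weightSum q α P + weightSum q α Q := by
  rw [weightSum, weightSum, weightSum, ← (summable_weight_mul_eval hq0 hq1 hα P).tsum_add
    (summable_weight_mul_eval hq0 hq1 hα Q)]
  exact tsum_congr fun l => by rw [eval_add, mul_add]

theorem weightSum_C_mul (q α c : ℝ) (P : ℝ[X]) :
    weightSum q α (C c * P) = c * weightSum q α P := by
  rw [weightSum, weightSum, ← tsum_mul_left]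
  exact tsum_congr fun l => by rw [eval_mul, eval_C]; ring

theorem inner_hermiteVec {q α : ℝ} (hq0 : 0 < q) (hq1 : q < 1) (hα : 0 < α) (n m : ℕ) :
    inner ℂ (hermiteVec hq0 hq1 hα n) (hermiteVec hq0 hq1 hα m)
      = (weightSum q α (hermite q n * hermite q m) : ℂ) := by
  have h1 := lp.hasSum_inner (𝕜 := ℂ) (hermiteVec hq0 hq1 hα n) (hermiteVec hq0 hq1 hα m)
  have h2 := Complex.hasSum_ofReal.mpr
    (summable_weight_mul_eval hq0 hq1 hα (hermite q n * hermite q m)).hasSum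
  refine h1.unique (h2.congr_fun fun l => ?_)
  have h3 := Real.mul_self_sqrt (weight_pos hq0 hα l).le
  rw [hermiteVec_apply, hermiteVec_apply, RCLike.inner_apply, Complex.conj_ofReal,
    ← Complex.ofReal_mul]
  congr 1
  rw [eval_mul]
  linear_combination (hermite q n).eval (massPoint q α l) * (hermite q m).eval (massPoint q α l) * h3

theorem inner_hermiteVec_of_ne {q α : ℝ} (hq0 : 0 < q) (hq1 : q < 1) (hα : 0 < α) {n m : ℕ}
    (hnm : n ≠ m) : inner ℂ (hermiteVec hq0 hq1 hα n) (hermiteVec hq0 hq1 hα m) = 0 := by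
  have h := opL_isSymmetric q α hq0 (hermiteVec hq0 hq1 hα n) (hermiteVec hq0 hq1 hα m)
  simp only [ContinuousLinearMap.coe_coe, opL_hermiteVec, inner_smul_left, inner_smul_right,
    map_pow, Complex.conj_ofReal] at h
  by_contra h0
  have h1 := mul_right_cancel₀ h0 h
  norm_cast at h1
  exact hnm (pow_right_injective₀ hq0 hq1.ne h1)

theorem weightSum_hermite_of_ne {q α : ℝ} (hq0 : 0 < q) (hq1 : q < 1) (hα : 0 < α) {n m : ℕ}
    (hnm : n ≠ m) : weightSum q α (hermite q n * hermite q m) = 0 := by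
  have h := inner_hermiteVec_of_ne hq0 hq1 hα hnm
  rw [inner_hermiteVec] at h
  exact_mod_cast h

theorem hermite_succ_succ (q : ℝ) (n : ℕ) : hermite q (n + 2) = 2 * X * hermite q (n + 1)
    - C ((q ^ (n + 1))⁻¹ * (1 - q ^ (n + 1))) * hermite q n := rfl

/-- Evaluate the weighted sum of 2x h_{n+1} h_n in two ways, applying the recurrence to 2x h_{n+1}
or to 2x h_n; orthogonality leaves one term each time. -/
theorem weightSum_hermite_sq_succ {q α : ℝ} (hq0 : 0 < q) (hq1 : q < 1) (hα : 0 < α) (n : ℕ) :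
    weightSum q α (hermite q (n + 1) * hermite q (n + 1))
      = (q ^ (n + 1))⁻¹ * (1 - q ^ (n + 1)) * weightSum q α (hermite q n * hermite q n) := by
  have h1 : weightSum q α (2 * X * hermite q (n + 1) * hermite q n)
      = (q ^ (n + 1))⁻¹ * (1 - q ^ (n + 1)) * weightSum q α (hermite q n * hermite q n) := by
    rw [show 2 * X * hermite q (n + 1) * hermite q n = hermite q (n + 2) * hermite q n
      + C ((q ^ (n + 1))⁻¹ * (1 - q ^ (n + 1))) * (hermite q n * hermite q n) by
        rw [hermite_succ_succ]; ring, weightSum_add hq0 hq1 hα, weightSum_C_mul,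
      weightSum_hermite_of_ne hq0 hq1 hα (by omega), zero_add]
  rw [← h1]
  cases n with
  | zero => simp [hermite]
  | succ n =>
    rw [show 2 * X * hermite q (n + 1 + 1) * hermite q (n + 1)
      = hermite q (n + 2) * hermite q (n + 2)
        + C ((q ^ (n + 1))⁻¹ * (1 - q ^ (n + 1))) * (hermite q (n + 2) * hermite q n) by
        rw [hermite_succ_succ]; ring, weightSum_add hq0 hq1 hα, weightSum_C_mul,
      weightSum_hermite_of_ne hq0 hq1 hα (n := n + 2) (m := n) (by omega), mul_zero, add_zero]

/-- The total mass of the discrete measure. -/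
noncomputable def totalMass (q α : ℝ) : ℝ :=
  qPochInf (-α ^ 2) q * qPochInf (-(q / α ^ 2)) q * qPochInf q q

theorem totalMass_pos {q α : ℝ} (hq0 : 0 < q) (hq1 : q < 1) : 0 < totalMass q α := by
  have h1 := one_le_qPochInf hq0 hq1 (a := -α ^ 2) (by nlinarith [sq_nonneg α])
  have h2 := one_le_qPochInf hq0 hq1 (a := -(q / α ^ 2)) (neg_nonpos.mpr (by positivity))
  have h3 := qPochInf_self_pos hq0 hq1
  unfold totalMass
  positivity

theorem weightSum_hermite_sq {q α : ℝ} (hq0 : 0 < q) (hq1 : q < 1) (hα : 0 < α) (n : ℕ) :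
    weightSum q α (hermite q n * hermite q n)
      = (q ^ (n * (n + 1) / 2))⁻¹ * qPoch q q n * totalMass q α := by
  induction n with
  | zero => simp [weightSum, hermite, (hasSum_weight hq0 hq1 hα).tsum_eq, qPoch, totalMass]
  | succ n ih =>
    have e : (n + 1) * (n + 1 + 1) / 2 = n * (n + 1) / 2 + (n + 1) := by
      rw [show (n + 1) * (n + 1 + 1) = n * (n + 1) + (n + 1) * 2 by ring,
        Nat.add_mul_div_right _ _ two_pos]
    rw [weightSum_hermite_sq_succ hq0 hq1 hα, ih, e, pow_add q, qPoch_succ, mul_inv,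
      ← pow_succ' q n]
    ring

theorem hasSum_weight_mul_hermite {q α : ℝ} (hq0 : 0 < q) (hq1 : q < 1) (hα : 0 < α) (n m : ℕ) :
    HasSum (fun l : ℤ => weight q α l * (hermite q n).eval (massPoint q α l)
        * (hermite q m).eval (massPoint q α l))
      (if n = m then (q ^ (n * (n + 1) / 2))⁻¹ * qPoch q q n * totalMass q α else 0) := by
  have h := (summable_weight_mul_eval hq0 hq1 hα (hermite q n * hermite q m)).hasSum
  have h1 : weightSum q α (hermite q n * hermite q m) =
      if n = m then (q ^ (n * (n + 1) / 2))⁻¹ * qPoch q q n * totalMass q α else 0 := by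
    split_ifs with hnm
    · rw [← hnm, weightSum_hermite_sq hq0 hq1 hα]
    · exact weightSum_hermite_of_ne hq0 hq1 hα hnm
  rw [← weightSum, h1] at h
  exact h.congr_fun fun l => by rw [eval_mul, mul_assoc]

theorem norm_hermiteVec_sq {q α : ℝ} (hq0 : 0 < q) (hq1 : q < 1) (hα : 0 < α) (n : ℕ) :
    ‖hermiteVec hq0 hq1 hα n‖ ^ 2
      = (q ^ (n * (n + 1) / 2))⁻¹ * qPoch q q n * totalMass q α := by
  have h := inner_hermiteVec hq0 hq1 hα n n
  rw [inner_self_eq_norm_sq_to_K, weightSum_hermite_sq hq0 hq1 hα] at h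
  apply Complex.ofReal_injective
  rw [← h]
  push_cast
  rfl

theorem hermiteVec_ne_zero {q α : ℝ} (hq0 : 0 < q) (hq1 : q < 1) (hα : 0 < α) (n : ℕ) :
    hermiteVec hq0 hq1 hα n ≠ 0 := by
  intro h
  have h1 := norm_hermiteVec_sq hq0 hq1 hα n
  have h2 := qPoch_self_pos hq0 hq1 n
  have h3 := totalMass_pos (α := α) hq0 hq1
  rw [h, norm_zero] at h1
  have : 0 < (q ^ (n * (n + 1) / 2))⁻¹ * qPoch q q n * totalMass q α := by positivity
  linarith

/-! ### Completeness of the eigenvectors -/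

/-- The normalized eigenvectors. -/
noncomputable def hermiteUnit {q α : ℝ} (hq0 : 0 < q) (hq1 : q < 1) (hα : 0 < α) (n : ℕ) :
    EllTwo := ((‖hermiteVec hq0 hq1 hα n‖⁻¹ : ℝ) : ℂ) • hermiteVec hq0 hq1 hα n

theorem orthonormal_hermiteUnit {q α : ℝ} (hq0 : 0 < q) (hq1 : q < 1) (hα : 0 < α) :
    Orthonormal ℂ (hermiteUnit hq0 hq1 hα) := by
  refine ⟨fun n => ?_, fun n m hnm => ?_⟩
  · rw [hermiteUnit, norm_smul, Complex.norm_real, norm_inv, norm_norm]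
    exact inv_mul_cancel₀ (norm_ne_zero_iff.mpr (hermiteVec_ne_zero hq0 hq1 hα n))
  · simp [hermiteUnit, inner_smul_left, inner_smul_right, inner_hermiteVec_of_ne hq0 hq1 hα hnm]

theorem opL_hermiteUnit {q α : ℝ} (hq0 : 0 < q) (hq1 : q < 1) (hα : 0 < α) (n : ℕ) :
    opL q α hq0 (hermiteUnit hq0 hq1 hα n) = ((q : ℂ) ^ n) • hermiteUnit hq0 hq1 hα n := by
  rw [hermiteUnit, map_smul, opL_hermiteVec, smul_comm]

/-- The trace of the Jacobi operator. -/
theorem hasSum_coeffB {q α : ℝ} (hq0 : 0 < q) (hq1 : q < 1) (hα : 0 < α) :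
    HasSum (coeffB q α) (1 - q)⁻¹ := by
  -- A discrete antiderivative of b_l, with limit 1/(1-q) at +∞ and 0 at -∞.
  set F : ℤ → ℝ := fun l => ((1 - q) * (1 + α ^ 2 * q ^ (2 * l - 1)))⁻¹ with hF
  have h1q : 0 < 1 - q := by linarith
  have hB : ∀ l, coeffB q α l = F (l + 1) - F l := by
    intro l
    have e1 : q ^ (2 * l + 1) = q ^ (2 * l - 1) * q * q := by
      rw [← zpow_add_one₀ hq0.ne', ← zpow_add_one₀ hq0.ne']
      congr 1
      ring
    simp only [hF, coeffB, show 2 * (l + 1) - 1 = 2 * l + 1 by ring, e1]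
    have hx : 0 < q ^ (2 * l - 1) := by positivity
    generalize q ^ (2 * l - 1) = x at hx
    field_simp
    ring
  have hq2 : Tendsto (fun n : ℕ => (q ^ 2) ^ n) atTop (𝓝 0) :=
    tendsto_pow_atTop_nhds_zero_of_lt_one (by positivity) (pow_lt_one₀ hq0.le hq1 two_ne_zero)
  have hB0 : ∀ l, 0 ≤ coeffB q α l := fun l => by unfold coeffB; positivity
  have hx1 : Tendsto (fun n : ℕ => F n) atTop (𝓝 (1 - q)⁻¹) := by
    have h := (((hq2.const_mul (α ^ 2 * q⁻¹)).const_add 1).const_mul (1 - q)).inv₀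
      (by rw [mul_zero, add_zero, mul_one]; exact h1q.ne')
    rw [mul_zero, add_zero, mul_one] at h
    refine h.congr fun n => ?_
    rw [hF]
    simp only
    rw [zpow_sub_one₀ hq0.ne', zpow_mul, zpow_natCast]
    norm_cast
    ring_nf
  have hx2 : Tendsto (fun n : ℕ => F (-n)) atTop (𝓝 0) := by
    have h := hq2.const_mul (q / ((1 - q) * α ^ 2))
    rw [mul_zero] at h
    refine squeeze_zero (fun n => by simp only [hF]; positivity) (fun n => ?_) h
    have e : q ^ (2 * -(n : ℤ) - 1) = ((q ^ 2) ^ n * q)⁻¹ := by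
      rw [← pow_mul, ← pow_succ, ← zpow_natCast, ← zpow_neg]
      congr 1
      push_cast
      ring
    have h2 : 0 < (q ^ 2) ^ n := by positivity
    simp only [hF, e]
    generalize (q ^ 2) ^ n = x at h2
    rw [inv_le_iff_one_le_mul₀ (by positivity)]
    field_simp
    have : 0 < x * q := by positivity
    linarith
  have s1 : HasSum (fun n : ℕ => coeffB q α n) ((1 - q)⁻¹ - F 0) := by
    rw [hasSum_iff_tendsto_nat_of_nonneg (fun n => hB0 n)]
    refine (hx1.sub_const (F 0)).congr fun n => ?_
    have := Finset.sum_range_sub (fun n : ℕ => F n) n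
    simp only [hB]
    push_cast at this
    exact this.symm
  have s2 : HasSum (fun n : ℕ => coeffB q α (-(n + 1))) (F 0 - 0) := by
    rw [hasSum_iff_tendsto_nat_of_nonneg (fun n => hB0 _)]
    refine (hx2.const_sub (F 0)).congr fun n => ?_
    have := Finset.sum_range_sub' (fun n : ℕ => F (-n)) n
    simp only [hB]
    push_cast at this
    rw [neg_zero] at this
    rw [← this]
    exact Finset.sum_congr rfl fun k _ => by rw [show -((k : ℤ) + 1) + 1 = -k by ring]
  have s3 := HasSum.of_nat_of_neg_add_one s1 s2
  rwa [show (1 - q)⁻¹ - F 0 + (F 0 - 0) = (1 - q)⁻¹ by ring] at s3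

theorem inner_basisVec (l : ℤ) (v : EllTwo) : inner ℂ (basisVec l) v = v l := by
  simp [basisVec, lp.inner_single_left]

theorem inner_basisVec_opL (q α : ℝ) (hq0 : 0 < q) (l : ℤ) :
    inner ℂ (basisVec l) (opL q α hq0 (basisVec l)) = (coeffB q α l : ℂ) := by
  rw [inner_basisVec, opL_apply]
  simp [basisVec, lp.single_apply]

/-- The part of `e_l` orthogonal to the first `N` eigenvectors. -/
noncomputable def residual {q α : ℝ} (hq0 : 0 < q) (hq1 : q < 1) (hα : 0 < α) (N : ℕ) (l : ℤ) :
    EllTwo :=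
  basisVec l - ∑ n ∈ Finset.range N,
    inner ℂ (hermiteUnit hq0 hq1 hα n) (basisVec l) • hermiteUnit hq0 hq1 hα n

/-- With r the residual, ‖Dr‖² = ⟨r, Lr⟩. Since r is orthogonal to the first N eigenvectors, this
equals ⟨r, Le_l⟩, the diagonal entry of L minus its first N spectral contributions. -/
theorem norm_factorOp_residual_sq {q α : ℝ} (hq0 : 0 < q) (hq1 : q < 1) (hα : 0 < α) (N : ℕ)
    (l : ℤ) : ‖factorOp q α hq0 (residual hq0 hq1 hα N l)‖ ^ 2
      = coeffB q α l - ∑ n ∈ Finset.range N, q ^ n * ‖hermiteUnit hq0 hq1 hα n l‖ ^ 2 := by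
  set f := hermiteUnit hq0 hq1 hα with hf
  set r := residual hq0 hq1 hα N l with hr
  have hon := orthonormal_hermiteUnit hq0 hq1 hα
  rw [← hf] at hon
  have h1 : ∀ n ∈ Finset.range N, inner ℂ r (f n) = 0 := by
    intro n hn
    rw [hr, residual, inner_sub_left, sum_inner]
    simp only [inner_smul_left, ← hf]
    rw [Finset.sum_eq_single_of_mem n hn (fun m _ hm => by rw [hon.2 hm, mul_zero]),
      inner_self_eq_norm_sq_to_K, hon.1 n, inner_conj_symm]
    simp
  have h2 : opL q α hq0 r = opL q α hq0 (basisVec l) - ∑ n ∈ Finset.range N,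
      (inner ℂ (f n) (basisVec l) * (q : ℂ) ^ n) • f n := by
    rw [hr, residual, map_sub, map_sum]
    congr 1
    exact Finset.sum_congr rfl fun n _ => by rw [map_smul, opL_hermiteUnit, smul_smul]
  have h3 : inner ℂ r (opL q α hq0 r) = inner ℂ r (opL q α hq0 (basisVec l)) := by
    rw [h2, inner_sub_right, inner_sum, Finset.sum_eq_zero, sub_zero]
    intro n hn
    rw [inner_smul_right, h1 n hn, mul_zero]
  have h4 : ∀ n, inner ℂ (f n) (opL q α hq0 (basisVec l))
      = (q : ℂ) ^ n * inner ℂ (f n) (basisVec l) := by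
    intro n
    have := opL_isSymmetric q α hq0 (f n) (basisVec l)
    simp only [ContinuousLinearMap.coe_coe] at this
    rw [← this, hf, opL_hermiteUnit, inner_smul_left, map_pow, Complex.conj_ofReal]
  have h5 : ∀ n, inner ℂ (f n) (basisVec l) = (starRingEnd ℂ) (f n l) := by
    intro n
    rw [← inner_conj_symm, inner_basisVec]
  have h6 : inner ℂ r (opL q α hq0 r) = ((coeffB q α l - ∑ n ∈ Finset.range N,
      q ^ n * ‖f n l‖ ^ 2 : ℝ) : ℂ) := by
    rw [h3, hr, residual, inner_sub_left, inner_basisVec_opL, sum_inner]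
    push_cast
    congr 1
    refine Finset.sum_congr rfl fun n _ => ?_
    rw [inner_smul_left, ← hf, h4, h5, Complex.conj_conj, ← Complex.mul_conj']
    ring
  rw [← inner_factorOp, inner_self_eq_norm_sq_to_K] at h6
  apply Complex.ofReal_injective
  rw [← h6]
  push_cast
  rfl

/-- Summed over l, the squares give the trace minus the first N eigenvalues, 1/(1-q) - ∑_{n<N} q^n =
q^N/(1-q). A single nonnegative term is at most the sum. -/
theorem norm_factorOp_residual_sq_le {q α : ℝ} (hq0 : 0 < q) (hq1 : q < 1) (hα : 0 < α) (N : ℕ)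
    (l : ℤ) : ‖factorOp q α hq0 (residual hq0 hq1 hα N l)‖ ^ 2 ≤ q ^ N * (1 - q)⁻¹ := by
  have h2 : (0 : ℝ) < (2 : ℝ≥0∞).toReal := by norm_num
  have h1 : ∀ n, HasSum (fun l => q ^ n * ‖hermiteUnit hq0 hq1 hα n l‖ ^ 2) (q ^ n) := by
    intro n
    have h := (lp.hasSum_norm h2 (hermiteUnit hq0 hq1 hα n)).mul_left (q ^ n)
    simpa [(orthonormal_hermiteUnit hq0 hq1 hα).1 n] using h
  have h3 := (hasSum_coeffB hq0 hq1 hα).sub (hasSum_sum (s := Finset.range N) fun n _ => h1 n)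
  have h4 : (1 - q)⁻¹ - ∑ n ∈ Finset.range N, q ^ n = q ^ N * (1 - q)⁻¹ := by
    have h5 : 1 - q ≠ 0 := by linarith
    have h6 := mul_neg_geom_sum q N
    field_simp
    linarith
  rw [h4] at h3
  have h5 := h3.congr_fun (norm_factorOp_residual_sq hq0 hq1 hα N)
  exact le_hasSum h5 l fun _ _ => sq_nonneg _

/-- If w is orthogonal to every eigenvector, so is Lw, and e_l may be replaced by its residual in
(Lw)_l = ⟨e_l, Lw⟩. This equals ⟨D r, D w⟩, which tends to 0 by the trace estimate. So Lw = 0, hence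
Dw = 0, and D is injective. -/
theorem eq_zero_of_inner_hermiteVec {q α : ℝ} (hq0 : 0 < q) (hq1 : q < 1) (hα : 0 < α)
    (hα1 : α ≤ 1) {w : EllTwo} (hw : ∀ n, inner ℂ (hermiteVec hq0 hq1 hα n) w = 0) : w = 0 := by
  have hf : ∀ n, inner ℂ (hermiteUnit hq0 hq1 hα n) w = 0 := fun n => by
    rw [hermiteUnit, inner_smul_left, hw, mul_zero]
  have hfL : ∀ n, inner ℂ (hermiteUnit hq0 hq1 hα n) (opL q α hq0 w) = 0 := fun n => by
    have := opL_isSymmetric q α hq0 (hermiteUnit hq0 hq1 hα n) w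
    simp only [ContinuousLinearMap.coe_coe] at this
    rw [← this, opL_hermiteUnit, inner_smul_left, hf, mul_zero]
  have h1 : ∀ N l, opL q α hq0 w l
      = inner ℂ (factorOp q α hq0 (residual hq0 hq1 hα N l)) (factorOp q α hq0 w) := by
    intro N l
    rw [inner_factorOp, residual, inner_sub_left, inner_basisVec, sum_inner, Finset.sum_eq_zero,
      sub_zero]
    intro n _
    rw [inner_smul_left, hfL, mul_zero]
  have hL : opL q α hq0 w = 0 := by
    ext l
    rw [lp.coeFn_zero, Pi.zero_apply, ← norm_le_zero_iff]
    have h2 : Tendsto (fun N : ℕ => √(q ^ N * (1 - q)⁻¹) * ‖factorOp q α hq0 w‖) atTop (𝓝 0) := by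
      have h3 := (((tendsto_pow_atTop_nhds_zero_of_lt_one hq0.le hq1).mul_const (1 - q)⁻¹).sqrt
        ).mul_const ‖factorOp q α hq0 w‖
      simpa using h3
    refine ge_of_tendsto h2 (Eventually.of_forall fun N => ?_)
    rw [h1 N l]
    refine (norm_inner_le_norm _ _).trans ?_
    gcongr
    exact Real.le_sqrt_of_sq_le (norm_factorOp_residual_sq_le hq0 hq1 hα N l)
  refine factorOp_injective hq0 hq1 hα hα1 ?_
  have h3 := inner_factorOp q α hq0 w w
  rwa [hL, inner_zero_right, inner_self_eq_zero] at h3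

theorem topologicalClosure_span_hermiteVec {q α : ℝ} (hq0 : 0 < q) (hq1 : q < 1) (hα : 0 < α)
    (hα1 : α ≤ 1) :
    (Submodule.span ℂ (Set.range (hermiteVec hq0 hq1 hα))).topologicalClosure = ⊤ := by
  rw [Submodule.topologicalClosure_eq_top_iff, Submodule.eq_bot_iff]
  intro w hw
  refine eq_zero_of_inner_hermiteVec hq0 hq1 hα hα1 fun n => ?_
  exact (Submodule.mem_orthogonal _ w).mp hw _ (Submodule.subset_span ⟨n, rfl⟩)


/-! ### The spectrum of the Jacobi operator -/

/-- L is the norm-convergent sum of the rank-one operators q^n⟨f_n, ·⟩f_n: both sides are continuous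
and agree on the dense span of the eigenvectors. -/
theorem isCompactOperator_opL {q α : ℝ} (hq0 : 0 < q) (hq1 : q < 1) (hα : 0 < α) (hα1 : α ≤ 1) :
    IsCompactOperator (opL q α hq0) := by
  have hon := orthonormal_hermiteUnit hq0 hq1 hα
  set f := hermiteUnit hq0 hq1 hα with hf
  let R : ℕ → EllTwo →L[ℂ] EllTwo := fun n => ((q : ℂ) ^ n) • (innerSL ℂ (f n)).smulRight (f n)
  have hR : ∀ n v, R n v = ((q : ℂ) ^ n) • inner ℂ (f n) v • f n := fun n v => rfl
  have hnorm : ∀ n, ‖R n‖ ≤ q ^ n := by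
    intro n
    refine ContinuousLinearMap.opNorm_le_bound _ (by positivity) fun v => ?_
    rw [hR, norm_smul, norm_smul, hon.1 n, mul_one, norm_pow, Complex.norm_real,
      Real.norm_of_nonneg hq0.le]
    have := norm_inner_le_norm (𝕜 := ℂ) (f n) v
    rw [hon.1 n, one_mul] at this
    gcongr
  have hs : Summable R :=
    Summable.of_norm_bounded (summable_geometric_of_lt_one hq0.le hq1) hnorm
  have hRc : ∀ n, IsCompactOperator (R n) := by
    intro n
    have h1 : IsCompactOperator (ContinuousLinearMap.toSpanSingleton ℂ (f n)) :=
      isCompactOperator_of_locallyCompactSpace_rng _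
    exact (h1.comp_clm (innerSL ℂ (f n))).smul ((q : ℂ) ^ n)
  have hT : ∑' n, R n = opL q α hq0 := by
    refine ContinuousLinearMap.ext_on (s := Set.range (hermiteVec hq0 hq1 hα)) ?_ ?_
    · rw [dense_iff_closure_eq, ← Submodule.topologicalClosure_coe,
        topologicalClosure_span_hermiteVec hq0 hq1 hα hα1]
      rfl
    · rintro _ ⟨m, rfl⟩
      have h0 := norm_ne_zero_iff.mpr (hermiteVec_ne_zero hq0 hq1 hα m)
      have h1 : hermiteVec hq0 hq1 hα m = ((‖hermiteVec hq0 hq1 hα m‖ : ℝ) : ℂ) • f m := by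
        rw [hf, hermiteUnit, smul_smul, ← Complex.ofReal_mul, mul_inv_cancel₀ h0,
          Complex.ofReal_one, one_smul]
      have h2 : (∑' n, R n) (f m) = ((q : ℂ) ^ m) • f m := by
        have h3 := hs.hasSum.mapL (ContinuousLinearMap.apply ℂ EllTwo (f m))
        refine h3.unique ?_
        convert hasSum_ite_eq m (((q : ℂ) ^ m) • f m) using 2 with n
        rw [ContinuousLinearMap.apply_apply, hR]
        split_ifs with hnm
        · rw [hnm, inner_self_eq_norm_sq_to_K, hon.1 m]
          simp
        · rw [hon.2 hnm, zero_smul, smul_zero]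
      rw [h1, map_smul, map_smul, h2, hf, opL_hermiteUnit]
  rw [← hT]
  refine isCompactOperator_of_tendsto hs.hasSum.tendsto_sum_nat (Eventually.of_forall fun N => ?_)
  exact Submodule.sum_mem (compactOperator (RingHom.id ℂ) EllTwo EllTwo) fun n _ => hRc n

theorem isSelfAdjoint_opL (q α : ℝ) (hq0 : 0 < q) : IsSelfAdjoint (opL q α hq0) :=
  ContinuousLinearMap.isSelfAdjoint_iff_isSymmetric.mpr (opL_isSymmetric q α hq0)

theorem not_hasEigenvalue_opL_zero {q α : ℝ} (hq0 : 0 < q) (hq1 : q < 1) (hα : 0 < α)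
    (hα1 : α ≤ 1) : ¬ Module.End.HasEigenvalue (opL q α hq0).toLinearMap 0 := by
  intro h
  obtain ⟨v, hv⟩ := h.exists_hasEigenvector
  have h1 : opL q α hq0 v = 0 := by simpa using hv.apply_eq_smul
  have h3 := inner_factorOp q α hq0 v v
  rw [h1, inner_zero_right, inner_self_eq_zero] at h3
  exact hv.2 (factorOp_injective hq0 hq1 hα hα1 h3)

/-- An eigenvector is orthogonal to the eigenvectors with a different eigenvalue. -/
theorem inner_hermiteVec_eq_zero_of_ne {q α : ℝ} (hq0 : 0 < q) (hq1 : q < 1) (hα : 0 < α)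
    {w : EllTwo} {z : ℂ} (hw : opL q α hq0 w = z • w) {n : ℕ} (hn : z ≠ (q : ℂ) ^ n) :
    inner ℂ (hermiteVec hq0 hq1 hα n) w = 0 := by
  have h := opL_isSymmetric q α hq0 (hermiteVec hq0 hq1 hα n) w
  simp only [ContinuousLinearMap.coe_coe, opL_hermiteVec, hw, inner_smul_left, inner_smul_right,
    map_pow, Complex.conj_ofReal] at h
  by_contra h0
  exact hn (mul_right_cancel₀ h0 h).symm

theorem hermiteVec_mem_eigenspace {q α : ℝ} (hq0 : 0 < q) (hq1 : q < 1) (hα : 0 < α) (n : ℕ) :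
    hermiteVec hq0 hq1 hα n ∈
      Module.End.eigenspace (opL q α hq0).toLinearMap ((q : ℂ) ^ n) :=
  Module.End.mem_eigenspace_iff.mpr (opL_hermiteVec hq0 hq1 hα n)

theorem eigenspace_opL {q α : ℝ} (hq0 : 0 < q) (hq1 : q < 1) (hα : 0 < α) (hα1 : α ≤ 1) (n : ℕ) :
    Module.End.eigenspace (opL q α hq0).toLinearMap ((q : ℂ) ^ n)
      = Submodule.span ℂ {hermiteVec hq0 hq1 hα n} := by
  refine le_antisymm (fun w hw => ?_) ?_
  · have hw' : opL q α hq0 w = ((q : ℂ) ^ n) • w := Module.End.mem_eigenspace_iff.mp hw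
    set e := hermiteVec hq0 hq1 hα n with he
    have he0 : e ≠ 0 := hermiteVec_ne_zero hq0 hq1 hα n
    set c : ℂ := inner ℂ e w / inner ℂ e e
    have h1 : w - c • e = 0 := by
      refine eq_zero_of_inner_hermiteVec hq0 hq1 hα hα1 fun m => ?_
      rw [inner_sub_right, inner_smul_right]
      rcases eq_or_ne m n with rfl | hm
      · rw [← he, div_mul_cancel₀ _ (inner_self_ne_zero.mpr he0), sub_self]
      · rw [inner_hermiteVec_of_ne hq0 hq1 hα hm, mul_zero, sub_zero]
        refine inner_hermiteVec_eq_zero_of_ne hq0 hq1 hα hw' fun h => hm ?_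
        norm_cast at h
        exact (pow_right_injective₀ hq0 hq1.ne h).symm
    rw [sub_eq_zero.mp h1]
    exact Submodule.smul_mem _ _ (Submodule.mem_span_singleton_self _)
  · rw [Submodule.span_singleton_le_iff_mem]
    exact hermiteVec_mem_eigenspace hq0 hq1 hα n

/-- Nonzero spectral points of a compact operator are eigenvalues. An eigenvector for any value
other than the q^n is orthogonal to a complete system, and 0 is the limit of q^n in a closed set. -/
theorem spectrum_opL {q α : ℝ} (hq0 : 0 < q) (hq1 : q < 1) (hα : 0 < α) (hα1 : α ≤ 1) :
    spectrum ℂ (opL q α hq0) = insert (0 : ℂ) (Set.range fun n : ℕ => (q : ℂ) ^ n) := by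
  have hc := isCompactOperator_opL hq0 hq1 hα hα1
  have hmem : ∀ n : ℕ, (q : ℂ) ^ n ∈ spectrum ℂ (opL q α hq0) := by
    intro n
    have hne : (q : ℂ) ^ n ≠ 0 := pow_ne_zero _ (by exact_mod_cast hq0.ne')
    exact (hc.hasEigenvalue_iff_mem_spectrum hne).mp (Module.End.hasEigenvalue_of_hasEigenvector
      ⟨hermiteVec_mem_eigenspace hq0 hq1 hα n, hermiteVec_ne_zero hq0 hq1 hα n⟩)
  ext z
  rw [Set.mem_insert_iff]
  constructor
  · intro hz
    by_contra! h
    obtain ⟨v, hv⟩ := ((hc.hasEigenvalue_iff_mem_spectrum h.1).mpr hz).exists_hasEigenvector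
    refine hv.2 (eq_zero_of_inner_hermiteVec hq0 hq1 hα hα1 fun n =>
      inner_hermiteVec_eq_zero_of_ne hq0 hq1 hα hv.apply_eq_smul fun hn => h.2 ⟨n, hn.symm⟩)
  · rintro (rfl | ⟨n, rfl⟩)
    · have h0 : Tendsto (fun n : ℕ => (q : ℂ) ^ n) atTop (𝓝 0) :=
        tendsto_pow_atTop_nhds_zero_of_norm_lt_one
          (by rwa [Complex.norm_real, Real.norm_of_nonneg hq0.le])
      exact (spectrum.isClosed (𝕜 := ℂ) (opL q α hq0)).mem_of_tendsto h0 (Eventually.of_forall hmem)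
    · exact hmem n

/-! ### The eigenvectors `φ` as elements of `ℓ²(ℤ)` -/

/-- The sequence `φ_{q^n}` in `ℓ²(ℤ)`. -/
noncomputable def phiVec {q α : ℝ} (hq0 : 0 < q) (hq1 : q < 1) (hα : 0 < α) (n : ℕ) : EllTwo :=
  ((α ^ n / qPochInf (-(α ^ 2 * q)) q : ℝ) : ℂ) • hermiteVec hq0 hq1 hα n

theorem phiVec_apply {q α : ℝ} (hq0 : 0 < q) (hq1 : q < 1) (hα : 0 < α) (n : ℕ) (l : ℤ) :
    phiVec hq0 hq1 hα n l = phi q α ((q : ℂ) ^ n) l := by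
  rw [phi_eq hq0 hq1 hα, phiVec, lp.coeFn_smul, Pi.smul_apply, hermiteVec_apply, smul_eq_mul,
    ← Complex.ofReal_mul, mul_assoc]

theorem phiVec_coeff_pos {q α : ℝ} (hq0 : 0 < q) (hq1 : q < 1) (hα : 0 < α) (n : ℕ) :
    0 < α ^ n / qPochInf (-(α ^ 2 * q)) q := by
  have h := one_le_qPochInf hq0 hq1 (a := -(α ^ 2 * q)) (neg_nonpos.mpr (by positivity))
  positivity

theorem span_phiVec_singleton {q α : ℝ} (hq0 : 0 < q) (hq1 : q < 1) (hα : 0 < α) (n : ℕ) :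
    Submodule.span ℂ {phiVec hq0 hq1 hα n} = Submodule.span ℂ {hermiteVec hq0 hq1 hα n} :=
  Submodule.span_singleton_smul_eq
    (IsUnit.mk0 _ (Complex.ofReal_ne_zero.mpr (phiVec_coeff_pos hq0 hq1 hα n).ne')) _

/-- Extracting the first factors of (-α²;q)_∞ and (-1/α²;q)_∞ produces (1 + α²)/(1 + 1/α²) = α²,
which explains the exponent 2n + 2. -/
theorem norm_phiVec_sq {q α : ℝ} (hq0 : 0 < q) (hq1 : q < 1) (hα : 0 < α) (n : ℕ) :
    ‖phiVec hq0 hq1 hα n‖ ^ 2 = qPochInf (-(1 / α ^ 2)) q * qPochInf q q /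
        qPochInf (-(α ^ 2 * q)) q * α ^ (2 * n + 2) * (q ^ (n * (n + 1) / 2))⁻¹ * qPoch q q n := by
  have h := one_le_qPochInf hq0 hq1 (a := -(α ^ 2 * q)) (neg_nonpos.mpr (by positivity))
  have h1 := one_sub_mul_qPochInf hq0 hq1 (-α ^ 2)
  have h2 := one_sub_mul_qPochInf hq0 hq1 (-(1 / α ^ 2))
  rw [show -α ^ 2 * q = -(α ^ 2 * q) by ring] at h1
  rw [show -(1 / α ^ 2) * q = -(q / α ^ 2) by field_simp] at h2
  have h3 : qPochInf (-(α ^ 2 * q)) q ≠ 0 := by linarith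
  rw [phiVec, norm_smul, mul_pow, norm_hermiteVec_sq, Complex.norm_real,
    Real.norm_of_nonneg (phiVec_coeff_pos hq0 hq1 hα n).le, totalMass, ← h1, ← h2]
  field_simp
  ring

theorem inner_phiVec_of_ne {q α : ℝ} (hq0 : 0 < q) (hq1 : q < 1) (hα : 0 < α) {n m : ℕ}
    (hnm : n ≠ m) : inner ℂ (phiVec hq0 hq1 hα n) (phiVec hq0 hq1 hα m) = 0 := by
  rw [phiVec, phiVec, inner_smul_left, inner_smul_right, inner_hermiteVec_of_ne hq0 hq1 hα hnm,
    mul_zero, mul_zero]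

theorem topologicalClosure_span_phiVec {q α : ℝ} (hq0 : 0 < q) (hq1 : q < 1) (hα : 0 < α)
    (hα1 : α ≤ 1) :
    (Submodule.span ℂ (Set.range (phiVec hq0 hq1 hα))).topologicalClosure = ⊤ := by
  rw [← topologicalClosure_span_hermiteVec hq0 hq1 hα hα1, Submodule.span_range_eq_iSup,
    Submodule.span_range_eq_iSup]
  simp only [span_phiVec_singleton]

/-! ### Completeness of the polynomials -/

theorem exists_polyVec_eq {q α : ℝ} (hq0 : 0 < q) (hq1 : q < 1) (hα : 0 < α) {v : EllTwo}
    (hv : v ∈ Submodule.span ℂ (Set.range (hermiteVec hq0 hq1 hα))) :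
    ∃ P : ℂ[X], v = polyVec hq0 hq1 hα P := by
  induction hv using Submodule.span_induction with
  | mem x h =>
    obtain ⟨n, rfl⟩ := h
    exact ⟨_, rfl⟩
  | zero => exact ⟨0, by ext l; simp [polyVec]⟩
  | add x y _ _ hx hy =>
    obtain ⟨P, rfl⟩ := hx
    obtain ⟨Q, rfl⟩ := hy
    exact ⟨P + Q, by ext l; simp [polyVec, mul_add]; rfl⟩
  | smul c x _ hx =>
    obtain ⟨P, rfl⟩ := hx
    exact ⟨C c * P, by ext l; simp [polyVec]; ring⟩

theorem lintegral_discreteMeasure (q α : ℝ) (g : ℝ → ℝ≥0∞) :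
    ∫⁻ x, g x ∂(discreteMeasure q α)
      = ∑' l : ℤ, ENNReal.ofReal (weight q α l) * g (massPoint q α l) := by
  simp [discreteMeasure, lintegral_sum_measure, lintegral_smul_measure, lintegral_dirac]

/-- The map f ↦ (√w_l f(x_l))_l preserves the L² norm and sends polynomials to a subspace containing
the dense span of the eigenvectors. -/
theorem polynomialsDense_discreteMeasure {q α : ℝ} (hq0 : 0 < q) (hq1 : q < 1) (hα : 0 < α)
    (hα1 : α ≤ 1) : PolynomialsDense (discreteMeasure q α) := by
  intro f hf ε hε
  have hsq : ∀ g : ℝ → ℂ, ∀ l : ℤ, ENNReal.ofReal (weight q α l) * ‖g (massPoint q α l)‖ₑ ^ 2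
      = ENNReal.ofReal (‖(√(weight q α l) : ℂ) * g (massPoint q α l)‖ ^ 2) := by
    intro g l
    rw [norm_mul, mul_pow, Complex.norm_real, Real.norm_of_nonneg (Real.sqrt_nonneg _),
      Real.sq_sqrt (weight_pos hq0 hα l).le, ENNReal.ofReal_mul (weight_pos hq0 hα l).le,
      ENNReal.ofReal_pow (norm_nonneg _), ofReal_norm]
  have hnorm : ∀ g : ℝ → ℂ, eLpNorm g 2 (discreteMeasure q α) = (∑' l : ℤ,
      ENNReal.ofReal (‖(√(weight q α l) : ℂ) * g (massPoint q α l)‖ ^ 2)) ^ (1 / 2 : ℝ) := by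
    intro g
    rw [eLpNorm_eq_lintegral_rpow_enorm_toReal two_ne_zero ENNReal.ofNat_ne_top,
      lintegral_discreteMeasure]
    simp only [ENNReal.toReal_ofNat, ENNReal.rpow_two, hsq]
  have h2 : (0 : ℝ) < (2 : ℝ≥0∞).toReal := by norm_num
  have hmem : Memℓp (fun l : ℤ => (√(weight q α l) : ℂ) * f (massPoint q α l)) 2 := by
    have h1 := hf.2
    rw [hnorm] at h1
    have h3 : (∑' l : ℤ, ENNReal.ofReal (‖(√(weight q α l) : ℂ) * f (massPoint q α l)‖ ^ 2)) ≠ ⊤ := by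
      intro h
      rw [h, ENNReal.top_rpow_of_pos (by norm_num)] at h1
      exact lt_irrefl _ h1
    refine memℓp_gen ?_
    have h4 := ENNReal.summable_toReal h3
    refine h4.congr fun l => ?_
    rw [ENNReal.toReal_ofReal (by positivity), ENNReal.toReal_ofNat, Real.rpow_two]
  let v : EllTwo := ⟨_, hmem⟩
  have hv : v ∈ (Submodule.span ℂ (Set.range (hermiteVec hq0 hq1 hα))).topologicalClosure := by
    rw [topologicalClosure_span_hermiteVec hq0 hq1 hα hα1]
    trivial
  rw [← SetLike.mem_coe, Submodule.topologicalClosure_coe, EMetric.mem_closure_iff] at hv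
  obtain ⟨w, hw, hd⟩ := hv ε hε.bot_lt
  obtain ⟨P, rfl⟩ := exists_polyVec_eq hq0 hq1 hα hw
  refine ⟨P, le_trans (le_of_eq ?_) hd.le⟩
  have h5 := lp.hasSum_norm h2 (v - polyVec hq0 hq1 hα P)
  have h6 : ∀ l : ℤ, (v - polyVec hq0 hq1 hα P) l
      = (√(weight q α l) : ℂ) * (f (massPoint q α l) - P.eval (massPoint q α l : ℂ)) := by
    intro l
    rw [mul_sub]
    rfl
  simp only [ENNReal.toReal_ofNat, Real.rpow_two, h6] at h5
  rw [hnorm, ← ENNReal.ofReal_tsum_of_nonneg (fun l => by positivity) h5.summable, h5.tsum_eq,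
    edist_eq_enorm_sub, ← ofReal_norm, ENNReal.ofReal_rpow_of_nonneg (by positivity) (by norm_num),
    ← Real.sqrt_eq_rpow, Real.sqrt_sq (norm_nonneg _)]


/-! ### Measures with finite moments in which the polynomials are dense -/

/-- A complex polynomial as a function on the real line. -/
noncomputable def polyFun (P : ℂ[X]) (x : ℝ) : ℂ := P.eval (x : ℂ)

theorem continuous_polyFun (P : ℂ[X]) : Continuous (polyFun P) :=
  P.continuous.comp Complex.continuous_ofReal

/-- All moments of `μ` are finite. -/
def HasMoments (μ : Measure ℝ) : Prop := ∀ k : ℕ, Integrable (fun x : ℝ => x ^ k) μ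

/-- The measures `μ` and `ν` have the same moments. -/
def SameMoments (μ ν : Measure ℝ) : Prop :=
  ∀ P : ℂ[X], ∫ x, polyFun P x ∂μ = ∫ x, polyFun P x ∂ν

section Moments

variable {μ ν : Measure ℝ}

theorem HasMoments.isFiniteMeasure (hμ : HasMoments μ) : IsFiniteMeasure μ := by
  have h := hμ 0
  simp only [pow_zero] at h
  exact (integrable_const_iff_isFiniteMeasure one_ne_zero).mp h

theorem HasMoments.integrable_polyFun (hμ : HasMoments μ) (P : ℂ[X]) :
    Integrable (polyFun P) μ := by
  induction P using Polynomial.induction_on' with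
  | add P Q hP hQ =>
    refine (hP.add hQ).congr (Eventually.of_forall fun x => ?_)
    simp [polyFun]
  | monomial k c =>
    refine ((hμ k).ofReal (𝕜 := ℂ) |>.const_mul c).congr (Eventually.of_forall fun x => ?_)
    simp [polyFun, eval_monomial]

/-- On the real line |P|² is again a polynomial, so the L² norm of a polynomial depends only on the
moments. This is what transfers approximations from one measure to another. -/
theorem ofReal_norm_polyFun_sq (P : ℂ[X]) (x : ℝ) :
    ((‖polyFun P x‖ ^ 2 : ℝ) : ℂ) = polyFun (P * P.map (starRingEnd ℂ)) x := by
  have e : (P.map (starRingEnd ℂ)).eval (x : ℂ) = (starRingEnd ℂ) (P.eval (x : ℂ)) := by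
    rw [← eval₂_at_apply, Complex.conj_ofReal, eval_map]
  rw [polyFun, polyFun, eval_mul, e, Complex.mul_conj']
  push_cast
  rfl

theorem HasMoments.memLp_polyFun (hμ : HasMoments μ) (P : ℂ[X]) : MemLp (polyFun P) 2 μ := by
  rw [memLp_two_iff_integrable_sq_norm (continuous_polyFun P).aestronglyMeasurable]
  have h := (hμ.integrable_polyFun (P * P.map (starRingEnd ℂ))).re
  refine h.congr (Eventually.of_forall fun x => ?_)
  simp only [← ofReal_norm_polyFun_sq]
  exact Complex.ofReal_re _

theorem SameMoments.eLpNorm_eq (h : SameMoments μ ν) (hμ : HasMoments μ) (hν : HasMoments ν)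
    (P : ℂ[X]) : eLpNorm (polyFun P) 2 μ = eLpNorm (polyFun P) 2 ν := by
  rw [(hμ.memLp_polyFun P).eLpNorm_eq_integral_rpow_norm two_ne_zero ENNReal.ofNat_ne_top,
    (hν.memLp_polyFun P).eLpNorm_eq_integral_rpow_norm two_ne_zero ENNReal.ofNat_ne_top]
  have e : ∫ x, ‖polyFun P x‖ ^ 2 ∂μ = ∫ x, ‖polyFun P x‖ ^ 2 ∂ν := by
    apply Complex.ofReal_injective
    rw [← integral_complex_ofReal, ← integral_complex_ofReal]
    simp only [ofReal_norm_polyFun_sq]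
    exact h _
  simp only [ENNReal.toReal_ofNat, Real.rpow_two, e]

/-- A point mass bounds the point evaluation. -/
theorem enorm_mul_measure_singleton_le (μ : Measure ℝ) (f : ℝ → ℂ) (x : ℝ) :
    ‖f x‖ₑ * μ {x} ^ (1 / 2 : ℝ) ≤ eLpNorm f 2 μ := by
  refine le_trans (le_of_eq ?_) (eLpNorm_restrict_le f 2 μ {x})
  rw [Measure.restrict_singleton, eLpNorm_smul_measure_of_ne_top ENNReal.ofNat_ne_top,
    eLpNorm_dirac f x two_ne_zero, smul_eq_mul, mul_comm]
  simp

/-- A set of positive measure on which the point evaluations are uniformly bounded cannot have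
small measure. -/
theorem one_le_of_enorm_polyFun_le (hν : HasMoments ν) (hd : PolynomialsDense ν) {B : Set ℝ}
    (hB : MeasurableSet B) (hB0 : ν B ≠ 0) {m : ℝ≥0∞} (hm : m ≠ ⊤)
    (hb : ∀ x ∈ B, ∀ P : ℂ[X], ‖polyFun P x‖ₑ ≤ m * eLpNorm (polyFun P) 2 ν) :
    1 ≤ m * ν B ^ (1 / 2 : ℝ) := by
  have := hν.isFiniteMeasure
  set f : ℝ → ℂ := B.indicator fun _ => 1 with hf
  set s : ℝ≥0∞ := ν B ^ (1 / 2 : ℝ) with hs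
  have hs0 : s ≠ 0 := by simp [hs, hB0]
  have hst : s ≠ ⊤ := by simp [hs]
  have hfs : eLpNorm f 2 ν = s := by
    rw [hf, eLpNorm_indicator_const hB two_ne_zero ENNReal.ofNat_ne_top]
    simp [hs]
  have hfB : eLpNorm f 2 (ν.restrict B) = s := by
    rw [hf, eLpNorm_indicator_const hB two_ne_zero ENNReal.ofNat_ne_top]
    simp [hs]
  have hfm : MemLp f 2 ν := memLp_indicator_const 2 hB 1 (Or.inr (measure_ne_top ν B))
  -- Approximate the indicator of B by P within ε. Then ‖P‖ ≤ s + ε, so |P| ≤ m(s + ε) on B, and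
  -- integrating over B bounds s. Letting ε → 0 gives s ≤ ms² with 0 < s < ∞.
  have key : ∀ ε : ℝ≥0∞, ε ≠ 0 → s ≤ ε + m * (s + ε) * s := by
    intro ε hε
    obtain ⟨P, hP⟩ := hd f hfm ε hε
    change eLpNorm (f - polyFun P) 2 ν ≤ ε at hP
    have hPm := (continuous_polyFun P).aestronglyMeasurable (μ := ν)
    have hPn : eLpNorm (polyFun P) 2 ν ≤ s + ε := by
      have h1 : polyFun P = f - (f - polyFun P) := by simp
      rw [h1, ← hfs]
      refine (eLpNorm_sub_le hfm.1 (hfm.1.sub hPm) one_le_two).trans ?_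
      gcongr
    have hPB : eLpNorm (polyFun P) 2 (ν.restrict B) ≤ m * (s + ε) * s := by
      have h1 : ∀ᵐ x ∂(ν.restrict B), ‖polyFun P x‖ₑ ≤ m * (s + ε) := by
        refine (ae_restrict_iff' hB).mpr (Eventually.of_forall fun x hx => ?_)
        exact (hb x hx P).trans (by gcongr)
      refine (eLpNorm_le_of_ae_enorm_bound h1).trans (le_of_eq ?_)
      simp [hs]
    have h2 : f = (f - polyFun P) + polyFun P := by simp
    calc s = eLpNorm f 2 (ν.restrict B) := hfB.symm
      _ ≤ eLpNorm (f - polyFun P) 2 (ν.restrict B) + eLpNorm (polyFun P) 2 (ν.restrict B) := by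
        conv_lhs => rw [h2]
        exact eLpNorm_add_le (hfm.1.sub hPm).restrict hPm.restrict one_le_two
      _ ≤ _ := add_le_add ((eLpNorm_restrict_le _ _ _ _).trans hP) hPB
  have key2 : ∀ ε : ℝ, 0 < ε → s.toReal ≤ ε + m.toReal * (s.toReal + ε) * s.toReal := by
    intro ε hε
    have h := key (ENNReal.ofReal ε) (by simpa using hε)
    have h2 := ENNReal.toReal_mono (by finiteness) h
    rwa [ENNReal.toReal_add (by finiteness) (by finiteness), ENNReal.toReal_mul,
      ENNReal.toReal_mul, ENNReal.toReal_add hst (by finiteness), ENNReal.toReal_ofReal hε.le] at h2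
  have key3 : s.toReal ≤ m.toReal * s.toReal * s.toReal := by
    have hc : Continuous fun ε : ℝ => ε + m.toReal * (s.toReal + ε) * s.toReal := by fun_prop
    have h1 : Tendsto (fun ε : ℝ => ε + m.toReal * (s.toReal + ε) * s.toReal) (𝓝[>] 0)
        (𝓝 (0 + m.toReal * (s.toReal + 0) * s.toReal)) := (hc.tendsto 0).mono_left nhdsWithin_le_nhds
    rw [zero_add, add_zero] at h1
    exact ge_of_tendsto h1 (eventually_mem_nhdsWithin.mono fun ε hε => key2 ε hε)
  have hsp : 0 < s.toReal := ENNReal.toReal_pos hs0 hst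
  have h3 : 1 ≤ m.toReal * s.toReal := by
    by_contra! h
    nlinarith
  rw [← ENNReal.toReal_mul] at h3
  rw [← ENNReal.ofReal_one, ← ENNReal.ofReal_toReal (a := m * s) (by finiteness)]
  exact ENNReal.ofReal_le_ofReal h3

/-- If the point evaluations are bounded and the polynomials are dense, then the measure is
purely atomic. -/
theorem exists_atom (hν : HasMoments ν) (hd : PolynomialsDense ν)
    (hb : ∀ x : ℝ, ∃ C : ℝ≥0∞, C ≠ ⊤ ∧ ∀ P : ℂ[X], ‖polyFun P x‖ₑ ≤ C * eLpNorm (polyFun P) 2 ν)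
    {A : Set ℝ} (hA : MeasurableSet A) (hA0 : ν A ≠ 0) : ∃ a ∈ A, ν {a} ≠ 0 := by
  have := hν.isFiniteMeasure
  let E : ℕ → Set ℝ := fun m => {x | ∀ P : ℂ[X], ‖polyFun P x‖ₑ ≤ m * eLpNorm (polyFun P) 2 ν}
  have hE : ∀ m, MeasurableSet (E m) := by
    intro m
    have h1 : E m = ⋂ P : ℂ[X], {x | ‖polyFun P x‖ₑ ≤ m * eLpNorm (polyFun P) 2 ν} := by
      ext x; simp [E]
    rw [h1]
    exact (isClosed_iInter fun P =>
      isClosed_le (continuous_polyFun P).enorm continuous_const).measurableSet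
  have hU : A ⊆ ⋃ m, A ∩ E m := by
    intro x hx
    obtain ⟨C, hC, h⟩ := hb x
    obtain ⟨m, hm⟩ := ENNReal.exists_nat_gt hC
    exact Set.mem_iUnion.mpr ⟨m, hx, fun P => (h P).trans (by gcongr)⟩
  obtain ⟨m, hm⟩ : ∃ m, ν (A ∩ E m) ≠ 0 := by
    by_contra! h
    exact hA0 (measure_mono_null hU (measure_iUnion_null h))
  -- All neighbourhoods of a within A ∩ E m have positive measure, hence measure bounded below
  -- uniformly by the preceding lemma. Shrinking them to {a} leaves positive mass at a.
  obtain ⟨a, ha, hpos⟩ := exists_mem_forall_mem_nhdsWithin_pos_measure hm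
  refine ⟨a, ha.1, fun h0 => ?_⟩
  let B : ℕ → Set ℝ := fun n => (A ∩ E m) ∩ Metric.closedBall a (1 / (n + 1))
  have hBm : ∀ n, MeasurableSet (B n) := fun n =>
    (hA.inter (hE m)).inter Metric.isClosed_closedBall.measurableSet
  have hB1 : ∀ n, 1 ≤ (m : ℝ≥0∞) * ν (B n) ^ (1 / 2 : ℝ) := by
    intro n
    refine one_le_of_enorm_polyFun_le hν hd (hBm n) (hpos _ ?_).ne' (ENNReal.natCast_ne_top m)
      fun x hx => hx.1.2
    exact inter_mem_nhdsWithin _ (Metric.closedBall_mem_nhds a (by positivity))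
  have hBI : ⋂ n, B n = {a} := by
    ext x
    simp only [B, Set.mem_iInter, Set.mem_inter_iff, Metric.mem_closedBall, Set.mem_singleton_iff]
    constructor
    · intro h
      have h1 : dist x a ≤ 0 :=
        ge_of_tendsto tendsto_one_div_add_atTop_nhds_zero_nat (Eventually.of_forall fun n => (h n).2)
      exact dist_le_zero.mp h1
    · rintro rfl n
      exact ⟨⟨ha.1, ha.2⟩, by rw [dist_self]; positivity⟩
  have hlim := tendsto_measure_iInter_atTop (μ := ν) (s := B) (fun n => (hBm n).nullMeasurableSet)
    (fun i j hij => Set.inter_subset_inter_right _ (Metric.closedBall_subset_closedBall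
      (one_div_le_one_div_of_le (by positivity) (by gcongr)))) ⟨0, measure_ne_top _ _⟩
  rw [hBI, h0] at hlim
  have hlim2 : Tendsto (fun n => (m : ℝ≥0∞) * ν (B n) ^ (1 / 2 : ℝ)) atTop
      (𝓝 ((m : ℝ≥0∞) * 0 ^ (1 / 2 : ℝ))) :=
    ENNReal.Tendsto.const_mul (hlim.ennrpow_const _) (Or.inr (ENNReal.natCast_ne_top m))
  have := ge_of_tendsto hlim2 (Eventually.of_forall hB1)
  norm_num at this

/-- Density of the polynomials in `L²(μ)` makes the point masses of `μ` as large as possible. -/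
theorem measure_singleton_le (hμ : HasMoments μ) (hν : HasMoments ν) (hd : PolynomialsDense μ)
    (h : SameMoments μ ν) {x : ℝ} (hx : μ {x} ≠ 0) : ν {x} ≤ μ {x} := by
  have := hμ.isFiniteMeasure
  have := hν.isFiniteMeasure
  set f : ℝ → ℂ := ({x} : Set ℝ).indicator fun _ => 1 with hf
  set a : ℝ≥0∞ := μ {x} ^ (1 / 2 : ℝ) with ha
  set b : ℝ≥0∞ := ν {x} ^ (1 / 2 : ℝ) with hb
  have ha0 : a ≠ 0 := by simp [ha, hx]
  have hat : a ≠ ⊤ := by simp [ha]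
  have hbt : b ≠ ⊤ := by simp [hb]
  have hfs : eLpNorm f 2 μ = a := by
    rw [hf, eLpNorm_indicator_const (measurableSet_singleton x) two_ne_zero ENNReal.ofNat_ne_top]
    simp [ha]
  have hfm : MemLp f 2 μ :=
    memLp_indicator_const 2 (measurableSet_singleton x) 1 (Or.inr (measure_ne_top μ _))
  -- A polynomial near the indicator of x in L²(μ) has value near 1 at x and norm near a. Its norm
  -- in L²(ν) is the same, and it bounds |P(x)| b; so b ≤ a in the limit.
  have key : ∀ ε : ℝ≥0∞, ε ≠ 0 → a * b ≤ ε * b + (a + ε) * a := by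
    intro ε hε
    obtain ⟨P, hP⟩ := hd f hfm ε hε
    change eLpNorm (f - polyFun P) 2 μ ≤ ε at hP
    have hPm := (continuous_polyFun P).aestronglyMeasurable (μ := μ)
    have hPn : eLpNorm (polyFun P) 2 μ ≤ a + ε := by
      have h1 : polyFun P = f - (f - polyFun P) := by simp
      rw [h1, ← hfs]
      refine (eLpNorm_sub_le hfm.1 (hfm.1.sub hPm) one_le_two).trans ?_
      gcongr
    have h1 := (enorm_mul_measure_singleton_le μ (f - polyFun P) x).trans hP
    have h2 := (enorm_mul_measure_singleton_le ν (polyFun P) x).trans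
      ((h.eLpNorm_eq hμ hν P).symm.le.trans hPn)
    have h3 : (1 : ℝ≥0∞) ≤ ‖(f - polyFun P) x‖ₑ + ‖polyFun P x‖ₑ := by
      have h4 : (1 : ℂ) = (f - polyFun P) x + polyFun P x := by simp [hf]
      calc (1 : ℝ≥0∞) = ‖(1 : ℂ)‖ₑ := by simp
        _ = ‖(f - polyFun P) x + polyFun P x‖ₑ := by rw [← h4]
        _ ≤ _ := enorm_add_le _ _
    calc a * b = 1 * (a * b) := (one_mul _).symm
      _ ≤ (‖(f - polyFun P) x‖ₑ + ‖polyFun P x‖ₑ) * (a * b) := by gcongr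
      _ = ‖(f - polyFun P) x‖ₑ * a * b + ‖polyFun P x‖ₑ * b * a := by ring
      _ ≤ ε * b + (a + ε) * a := by gcongr
  have key2 : ∀ ε : ℝ, 0 < ε → a.toReal * b.toReal ≤ ε * b.toReal + (a.toReal + ε) * a.toReal := by
    intro ε hε
    have h := key (ENNReal.ofReal ε) (by simpa using hε)
    have h2 := ENNReal.toReal_mono (by finiteness) h
    rwa [ENNReal.toReal_add (by finiteness) (by finiteness), ENNReal.toReal_mul,
      ENNReal.toReal_mul, ENNReal.toReal_mul, ENNReal.toReal_add hat (by finiteness),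
      ENNReal.toReal_ofReal hε.le] at h2
  have key3 : a.toReal * b.toReal ≤ a.toReal * a.toReal := by
    have hc : Continuous fun ε : ℝ => ε * b.toReal + (a.toReal + ε) * a.toReal := by fun_prop
    have h1 : Tendsto (fun ε : ℝ => ε * b.toReal + (a.toReal + ε) * a.toReal) (𝓝[>] 0)
        (𝓝 (0 * b.toReal + (a.toReal + 0) * a.toReal)) :=
      (hc.tendsto 0).mono_left nhdsWithin_le_nhds
    rw [zero_mul, zero_add, add_zero] at h1
    exact ge_of_tendsto h1 (eventually_mem_nhdsWithin.mono fun ε hε => key2 ε hε)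
  have h4 := le_of_mul_le_mul_left key3 (ENNReal.toReal_pos ha0 hat)
  rw [ENNReal.toReal_le_toReal hbt hat] at h4
  exact (ENNReal.rpow_le_rpow_iff (by norm_num)).mp h4

end Moments


/-! ### Two measures with the same moments and a common atom -/

section CommonAtom

variable {μ ν : Measure ℝ}

/-- Pairing with a fixed `L²` function is continuous. -/
theorem tendsto_integral_mul {f : ℕ → ℝ → ℂ} {g k : ℝ → ℂ} (hf : ∀ n, MemLp (f n) 2 μ)
    (hg : MemLp g 2 μ) (hk : MemLp k 2 μ)
    (hlim : Tendsto (fun n => eLpNorm (f n - k) 2 μ) atTop (𝓝 0)) :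
    Tendsto (fun n => ∫ x, g x * f n x ∂μ) atTop (𝓝 (∫ x, g x * k x ∂μ)) := by
  have hle : ∀ n, eLpNorm ((fun x => g x * f n x) - fun x => g x * k x) 1 μ
      ≤ eLpNorm g 2 μ * eLpNorm (f n - k) 2 μ := by
    intro n
    have e : ((fun x => g x * f n x) - fun x => g x * k x) = g • (f n - k) := by
      ext x
      simp only [Pi.sub_apply, Pi.smul_apply', smul_eq_mul, mul_sub]
    rw [e]
    exact eLpNorm_smul_le_mul_eLpNorm ((hf n).1.sub hk.1) hg.1
  have h1 : Tendsto (fun n => eLpNorm g 2 μ * eLpNorm (f n - k) 2 μ) atTop (𝓝 0) := by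
    have := ENNReal.Tendsto.const_mul hlim (a := eLpNorm g 2 μ) (Or.inr hg.2.ne)
    rwa [mul_zero] at this
  have hgk : Integrable (fun x => g x * k x) μ := hg.integrable_mul hk
  have hgf : ∀ n, Integrable (fun x => g x * f n x) μ := fun n => hg.integrable_mul (hf n)
  exact tendsto_integral_of_L1' (fun x => g x * k x) hgk.1 (Eventually.of_forall hgf)
    (tendsto_of_tendsto_of_tendsto_of_le_of_le tendsto_const_nhds h1 (fun _ => zero_le) hle)

/-- A square integrable function orthogonal to all polynomials vanishes if the polynomials are
dense. -/
theorem ae_eq_zero_of_integral_polyFun_mul (hμ : HasMoments μ) (hd : PolynomialsDense μ)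
    {k : ℝ → ℂ} (hk : MemLp k 2 μ) (h : ∀ P : ℂ[X], ∫ x, polyFun P x * k x ∂μ = 0) :
    k =ᵐ[μ] 0 := by
  set g : ℝ → ℂ := fun x => (starRingEnd ℂ) (k x) with hg
  have hgm : MemLp g 2 μ := hk.star
  choose P hP using fun n : ℕ => hd g hgm ((n : ℝ≥0∞) + 1)⁻¹ (by simp)
  have hlim : Tendsto (fun n => eLpNorm (polyFun (P n) - g) 2 μ) atTop (𝓝 0) := by
    have h1 : Tendsto (fun n : ℕ => ((n : ℝ≥0∞) + 1)⁻¹) atTop (𝓝 0) := by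
      have := ENNReal.tendsto_inv_nat_nhds_zero.comp (tendsto_add_atTop_nat 1)
      simpa [Function.comp_def] using this
    refine tendsto_of_tendsto_of_tendsto_of_le_of_le tendsto_const_nhds h1 (fun _ => zero_le)
      fun n => ?_
    simp only
    rw [eLpNorm_sub_comm]
    exact hP n
  have h2 := tendsto_integral_mul (fun n => hμ.memLp_polyFun (P n)) hk hgm hlim
  have h3 : ∀ n, ∫ x, k x * polyFun (P n) x ∂μ = 0 := fun n => by
    rw [← h (P n)]; simp only [mul_comm]
  simp only [h3] at h2
  have h4 := tendsto_nhds_unique tendsto_const_nhds h2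
  have h5 : ∫ x, ‖k x‖ ^ 2 ∂μ = 0 := by
    apply Complex.ofReal_injective
    rw [← integral_complex_ofReal, Complex.ofReal_zero, h4]
    exact integral_congr_ae (Eventually.of_forall fun x => by
      simp only [hg, Complex.mul_conj']; push_cast; rfl)
  rw [integral_eq_zero_iff_of_nonneg (fun x => by positivity)
    ((memLp_two_iff_integrable_sq_norm hk.1).mp hk)] at h5
  filter_upwards [h5] with x hx
  simpa using hx

/-- If the polynomials are dense for two measures with the same moments which have a common atom,
isolated for one of them, then the atoms of the other are atoms of that one. -/
theorem measure_singleton_ne_zero (hμ : HasMoments μ) (hν : HasMoments ν)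
    (hdμ : PolynomialsDense μ) (hdν : PolynomialsDense ν) (h : SameMoments μ ν) {x ξ : ℝ}
    (hx : ν {x} ≠ 0) (hξν : ν {ξ} ≠ 0) (hξ : μ {ξ} ≠ 0) {δ : ℝ} (hδ : 0 < δ)
    (hiso : ∀ᵐ y ∂μ, y = ξ ∨ δ ≤ |y - ξ|) : μ {x} ≠ 0 := by
  rcases eq_or_ne x ξ with rfl | hxξ
  · exact hξ
  intro hx0
  have := hμ.isFiniteMeasure
  have := hν.isFiniteMeasure
  set f : ℝ → ℂ := ({x} : Set ℝ).indicator fun _ => 1 with hf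
  have hfm : MemLp f 2 ν :=
    memLp_indicator_const 2 (measurableSet_singleton x) 1 (Or.inr (measure_ne_top ν _))
  -- The exponent n + 2 makes two such errors add up to 2^{-(N+1)}, strictly below the summable
  -- Cauchy bound 2^{-N}.
  have hεpos : ∀ n : ℕ, (2 : ℝ≥0∞)⁻¹ ^ (n + 2) ≠ 0 := fun n => pow_ne_zero _ (by simp)
  choose P hP using fun n : ℕ => hdν f hfm ((2 : ℝ≥0∞)⁻¹ ^ (n + 2)) (hεpos n)
  replace hP : ∀ n, eLpNorm (f - polyFun (P n)) 2 ν ≤ (2 : ℝ≥0∞)⁻¹ ^ (n + 2) := hP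
  have hε0 : Tendsto (fun n : ℕ => (2 : ℝ≥0∞)⁻¹ ^ (n + 2)) atTop (𝓝 0) :=
    (ENNReal.tendsto_pow_atTop_nhds_zero_of_lt_one (by simp)).comp (tendsto_add_atTop_nat 2)
  have hanti : ∀ N n : ℕ, N ≤ n → (2 : ℝ≥0∞)⁻¹ ^ (n + 2) ≤ (2 : ℝ≥0∞)⁻¹ ^ (N + 2) :=
    fun N n hn => pow_le_pow_right_of_le_one' (by simp) (by omega)
  have hPlimν : Tendsto (fun n => eLpNorm (polyFun (P n) - f) 2 ν) atTop (𝓝 0) := by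
    refine tendsto_of_tendsto_of_tendsto_of_le_of_le tendsto_const_nhds hε0 (fun _ => zero_le)
      fun n => ?_
    simp only
    rw [eLpNorm_sub_comm]
    exact hP n
  obtain ⟨k, hk, hklim⟩ := Lp.cauchy_complete_eLpNorm (μ := μ) (p := 2) one_le_two
    (f := fun n => polyFun (P n)) (fun n => hμ.memLp_polyFun (P n))
    (B := fun n => (2 : ℝ≥0∞)⁻¹ ^ n) (by rw [ENNReal.tsum_geometric]; simp) (by
      intro N n m hn hm
      have e : polyFun (P n) - polyFun (P m) = polyFun (P n - P m) := by
        ext y; simp [polyFun]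
      have e2 : polyFun (P n - P m) = (f - polyFun (P m)) - (f - polyFun (P n)) := by
        rw [← e]; simp
      have hPn := fun n => (continuous_polyFun (P n)).aestronglyMeasurable (μ := ν)
      simp only [e]
      rw [h.eLpNorm_eq hμ hν, e2]
      calc _ ≤ eLpNorm (f - polyFun (P m)) 2 ν + eLpNorm (f - polyFun (P n)) 2 ν :=
            eLpNorm_sub_le (hfm.1.sub (hPn m)) (hfm.1.sub (hPn n)) one_le_two
        _ ≤ (2 : ℝ≥0∞)⁻¹ ^ (N + 2) + (2 : ℝ≥0∞)⁻¹ ^ (N + 2) :=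
            add_le_add ((hP m).trans (hanti N m hm)) ((hP n).trans (hanti N n hn))
        _ = (2 : ℝ≥0∞)⁻¹ ^ (N + 1) := by
            rw [← two_mul, pow_succ' _ (N + 1), ← mul_assoc,
              ENNReal.mul_inv_cancel two_ne_zero ENNReal.ofNat_ne_top, one_mul]
        _ < (2 : ℝ≥0∞)⁻¹ ^ N := by
            rw [pow_succ]
            refine ENNReal.mul_lt_of_lt_div' ?_
            rw [ENNReal.div_self (pow_ne_zero _ (by simp)) (by simp)]
            simp)
  -- k is the image in L²(μ) of the indicator of x under the isometry of polynomials; pairing with k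
  -- therefore evaluates at x, even though x carries no μ-mass.
  have hrep : ∀ Q : ℂ[X], ∫ y, polyFun Q y * k y ∂μ = ν.real {x} • polyFun Q x := by
    intro Q
    have h1 := tendsto_integral_mul (fun n => hμ.memLp_polyFun (P n)) (hμ.memLp_polyFun Q) hk hklim
    have h2 := tendsto_integral_mul (fun n => hν.memLp_polyFun (P n)) (hν.memLp_polyFun Q) hfm
      hPlimν
    have h3 : ∀ n, ∫ y, polyFun Q y * polyFun (P n) y ∂μ = ∫ y, polyFun Q y * polyFun (P n) y ∂ν := by
      intro n
      have e : ∀ y, polyFun Q y * polyFun (P n) y = polyFun (Q * P n) y := fun y => by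
        simp [polyFun]
      simp only [e]
      exact h _
    simp only [h3] at h1
    rw [tendsto_nhds_unique h1 h2]
    have e : (fun y => polyFun Q y * f y) = ({x} : Set ℝ).indicator (polyFun Q) := by
      ext y
      rcases eq_or_ne y x with rfl | hy
      · simp [hf]
      · simp [hf, hy]
    rw [e, integral_indicator (measurableSet_singleton x), integral_singleton]
  -- L² convergence forces convergence at atoms. As ξ is an atom of both measures, P_n(ξ) tends both
  -- to k(ξ) and to the indicator of x at ξ, which is 0.
  have hkξ : k ξ = 0 := by
    have h1 : Tendsto (fun n => ‖(polyFun (P n) - f) ξ‖ₑ * ν {ξ} ^ (1 / 2 : ℝ)) atTop (𝓝 0) :=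
      tendsto_of_tendsto_of_tendsto_of_le_of_le tendsto_const_nhds hPlimν (fun _ => zero_le)
        fun n => enorm_mul_measure_singleton_le ν _ ξ
    have h2 : Tendsto (fun n => ‖(polyFun (P n) - k) ξ‖ₑ * μ {ξ} ^ (1 / 2 : ℝ)) atTop (𝓝 0) :=
      tendsto_of_tendsto_of_tendsto_of_le_of_le tendsto_const_nhds hklim (fun _ => zero_le)
        fun n => enorm_mul_measure_singleton_le μ _ ξ
    have aux : ∀ (u : ℕ → ℝ≥0∞) (c : ℝ≥0∞), c ≠ 0 → c ≠ ⊤ →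
        Tendsto (fun n => u n * c) atTop (𝓝 0) → Tendsto u atTop (𝓝 0) := by
      intro u c hc hct hu
      have := ENNReal.Tendsto.mul_const hu (b := c⁻¹) (Or.inr (by simpa using hc))
      simpa [mul_assoc, ENNReal.mul_inv_cancel hc hct] using this
    have h3 := aux _ _ (by simp [hξν]) (by simp) h1
    have h4 := aux _ _ (by simp [hξ]) (by simp) h2
    have h5 := h3.add h4
    rw [add_zero] at h5
    have h6 : ‖k ξ‖ₑ ≤ 0 := by
      refine ge_of_tendsto h5 (Eventually.of_forall fun n => ?_)
      have e : k ξ = (polyFun (P n) - f) ξ - (polyFun (P n) - k) ξ := by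
        simp [hf, Ne.symm hxξ]
      conv_lhs => rw [e]
      exact enorm_sub_le
    simpa using h6
  -- The factor exchanges the zero of k at ξ for one at x. It is bounded μ-almost everywhere because
  -- ξ is isolated, and division by zero gives g(ξ) = 0.
  set g : ℝ → ℂ := fun y => ((y : ℂ) - x) / ((y : ℂ) - ξ) * k y with hg
  have hgm : MemLp g 2 μ := by
    refine hk.of_le_mul (c := 1 + |ξ - x| / δ) ?_ ?_
    · refine AEStronglyMeasurable.mul (Measurable.aestronglyMeasurable ?_) hk.1
      fun_prop
    · filter_upwards [hiso] with y hy
      rw [hg, norm_mul]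
      gcongr
      rcases hy with rfl | hy
      · simp only [sub_self, div_zero, norm_zero]
        positivity
      · have h0 : 0 < |y - ξ| := hδ.trans_le hy
        rw [norm_div, ← Complex.ofReal_sub, ← Complex.ofReal_sub, Complex.norm_real,
          Complex.norm_real, Real.norm_eq_abs, Real.norm_eq_abs, div_le_iff₀ h0]
        have h1 : |y - x| ≤ |y - ξ| + |ξ - x| := abs_sub_le y ξ x
        have h2 : |ξ - x| ≤ |ξ - x| / δ * |y - ξ| := by
          rw [div_mul_eq_mul_div, le_div_iff₀ hδ]
          exact mul_le_mul_of_nonneg_left hy (abs_nonneg _)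
        linarith
  -- The atom at ξ absorbs a correction that makes g + e orthogonal to the constants.
  set c : ℂ := -(∫ y, g y ∂μ) / μ.real {ξ} with hc
  set e : ℝ → ℂ := ({ξ} : Set ℝ).indicator fun _ => c with he
  have hem : MemLp e 2 μ :=
    memLp_indicator_const 2 (measurableSet_singleton ξ) c (Or.inr (measure_ne_top μ _))
  have hμξ : (μ.real {ξ} : ℂ) ≠ 0 := by
    rw [Complex.ofReal_ne_zero]
    exact (measureReal_ne_zero_iff (measure_ne_top μ _)).mpr hξ
  have hgi : Integrable g μ := hgm.integrable one_le_two
  have hei : Integrable e μ := hem.integrable one_le_two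
  have hint : ∫ y, (g + e) y ∂μ = 0 := by
    have h1 : ∫ y, e y ∂μ = μ.real {ξ} * c := by
      rw [he, integral_indicator (measurableSet_singleton ξ), integral_singleton]
      simp
    simp only [Pi.add_apply]
    rw [integral_add hgi hei, h1, hc]
    field_simp
    ring
  have horth : ∀ Q : ℂ[X], ∫ y, polyFun Q y * (g + e) y ∂μ = 0 := by
    intro Q
    -- With Q = Q(ξ) + (y - ξ)R, the constant part integrates to 0 by the choice of c, and (y -
    -- ξ)R(g + e) = (y - x)R k integrates to a multiple of the value at x, which is 0.
    obtain ⟨R, hR⟩ : (X - C (ξ : ℂ)) ∣ Q - C (Q.eval (ξ : ℂ)) :=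
      dvd_iff_isRoot.mpr (by simp)
    have h1 : ∀ y, polyFun Q y * (g + e) y
        = polyFun ((X - C (x : ℂ)) * R) y * k y + Q.eval (ξ : ℂ) * (g + e) y := by
      intro y
      have h2 : polyFun Q y = (y - ξ) * R.eval (y : ℂ) + Q.eval (ξ : ℂ) := by
        have h3 := congrArg (fun p : ℂ[X] => p.eval (y : ℂ)) hR
        simp only [eval_sub, eval_C, eval_mul, eval_X] at h3
        rw [polyFun]
        linear_combination h3
      have h4 : ((y : ℂ) - ξ) * (g + e) y = (y - x) * k y := by
        rcases eq_or_ne y ξ with rfl | hy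
        · simp [hkξ]
        · have h5 : (y : ℂ) - ξ ≠ 0 := by
            rw [sub_ne_zero]; exact_mod_cast hy
          simp only [Pi.add_apply, hg, he]
          rw [Set.indicator_of_notMem (by simpa using hy), add_zero]
          field_simp
      have h6 : polyFun ((X - C (x : ℂ)) * R) y = (y - x) * R.eval (y : ℂ) := by simp [polyFun]
      rw [h2, h6]
      linear_combination R.eval (y : ℂ) * h4
    simp only [h1]
    have i1 : Integrable (fun y => polyFun ((X - C (x : ℂ)) * R) y * k y) μ :=
      (hμ.memLp_polyFun _).integrable_mul hk
    have i2 : Integrable (fun y => Q.eval (ξ : ℂ) * (g + e) y) μ := (hgi.add hei).const_mul _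
    rw [integral_add i1 i2, integral_const_mul, hint, hrep]
    simp [polyFun]
  have hzero := ae_eq_zero_of_integral_polyFun_mul hμ hdμ (hgm.add hem) horth
  have hkzero : k =ᵐ[μ] 0 := by
    have hxae : ∀ᵐ y ∂μ, y ≠ x := by
      rw [ae_iff]
      simpa using hx0
    filter_upwards [hzero, hxae] with y hy hyx
    rcases eq_or_ne y ξ with rfl | hyξ
    · exact hkξ
    · have h5 : (y : ℂ) - ξ ≠ 0 := by rw [sub_ne_zero]; exact_mod_cast hyξ
      have h6 : (y : ℂ) - x ≠ 0 := by rw [sub_ne_zero]; exact_mod_cast hyx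
      simp only [Pi.add_apply, hg, he] at hy
      rw [Set.indicator_of_notMem (by simpa using hyξ), add_zero] at hy
      simpa [h5, h6] using hy
  have h1 := hrep 1
  have h2 : ∫ y, polyFun 1 y * k y ∂μ = 0 := by
    rw [← integral_zero ℝ ℂ (μ := μ)]
    refine integral_congr_ae ?_
    filter_upwards [hkzero] with y hy
    simp [hy]
  rw [h2] at h1
  have h3 : ν.real {x} ≠ 0 := (measureReal_ne_zero_iff (measure_ne_top ν _)).mpr hx
  simp [polyFun] at h1
  exact h3 (by exact_mod_cast h1.symm)

/-- Two measures with the same moments for which the polynomials are dense coincide if one of them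
is concentrated on isolated atoms and they have a common atom. -/
theorem eq_of_common_atom (hμ : HasMoments μ) (hν : HasMoments ν)
    (hdμ : PolynomialsDense μ) (hdν : PolynomialsDense ν) (h : SameMoments μ ν)
    (hb : ∀ x : ℝ, ∃ C : ℝ≥0∞, C ≠ ⊤ ∧ ∀ P : ℂ[X], ‖polyFun P x‖ₑ ≤ C * eLpNorm (polyFun P) 2 ν)
    {S : Set ℝ} (hS : S.Countable) (hSμ : μ Sᶜ = 0) (hSa : ∀ x ∈ S, μ {x} ≠ 0)
    (hiso : ∀ x ∈ S, ∃ δ : ℝ, 0 < δ ∧ ∀ y ∈ S, y = x ∨ δ ≤ |y - x|)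
    {ξ : ℝ} (hξ : ξ ∈ S) (hξν : ν {ξ} ≠ 0) : ν = μ := by
  have := hμ.isFiniteMeasure
  have := hν.isFiniteMeasure
  have hSν : ν Sᶜ = 0 := by
    by_contra h0
    obtain ⟨a, ha, ha0⟩ := exists_atom hν hdν hb hS.measurableSet.compl h0
    obtain ⟨δ, hδ, hδS⟩ := hiso ξ hξ
    refine measure_singleton_ne_zero hμ hν hdμ hdν h ha0 hξν (hSa ξ hξ) hδ ?_
      (measure_mono_null (Set.singleton_subset_iff.mpr ha) hSμ)
    have hS' : ∀ᵐ y ∂μ, y ∈ S := by rwa [ae_iff]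
    filter_upwards [hS'] with y hy using hδS y hy
  -- As ν lives on the countable set S, it suffices to compare singletons, where
  -- `measure_singleton_le` applies; equality of the zeroth moments then turns ν ≤ μ into equality.
  have hle : ν ≤ μ := by
    refine Measure.le_iff.mpr fun A hA => ?_
    have hc : (A ∩ S).Countable := hS.mono Set.inter_subset_right
    have hsum : ∀ ρ : Measure ℝ, ρ (A ∩ S) = ∑' p : ↑(A ∩ S), ρ {(p : ℝ)} := by
      intro ρ
      conv_lhs => rw [← Set.biUnion_of_singleton (A ∩ S)]
      exact measure_biUnion hc (fun i _ j _ hij => by simpa using hij)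
        fun b _ => measurableSet_singleton b
    calc ν A = ν (A ∩ S) := by
          rw [Set.inter_comm]
          exact (Measure.measure_inter_eq_of_ae (by rwa [ae_iff])).symm
      _ = ∑' p : ↑(A ∩ S), ν {(p : ℝ)} := hsum ν
      _ ≤ ∑' p : ↑(A ∩ S), μ {(p : ℝ)} := ENNReal.tsum_le_tsum fun p =>
          measure_singleton_le hμ hν hdμ h (hSa p p.2.2)
      _ = μ (A ∩ S) := (hsum μ).symm
      _ ≤ μ A := measure_mono Set.inter_subset_left
  refine Measure.eq_of_le_of_measure_univ_eq hle ?_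
  have h1 := h 1
  simp only [polyFun, eval_one, integral_const] at h1
  have h2 : μ.real Set.univ = ν.real Set.univ := by simpa using h1
  exact ((measureReal_eq_measureReal_iff).mp h2).symm

end CommonAtom


/-! ### The discrete measures -/

theorem hasMoments_discreteMeasure {q α : ℝ} (hq0 : 0 < q) (hq1 : q < 1) (hα : 0 < α) :
    HasMoments (discreteMeasure q α) := by
  intro k
  refine ⟨(continuous_pow k).aestronglyMeasurable, ?_⟩
  rw [HasFiniteIntegral, lintegral_discreteMeasure]
  have h := summable_weight_mul_abs_pow hq0 hq1 hα k
  have e : ∀ l : ℤ, ENNReal.ofReal (weight q α l) * ‖massPoint q α l ^ k‖ₑ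
      = ENNReal.ofReal (weight q α l * |massPoint q α l| ^ k) := by
    intro l
    rw [ENNReal.ofReal_mul (weight_pos hq0 hα l).le, ← ofReal_norm, norm_pow, Real.norm_eq_abs]
  simp only [e]
  exact h.tsum_ofReal_lt_top

theorem integral_eval_discreteMeasure {q α : ℝ} (hq0 : 0 < q) (hq1 : q < 1) (hα : 0 < α)
    (P : ℝ[X]) : ∫ x, P.eval x ∂(discreteMeasure q α) = weightSum q α P := by
  have hi : Integrable (fun x => P.eval x) (discreteMeasure q α) := by
    have h := hasMoments_discreteMeasure hq0 hq1 hα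
    induction P using Polynomial.induction_on' with
    | add P Q hP hQ => simpa using! hP.add hQ
    | monomial k c => simpa [eval_monomial] using (h k).const_mul c
  rw [discreteMeasure] at hi ⊢
  rw [integral_sum_measure hi, weightSum]
  refine tsum_congr fun l => ?_
  rw [integral_smul_measure, integral_dirac, ENNReal.toReal_ofReal (weight_pos hq0 hα l).le,
    smul_eq_mul]

theorem discreteMeasure_singleton_ne_zero {q α : ℝ} (hq0 : 0 < q) (hα : 0 < α) (l : ℤ) :
    discreteMeasure q α {massPoint q α l} ≠ 0 := by
  intro h
  rw [discreteMeasure, Measure.sum_apply _ (measurableSet_singleton _), ENNReal.tsum_eq_zero] at h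
  have h1 := h l
  rw [Measure.smul_apply, Measure.dirac_apply_of_mem (Set.mem_singleton _), smul_eq_mul, mul_one,
    ENNReal.ofReal_eq_zero] at h1
  exact absurd (weight_pos hq0 hα l) h1.not_gt

theorem discreteMeasure_compl_range (q α : ℝ) :
    discreteMeasure q α (Set.range (massPoint q α))ᶜ = 0 := by
  have hm : MeasurableSet (Set.range (massPoint q α))ᶜ :=
    (Set.countable_range _).measurableSet.compl
  rw [discreteMeasure, Measure.sum_apply _ hm, ENNReal.tsum_eq_zero]
  intro l
  rw [Measure.smul_apply, Measure.dirac_apply' _ hm, Set.indicator_of_notMem (by simp), smul_zero]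

/-- Every real number is a mass point of one of the discrete measures. -/
theorem exists_massPoint_eq {q : ℝ} (hq0 : 0 < q) (hq1 : q < 1) (ξ : ℝ) :
    ∃ α : ℝ, q < α ∧ α ≤ 1 ∧ ∃ l : ℤ, massPoint q α l = ξ := by
  have hs : √(ξ ^ 2 + 1) ^ 2 = ξ ^ 2 + 1 := Real.sq_sqrt (by positivity)
  -- The positive solution of (1/u - u)/2 = ξ.
  set u := √(ξ ^ 2 + 1) - ξ with hu
  have hu0 : 0 < u := by
    rw [hu, sub_pos]
    exact Real.lt_sqrt_of_sq_lt (by linarith)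
  have hinv : u⁻¹ = √(ξ ^ 2 + 1) + ξ := by
    refine inv_eq_of_mul_eq_one_right ?_
    rw [hu]
    linear_combination hs
  -- From q^{-n} < u ≤ q^{-(n+1)} the number α = uq^{n+1} lies in (q, 1], and u = αq^l with l =
  -- -(n+1).
  obtain ⟨n, h1, h2⟩ := exists_mem_Ioc_zpow hu0 ((one_lt_inv₀ hq0).mpr hq1)
  have hp : 0 < q ^ (n + 1) := by positivity
  refine ⟨u * q ^ (n + 1), ?_, ?_, -(n + 1), ?_⟩
  · have h3 := mul_lt_mul_of_pos_right h1 hp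
    rwa [inv_zpow, zpow_add_one₀ hq0.ne', inv_mul_cancel_left₀ (by positivity),
      ← zpow_add_one₀ hq0.ne'] at h3
  · have h3 := mul_le_mul_of_nonneg_right h2 hp.le
    rwa [inv_zpow, inv_mul_cancel₀ hp.ne'] at h3
  · rw [massPoint, zpow_neg, mul_inv_cancel_right₀ hp.ne', hinv, hu]
    ring

theorem massPoint_strictMono {q α : ℝ} (hq0 : 0 < q) (hq1 : q < 1) (hα : 0 < α) :
    StrictMono (massPoint q α) := by
  refine strictMono_int_of_lt_succ fun l => ?_
  have hu : 0 < α * q ^ l := by positivity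
  have h1 : α * q ^ (l + 1) < α * q ^ l := by
    rw [zpow_add_one₀ hq0.ne', ← mul_assoc]
    exact mul_lt_of_lt_one_right hu hq1
  have h2 : (α * q ^ l)⁻¹ < (α * q ^ (l + 1))⁻¹ := inv_strictAnti₀ (by positivity) h1
  unfold massPoint
  linarith

theorem massPoint_isolated {q α : ℝ} (hq0 : 0 < q) (hq1 : q < 1) (hα : 0 < α) (l : ℤ) :
    ∃ δ : ℝ, 0 < δ ∧ ∀ y ∈ Set.range (massPoint q α), y = massPoint q α l ∨
      δ ≤ |y - massPoint q α l| := by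
  have hm := massPoint_strictMono hq0 hq1 hα
  have h1 := hm (show l < l + 1 by omega)
  have h2 := hm (show l - 1 < l by omega)
  refine ⟨min (massPoint q α (l + 1) - massPoint q α l) (massPoint q α l - massPoint q α (l - 1)),
    lt_min (by linarith) (by linarith), ?_⟩
  rintro _ ⟨m, rfl⟩
  rcases lt_trichotomy m l with h | rfl | h
  · right
    have h3 := hm.monotone (show m ≤ l - 1 by omega)
    rw [abs_of_nonpos (by linarith)]
    exact (min_le_right _ _).trans (by linarith)
  · exact Or.inl rfl
  · right
    have h3 := hm.monotone (show l + 1 ≤ m by omega)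
    rw [abs_of_nonneg (by linarith)]
    exact (min_le_left _ _).trans (by linarith)

/-! ### Moments of the orthogonality measures -/

theorem X_mul_hermite_mem_span {q : ℝ} (n : ℕ) :
    X * hermite q n ∈ Submodule.span ℝ (Set.range (hermite q)) := by
  have hmem : ∀ k, hermite q k ∈ Submodule.span ℝ (Set.range (hermite q)) := fun k =>
    Submodule.subset_span ⟨k, rfl⟩
  have h2 : ∀ P : ℝ[X], (2 : ℝ)⁻¹ • (2 * P) = P := fun P => by
    rw [smul_eq_C_mul, show (2 : ℝ[X]) = C 2 from rfl, ← mul_assoc, ← C_mul]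
    norm_num
  cases n with
  | zero =>
    rw [← h2 (X * hermite q 0)]
    refine Submodule.smul_mem _ _ ?_
    simpa [hermite] using hmem 1
  | succ n =>
    rw [← h2 (X * hermite q (n + 1))]
    refine Submodule.smul_mem _ _ ?_
    rw [show 2 * (X * hermite q (n + 1)) = hermite q (n + 2)
      + ((q ^ (n + 1))⁻¹ * (1 - q ^ (n + 1))) • hermite q n by
        rw [hermite_succ_succ, smul_eq_C_mul]; ring]
    exact Submodule.add_mem _ (hmem _) (Submodule.smul_mem _ _ (hmem _))

/-- The span contains 1 and, by the recurrence, is stable under multiplication by X. -/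
theorem span_hermite (q : ℝ) : Submodule.span ℝ (Set.range (hermite q)) = ⊤ := by
  set W := Submodule.span ℝ (Set.range (hermite q)) with hW
  have hX : ∀ P ∈ W, X * P ∈ W := by
    intro P hP
    induction hP using Submodule.span_induction with
    | mem x h =>
      obtain ⟨n, rfl⟩ := h
      exact X_mul_hermite_mem_span n
    | zero => simp
    | add x y _ _ hx hy => rw [mul_add]; exact W.add_mem hx hy
    | smul c x _ hx => rw [mul_smul_comm]; exact W.smul_mem c hx
  have hpow : ∀ k : ℕ, (X : ℝ[X]) ^ k ∈ W := by
    intro k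
    induction k with
    | zero => exact Submodule.subset_span ⟨0, by simp [hermite]⟩
    | succ k ih => rw [pow_succ']; exact hX _ ih
  refine eq_top_iff.mpr fun P _ => ?_
  induction P using Polynomial.induction_on' with
  | add P Q hP hQ => exact W.add_mem (hP trivial) (hQ trivial)
  | monomial k c =>
    rw [← C_mul_X_pow_eq_monomial, ← smul_eq_C_mul]
    exact W.smul_mem c (hpow k)

theorem integrable_eval {μ : Measure ℝ} (hμ : HasMoments μ) (P : ℝ[X]) :
    Integrable (fun x => P.eval x) μ := by
  induction P using Polynomial.induction_on' with
  | add P Q hP hQ => simpa using! hP.add hQ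
  | monomial k c => simpa [eval_monomial] using (hμ k).const_mul c

/-- The orthogonality determines the moments up to a factor. -/
theorem integral_eval_eq {q α : ℝ} (hq0 : 0 < q) (hq1 : q < 1) (hα : 0 < α) {μ : Measure ℝ}
    (hμ : IsOrthogonalityMeasure (hermite q) μ) (P : ℝ[X]) :
    ∫ x, P.eval x ∂μ = μ.real Set.univ / totalMass q α * weightSum q α P := by
  have hm : HasMoments μ := hμ.integrable_pow
  have hP : P ∈ Submodule.span ℝ (Set.range (hermite q)) := by rw [span_hermite]; trivial
  induction hP using Submodule.span_induction with
  | mem x h =>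
    obtain ⟨n, rfl⟩ := h
    -- For positive degree both sides vanish by orthogonality to h_0 = 1; degree 0 fixes the factor
    -- as the ratio of the total masses.
    cases n with
    | zero =>
      have h1 := weightSum_hermite_sq hq0 hq1 hα 0
      have h2 := (totalMass_pos (α := α) hq0 hq1).ne'
      simp only [hermite, mul_one, zero_mul, Nat.zero_div, pow_zero, inv_one, qPoch_zero,
        one_mul] at h1
      simp only [hermite, h1, eval_one, integral_const, smul_eq_mul, mul_one]
      field_simp
    | succ n =>
      have h1 := weightSum_hermite_of_ne hq0 hq1 hα (show n + 1 ≠ 0 by omega)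
      have h2 := hμ.orthogonal (n + 1) 0 (by omega)
      have h3 : hermite q 0 = 1 := by simp [hermite]
      rw [h3, mul_one] at h1
      simp only [h3, eval_one, mul_one] at h2
      rw [h1, h2, mul_zero]
  | zero => simp [weightSum]
  | add x y _ _ hx hy =>
    rw [weightSum_add hq0 hq1 hα, mul_add, ← hx, ← hy, ← integral_add (integrable_eval hm x)
      (integrable_eval hm y)]
    simp
  | smul c x _ hx =>
    rw [smul_eq_C_mul, weightSum_C_mul, mul_left_comm, ← hx, ← integral_const_mul]
    simp

theorem sameMoments_of_integral_pow {μ ν : Measure ℝ} (hμ : HasMoments μ) (hν : HasMoments ν)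
    (h : ∀ k : ℕ, ∫ x, x ^ k ∂μ = ∫ x, x ^ k ∂ν) : SameMoments μ ν := by
  intro P
  induction P using Polynomial.induction_on' with
  | add P Q hP hQ =>
    have e : polyFun (P + Q) = fun x => polyFun P x + polyFun Q x := by ext x; simp [polyFun]
    rw [e, integral_add (hμ.integrable_polyFun P) (hμ.integrable_polyFun Q), hP, hQ,
      ← integral_add (hν.integrable_polyFun P) (hν.integrable_polyFun Q)]
  | monomial k c =>
    have e : polyFun (monomial k c) = fun x : ℝ => c * ((x ^ k : ℝ) : ℂ) := by
      ext x; simp [polyFun, eval_monomial]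
    simp only [e]
    rw [integral_const_mul, integral_const_mul, integral_complex_ofReal, integral_complex_ofReal,
      h k]

theorem PolynomialsDense.smul {μ : Measure ℝ} (hμ : PolynomialsDense μ) {c : ℝ≥0∞} (hc : c ≠ 0)
    (hct : c ≠ ⊤) : PolynomialsDense (c • μ) := by
  intro f hf ε hε
  have hf' : MemLp f 2 μ := by
    have h := hf.smul_measure (c := c⁻¹) (by simpa using hc)
    rwa [smul_smul, ENNReal.inv_mul_cancel hc hct, one_smul] at h
  have hs : c ^ (1 / (2 : ℝ≥0∞)).toReal ≠ 0 := by simp [hc, hct]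
  have hst : c ^ (1 / (2 : ℝ≥0∞)).toReal ≠ ⊤ := by simp [hc, hct]
  obtain ⟨P, hP⟩ := hμ f hf' (ε / c ^ (1 / (2 : ℝ≥0∞)).toReal) (ENNReal.div_ne_zero.mpr ⟨hε, hst⟩)
  refine ⟨P, ?_⟩
  rw [eLpNorm_smul_measure_of_ne_top ENNReal.ofNat_ne_top, smul_eq_mul]
  exact (mul_le_mul_right hP _).trans (ENNReal.mul_div_le)

theorem HasMoments.smul {μ : Measure ℝ} (hμ : HasMoments μ) {c : ℝ≥0∞} (hct : c ≠ ⊤) :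
    HasMoments (c • μ) := fun k => (hμ k).smul_measure hct

/-! ### The N-extremal measures -/

theorem isNExtremal_smul_discreteMeasure {q α : ℝ} (hq0 : 0 < q) (hq1 : q < 1) (hα : 0 < α)
    (hα1 : α ≤ 1) {c : ℝ≥0∞} (hc : c ≠ 0) (hct : c ≠ ⊤) :
    IsNExtremal (hermite q) (c • discreteMeasure q α) := by
  refine ⟨⟨fun h => ?_, (hasMoments_discreteMeasure hq0 hq1 hα).smul hct, fun n m hnm => ?_⟩,
    (polynomialsDense_discreteMeasure hq0 hq1 hα hα1).smul hc hct⟩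
  · have h1 := congrArg (fun ρ : Measure ℝ => ρ {massPoint q α 0}) h
    simp only [Measure.smul_apply, smul_eq_mul, Measure.coe_zero, Pi.zero_apply, mul_eq_zero] at h1
    exact h1.elim hc (discreteMeasure_singleton_ne_zero hq0 hα 0)
  · have h1 := integral_eval_discreteMeasure hq0 hq1 hα (hermite q n * hermite q m)
    simp only [eval_mul] at h1
    rw [integral_smul_measure, h1, weightSum_hermite_of_ne hq0 hq1 hα hnm, smul_zero]

/-- The atoms of the discrete measures cover the line, which serves twice: it bounds all point
evaluations in L²(ν), so that ν has an atom, and it supplies a discrete measure sharing that atom.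
-/
theorem IsNExtremal.exists_eq_smul {q : ℝ} (hq0 : 0 < q) (hq1 : q < 1) {ν : Measure ℝ}
    (hν : IsNExtremal (hermite q) ν) :
    ∃ α : ℝ, q < α ∧ α ≤ 1 ∧ ∃ c : ℝ≥0∞, c ≠ 0 ∧ c ≠ ⊤ ∧ ν = c • discreteMeasure q α := by
  have hmν : HasMoments ν := hν.isOrthogonalityMeasure.integrable_pow
  have := hmν.isFiniteMeasure
  have hν0 : ν Set.univ ≠ 0 := by
    rw [Ne, Measure.measure_univ_eq_zero]
    exact hν.isOrthogonalityMeasure.ne_zero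
  have hνr : 0 < ν.real Set.univ := ENNReal.toReal_pos hν0 (measure_ne_top ν _)
  have hsame : ∀ α : ℝ, 0 < α → α ≤ 1 → ∃ c : ℝ≥0∞, c ≠ 0 ∧ c ≠ ⊤ ∧
      HasMoments (c • discreteMeasure q α) ∧ SameMoments (c • discreteMeasure q α) ν := by
    intro α hα hα1
    have hZ := totalMass_pos (α := α) hq0 hq1
    have hpos : 0 < ν.real Set.univ / totalMass q α := by positivity
    have hm := (hasMoments_discreteMeasure hq0 hq1 hα).smul
      (c := ENNReal.ofReal (ν.real Set.univ / totalMass q α)) ENNReal.ofReal_ne_top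
    refine ⟨_, by simpa using hpos, ENNReal.ofReal_ne_top, hm,
      sameMoments_of_integral_pow hm hmν fun k => ?_⟩
    have h1 := integral_eval_eq hq0 hq1 hα hν.isOrthogonalityMeasure (X ^ k)
    rw [← integral_eval_discreteMeasure hq0 hq1 hα] at h1
    simp only [eval_pow, eval_X] at h1
    rw [integral_smul_measure, h1, ENNReal.toReal_ofReal hpos.le, smul_eq_mul]
  -- The constant is the inverse square root of the mass at x of a suitably scaled discrete measure;
  -- polynomials have the same L² norm for that measure and for ν.
  have hb : ∀ x : ℝ, ∃ C : ℝ≥0∞, C ≠ ⊤ ∧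
      ∀ P : ℂ[X], ‖polyFun P x‖ₑ ≤ C * eLpNorm (polyFun P) 2 ν := by
    intro x
    obtain ⟨α, hqα, hα1, l, rfl⟩ := exists_massPoint_eq hq0 hq1 x
    have hα := hq0.trans hqα
    obtain ⟨c, hc, hct, hm, hsm⟩ := hsame α hα hα1
    have := hm.isFiniteMeasure
    set s := (c • discreteMeasure q α) {massPoint q α l} ^ (1 / 2 : ℝ) with hs
    have hs0 : s ≠ 0 := by
      simp [hs, hc, discreteMeasure_singleton_ne_zero hq0 hα l]
    have hst : s ≠ ⊤ := ENNReal.rpow_ne_top_of_nonneg (by norm_num) (measure_ne_top _ _)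
    refine ⟨s⁻¹, by simpa using hs0, fun P => ?_⟩
    have h1 := enorm_mul_measure_singleton_le (c • discreteMeasure q α) (polyFun P)
      (massPoint q α l)
    rw [hsm.eLpNorm_eq hm hmν, ← hs] at h1
    rwa [mul_comm, ← div_eq_mul_inv, ENNReal.le_div_iff_mul_le (Or.inl hs0) (Or.inl hst)]
  obtain ⟨ξ, -, hξ⟩ := exists_atom hmν hν.dense hb MeasurableSet.univ hν0
  obtain ⟨α, hqα, hα1, l, rfl⟩ := exists_massPoint_eq hq0 hq1 ξ
  have hα := hq0.trans hqα
  obtain ⟨c, hc, hct, hm, hsm⟩ := hsame α hα hα1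
  refine ⟨α, hqα, hα1, c, hc, hct, ?_⟩
  refine eq_of_common_atom hm hmν
    ((polynomialsDense_discreteMeasure hq0 hq1 hα hα1).smul hc hct) hν.dense hsm hb
    (Set.countable_range (massPoint q α)) ?_ ?_ ?_ ⟨l, rfl⟩ hξ
  · rw [Measure.smul_apply, discreteMeasure_compl_range, smul_zero]
  · rintro _ ⟨m, rfl⟩
    rw [Measure.smul_apply, smul_eq_mul]
    exact mul_ne_zero hc (discreteMeasure_singleton_ne_zero hq0 hα m)
  · rintro _ ⟨m, rfl⟩
    exact massPoint_isolated hq0 hq1 hα m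

end QInvHermite

theorem mainTheorem4 (q : ℝ) (hq0 : 0 < q) (hq1 : q < 1) :
    (∀ α : ℝ, q < α → α ≤ 1 →
      -- spectral decomposition of the compact self-adjoint operator `L`
      (IsCompactOperator (QInvHermite.opL q α hq0) ∧
        IsSelfAdjoint (QInvHermite.opL q α hq0) ∧
        spectrum ℂ (QInvHermite.opL q α hq0) =
          insert (0 : ℂ) (Set.range fun n : ℕ => (q : ℂ) ^ n) ∧
        ¬ Module.End.HasEigenvalue (QInvHermite.opL q α hq0).toLinearMap 0 ∧
        ∃ v : ℕ → QInvHermite.EllTwo,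
          (∀ (n : ℕ) (l : ℤ), v n l = QInvHermite.phi q α ((q : ℂ) ^ n) l) ∧
          (∀ n : ℕ, Module.finrank ℂ
            (Module.End.eigenspace (QInvHermite.opL q α hq0).toLinearMap ((q : ℂ) ^ n)) = 1) ∧
          (∀ n : ℕ, Module.End.eigenspace (QInvHermite.opL q α hq0).toLinearMap ((q : ℂ) ^ n) =
            Submodule.span ℂ {v n}) ∧
          (∀ n : ℕ, ‖v n‖ ^ 2 =
            QInvHermite.qPochInf (-(1 / α ^ 2)) q * QInvHermite.qPochInf q q /
                QInvHermite.qPochInf (-(α ^ 2 * q)) q *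
              α ^ (2 * n + 2) * (q ^ (n * (n + 1) / 2))⁻¹ * QInvHermite.qPoch q q n) ∧
          (∀ n m : ℕ, n ≠ m → inner ℂ (v n) (v m) = 0) ∧
          (Submodule.span ℂ (Set.range v)).topologicalClosure = ⊤) ∧
      -- the eigenvectors in terms of the polynomials
      (∀ (n : ℕ) (l : ℤ), QInvHermite.phi q α ((q : ℂ) ^ n) l =
        ((α ^ n / QInvHermite.qPochInf (-(α ^ 2 * q)) q * √(QInvHermite.weight q α l) *
          (QInvHermite.hermite q n).eval (QInvHermite.massPoint q α l) : ℝ) : ℂ)) ∧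
      -- the discrete orthogonality relations
      (∀ n m : ℕ, HasSum
        (fun l : ℤ => QInvHermite.weight q α l *
          (QInvHermite.hermite q n).eval (QInvHermite.massPoint q α l) *
          (QInvHermite.hermite q m).eval (QInvHermite.massPoint q α l))
        (if n = m then
          (q ^ (n * (n + 1) / 2))⁻¹ * QInvHermite.qPoch q q n *
            (QInvHermite.qPochInf (-α ^ 2) q * QInvHermite.qPochInf (-(q / α ^ 2)) q *
              QInvHermite.qPochInf q q)
          else 0)) ∧
      -- completeness of the polynomials
      QInvHermite.PolynomialsDense (QInvHermite.discreteMeasure q α)) ∧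
    -- every real point carries mass for one of the measures
    (∀ ξ : ℝ, ∃ α : ℝ, q < α ∧ α ≤ 1 ∧ 0 < QInvHermite.discreteMeasure q α {ξ}) ∧
    -- the N-extremal measures are exactly the positive multiples of the discrete measures
    (∀ μ : MeasureTheory.Measure ℝ,
      QInvHermite.IsNExtremal (QInvHermite.hermite q) μ ↔
        ∃ α : ℝ, q < α ∧ α ≤ 1 ∧ ∃ c : ENNReal, c ≠ 0 ∧ c ≠ ⊤ ∧
          μ = c • QInvHermite.discreteMeasure q α) := by
  refine ⟨fun α hqα hα1 => ?_, fun ξ => ?_, fun μ => ⟨fun h => h.exists_eq_smul hq0 hq1, ?_⟩⟩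
  · have hα := hq0.trans hqα
    refine ⟨⟨QInvHermite.isCompactOperator_opL hq0 hq1 hα hα1,
      QInvHermite.isSelfAdjoint_opL q α hq0, QInvHermite.spectrum_opL hq0 hq1 hα hα1,
      QInvHermite.not_hasEigenvalue_opL_zero hq0 hq1 hα hα1, QInvHermite.phiVec hq0 hq1 hα,
      QInvHermite.phiVec_apply hq0 hq1 hα, fun n => ?_, fun n => ?_,
      QInvHermite.norm_phiVec_sq hq0 hq1 hα,
      fun n m hnm => QInvHermite.inner_phiVec_of_ne hq0 hq1 hα hnm,
      QInvHermite.topologicalClosure_span_phiVec hq0 hq1 hα hα1⟩,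
      QInvHermite.phi_eq hq0 hq1 hα, QInvHermite.hasSum_weight_mul_hermite hq0 hq1 hα,
      QInvHermite.polynomialsDense_discreteMeasure hq0 hq1 hα hα1⟩
    · rw [QInvHermite.eigenspace_opL hq0 hq1 hα hα1]
      exact finrank_span_singleton (QInvHermite.hermiteVec_ne_zero hq0 hq1 hα n)
    · rw [QInvHermite.eigenspace_opL hq0 hq1 hα hα1, QInvHermite.span_phiVec_singleton]
  · obtain ⟨α, hqα, hα1, l, rfl⟩ := QInvHermite.exists_massPoint_eq hq0 hq1 ξ
    exact ⟨α, hqα, hα1, pos_iff_ne_zero.mpr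
      (QInvHermite.discreteMeasure_singleton_ne_zero hq0 (hq0.trans hqα) l)⟩
  · rintro ⟨α, hqα, hα1, c, hc, hct, rfl⟩
    exact QInvHermite.isNExtremal_smul_discreteMeasure hq0 hq1 (hq0.trans hqα) hα1 hc hct
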